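/- **Setting.** All manifolds, forms, vector fields, functions and maps are smooth. A *Liouville quadruple* $(M,\omega,X,L)$ consists of a compact symplectic manifold $(M,\omega)$ of dimension $2n$ with boundary, a vector field $X$ with $L_X\omega=\omega$ that points strictly outwards along $\partial M$, and a Lagrangian submanifold $L$ of $M$ such that $X_q\in T_qL$ for all $q\in L$, $L$ is transverse to $\partial M$, and $\partial L=L\cap\partial M$. Put $\lambda=i_X\omega$; it restricts to a contact form on $\partial M$. For a contact form $\alpha$ on $\partial M$, $\mathcal A(\partial M,\alpha,\partial L)$ is the set of the numbers $\int_0^l x^*\alpha$, where $l>0$ and $x:[0,l]\to\partial M$ is an integral curve of the Reeb field of $\alpha$ with $x(0),x(l)\in\partial L$. The *completion* is $\hat M=M\cup\partial M\times[1,\infty)$, $\hat L=L\cup\partial L\times[1,\infty)$, where on $\partial M\times[1,\infty)$ (with coordinate $\rho$ on the second factor) $X$ is extended by $\hat X=\rho\,\partial_\rho$, $\lambda$ by $\hat\lambda=\rho\lambda$, and $\omega$ by $\hat\omega=d\hat\lambda$. For $z\in\partial M$, $\rho>0$, the point $(z,\rho)\in\hat M$ is the image of $z$ under the time $\log\rho$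 flow of $\hat X$. For $H\in C^\infty(\hat M)$ the field $X_H$ is defined by $dH=-i_{X_H}\hat\omega$, and $\mathcal C(H)$ is the set of the integral curves $x:[0,1]\to\hat M$ of $X_H$ with $x(0),x(1)\in\hat L$. A chord $x\in\mathcal C(H)$ is nondegenerate if $\Phi_1(T_{x(0)}\hat L)\cap T_{x(1)}\hat L=0$, where $\Phi_1:T_{x(0)}\hat M\to T_{x(1)}\hat M$ is the linearized time $1$ flow of $X_H$. For a compact set $K\supseteq M$, $\mathcal H_K(\hat M)$ is the set of $H\in C^\infty(\hat M)$ such that $H(z,\rho)=a_H(z)\rho+b_H$ on $\hat M\setminus K$ for some positive $a_H\in C^\infty(\partial M)$ and $b_H\in\mathbb R$; $H$ is *admissible* if it lies in some $\mathcal H_K(\hat M)$, $1\notin\mathcal A(\partial M,a_H^{-1}\lambda,\partial L)$, and all chords in $\mathcal C(H)$ are nondegenerate. A *monotone homotopy* from $H$ to $H'$ (both admissible) is a smooth family $(H^s)_{s\in\mathbb R}$ contained in one $\mathcal H_K(\hat M)$ such that for some $s_0>0$: $H^s=H$ for $s\le -s_0$, $H^s=H'$ for $s\ge s_0$, and for $s\in(-s_0,s_0)$,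 $\partial_sH^s>0$ on $\hat M$ and $\partial_s a_{H^s}>0$ on $\partial M$. $\mathcal J(\hat M)$ is the set of almost complex structures $J$ on $\hat M$ for which $\hat\omega(\cdot,J\cdot)$ is a Riemannian metric. **Lemma 5.1.** Let $(M,\omega,X,L)$ be a Liouville quadruple, and let $M^{\mathrm{in}}\subset M$ be a compact submanifold with boundary, of codimension $0$, such that $(M^{\mathrm{in}},\omega|_{M^{\mathrm{in}}},X|_{M^{\mathrm{in}}},L\cap M^{\mathrm{in}})$ is a Liouville quadruple. Let $R^{\mathrm{in}}$ and $\xi^{\mathrm{in}}=\ker\lambda|_{\partial M^{\mathrm{in}}}$ be the Reeb field and the contact distribution of $(\partial M^{\mathrm{in}},\lambda)$, and let $(z,\rho)$, $z\in\partial M^{\mathrm{in}}$, $0<\rho\le1$, denote the image of $z$ under the time $\log\rho$ flow of $X$; for $v\in T_z\partial M^{\mathrm{in}}$ let $\overline v=(v,0)$ be the corresponding tangent vector at $(z,\rho)$, that is, the image of $v$ under the differential of that flow. Let $H,H'$ be admissible, $(H^s)_s$ a monotone homotopy from $H$ to $H'$, and $(J^s_t)_{s\in\mathbb R,t\in[0,1]}$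 a family of elements of $\mathcal J(\hat M)$. Assume that there are $a\in C^\infty(\mathbb R)$ and $0<\nu<1$ such that 1. for some $s_0>0$, $a(s)=a(-s_0)$ for $s\le-s_0$, $a(s)=a(s_0)$ for $s\ge s_0$, and $a(-s_0),a(s_0)\notin\mathcal A(\partial M^{\mathrm{in}},\lambda,\partial M^{\mathrm{in}}\cap L)$; 2. $H^s(z,\rho)=a(s)(\rho-\nu)$ for all $s\in\mathbb R$, $z\in\partial M^{\mathrm{in}}$, $\nu^{1/2}<\rho\le1$; 3. for all $s\in\mathbb R$, $t\in[0,1]$, $J^s_t$ preserves $\overline{\xi^{\mathrm{in}}}$ and $J^s_t(\partial_\rho)=\rho^{-1}\overline{R^{\mathrm{in}}}$ at all points $(z,\rho)$ with $z\in\partial M^{\mathrm{in}}$, $\nu^{1/2}<\rho\le1$. Let $x_-\in\mathcal C(H)$ and $x_+\in\mathcal C(H')$ have images contained in $M^{\mathrm{in}}$. If a smooth map $u:\mathbb R\times[0,1]\to\hat M$ satisfies $$\partial_su-J^s_t\bigl(\partial_tu-X_{H^s}(u)\bigr)=0,\qquad u(\mathbb R\times\{0,1\})\subset\hat L,\qquad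 u(s,\cdot)\to x_\pm\ \text{uniformly as } s\to\pm\infty,$$ then $u(\mathbb R\times[0,1])\subset M^{\mathrm{in}}$. -/

import Mathlib

open Set Filter Topology Manifold ContDiff

noncomputable section

namespace LiouvilleFloer

section Tensors

variable {m : ℕ} {W : Type*} [TopologicalSpace W] [ChartedSpace (EuclideanSpace ℝ (Fin m)) W]

/-- A (not necessarily smooth) vector field on the `m`-manifold `W`. -/
abbrev VField (m : ℕ) (W : Type*) [TopologicalSpace W]
    [ChartedSpace (EuclideanSpace ℝ (Fin m)) W] :=
  (x : W) → TangentSpace (𝓡 m) x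

/-- A (not necessarily smooth) differential `k`-form on the `m`-manifold `W`. -/
abbrev DForm (m k : ℕ) (W : Type*) [TopologicalSpace W]
    [ChartedSpace (EuclideanSpace ℝ (Fin m)) W] :=
  (x : W) → TangentSpace (𝓡 m) x [⋀^Fin k]→L[ℝ] ℝ

def VField.IsSmooth [IsManifold (𝓡 m) ∞ W] (V : VField m W) : Prop :=
  ContMDiff (𝓡 m) (𝓡 m).tangent ∞ (fun x => (⟨x, V x⟩ : TangentBundle (𝓡 m) W))

/-- The coordinate expression of a `k`-form in the preferred chart at `x₀`: the pullback of the
form by the inverse of that chart. -/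
def DForm.inChart {k : ℕ} (α : DForm m k W) (x₀ : W) :
    EuclideanSpace ℝ (Fin m) → EuclideanSpace ℝ (Fin m) [⋀^Fin k]→L[ℝ] ℝ :=
  fun y => (α ((extChartAt (𝓡 m) x₀).symm y)).compContinuousLinearMap
    (mfderiv (𝓡 m) (𝓡 m) (extChartAt (𝓡 m) x₀).symm y)

def DForm.IsSmooth {k : ℕ} (α : DForm m k W) : Prop :=
  ∀ x₀ : W, ContDiffOn ℝ ∞ (α.inChart x₀) (extChartAt (𝓡 m) x₀).target

/-- Exterior derivative, computed at `x` in the preferred chart at `x`. -/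
def DForm.d {k : ℕ} (α : DForm m k W) : DForm m (k + 1) W :=
  fun x => (extDeriv (α.inChart x) (extChartAt (𝓡 m) x x)).compContinuousLinearMap
    (mfderiv (𝓡 m) (𝓡 m) (extChartAt (𝓡 m) x) x)

/-- Interior product `i_X α = α(X, ·, …, ·)`. -/
def DForm.interior {k : ℕ} (X : VField m W) (α : DForm m (k + 1) W) : DForm m k W :=
  fun x => ContinuousAlternatingMap.curryLeft (E := EuclideanSpace ℝ (Fin m)) (α x) (X x)

/-- Lie derivative of a form, by Cartan's formula `L_X α = d(i_X α) + i_X(dα)`. -/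
def DForm.lie {k : ℕ} (X : VField m W) (α : DForm m (k + 1) W) : DForm m (k + 1) W :=
  fun x => (DForm.interior X α).d x + DForm.interior X α.d x

end Tensors

section Submanifolds

variable {m : ℕ} {W : Type*} [TopologicalSpace W] [ChartedSpace (EuclideanSpace ℝ (Fin m)) W]

/-- Near `p ∈ S`, the set `S` is the regular zero set of a smooth map to `ℝ^c`. -/
def IsInteriorPoint (c : ℕ) (S : Set W) (p : W) : Prop :=
  p ∈ S ∧ ∃ g : W → EuclideanSpace ℝ (Fin c),
    ContMDiff (𝓡 m) 𝓘(ℝ, EuclideanSpace ℝ (Fin c)) ∞ g ∧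
    Function.Surjective (mfderiv (𝓡 m) 𝓘(ℝ, EuclideanSpace ℝ (Fin c)) g p) ∧
    ∀ᶠ q in 𝓝 p, q ∈ S ↔ g q = 0

/-- `S = {g = 0, f ≤ 0}` near `p ∈ S`, where `f p = 0` and `(g, f)` is a smooth map to
`ℝ^c × ℝ` that is a submersion at `p`. -/
def IsBoundaryChart (c : ℕ) (S : Set W) (p : W) (g : W → EuclideanSpace ℝ (Fin c))
    (f : W → ℝ) : Prop :=
  p ∈ S ∧ f p = 0 ∧
  ContMDiff (𝓡 m) 𝓘(ℝ, EuclideanSpace ℝ (Fin c)) ∞ g ∧ ContMDiff (𝓡 m) 𝓘(ℝ, ℝ) ∞ f ∧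
  (∀ (a : EuclideanSpace ℝ (Fin c)) (b : ℝ), ∃ v : TangentSpace (𝓡 m) p,
    mfderiv (𝓡 m) 𝓘(ℝ, EuclideanSpace ℝ (Fin c)) g p v = a ∧
    mfderiv (𝓡 m) 𝓘(ℝ, ℝ) f p v = b) ∧
  ∀ᶠ q in 𝓝 p, q ∈ S ↔ g q = 0 ∧ f q ≤ 0

/-- The boundary of a submanifold with boundary of codimension `c`. -/
def bdry (m c : ℕ) {W : Type*} [TopologicalSpace W] [ChartedSpace (EuclideanSpace ℝ (Fin m)) W]
    (S : Set W) : Set W :=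
  {p | ∃ g f, IsBoundaryChart (m := m) c S p g f}

/-- `S` is a smooth embedded submanifold with (possibly empty) boundary, of codimension `c`. -/
def IsSubmanifold (m c : ℕ) {W : Type*} [TopologicalSpace W]
    [ChartedSpace (EuclideanSpace ℝ (Fin m)) W] (S : Set W) : Prop :=
  ∀ p ∈ S, IsInteriorPoint (m := m) c S p ∨ p ∈ bdry m c S

/-- The tangent space at `p` of a submanifold, possibly with boundary: the span of the velocities
at time `0` of the curves `[0, ε) → S` that start at `p`. -/
def tangentOf (S : Set W) (p : W) : Submodule ℝ (TangentSpace (𝓡 m) p) :=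
  Submodule.span ℝ {v | ∃ c : ℝ → W, c 0 = p ∧ (∀ᶠ t in 𝓝[≥] (0 : ℝ), c t ∈ S) ∧
    HasMFDerivWithinAt 𝓘(ℝ, ℝ) (𝓡 m) c (Ici 0) 0 (ContinuousLinearMap.toSpanSingleton ℝ
      (v : EuclideanSpace ℝ (Fin m)))}

/-- `V` points strictly outwards along the boundary of the codimension `0` submanifold `S`. -/
def PointsOutward (V : VField m W) (S : Set W) : Prop :=
  ∀ p ∈ bdry m 0 S, ∃ g f, IsBoundaryChart (m := m) 0 S p g f ∧
    (0 : ℝ) < mfderiv (𝓡 m) 𝓘(ℝ, ℝ) f p (V p)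

end Submanifolds

section Flows

variable {m : ℕ} {W : Type*} [TopologicalSpace W] [ChartedSpace (EuclideanSpace ℝ (Fin m)) W]

/-- `φ t y` is the flow of `V`, smooth in `(t, y)`, on an open set that contains
`[[0, T]] × {p}` (here `T` may be negative). -/
def IsLocalFlow (V : VField m W) (T : ℝ) (p : W) (φ : ℝ → W → W) : Prop :=
  ∃ U : Set (ℝ × W), IsOpen U ∧ uIcc 0 T ×ˢ {p} ⊆ U ∧
    ContMDiffOn (𝓘(ℝ, ℝ).prod (𝓡 m)) (𝓡 m) ∞ (fun y : ℝ × W => φ y.1 y.2) U ∧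
    (∀ y : W, ((0 : ℝ), y) ∈ U → φ 0 y = y) ∧
    ∀ t y, (t, y) ∈ U →
      HasMFDerivAt 𝓘(ℝ, ℝ) (𝓡 m) (fun r => φ r y) t (ContinuousLinearMap.toSpanSingleton ℝ
        (V (φ t y) : EuclideanSpace ℝ (Fin m)))

/-- The time `T` flow of `V` maps `p` to `q`, and its differential at `p` is `D`. -/
def IsFlowDifferential (V : VField m W) (T : ℝ) (p q : W)
    (D : TangentSpace (𝓡 m) p →L[ℝ] TangentSpace (𝓡 m) q) : Prop :=
  ∃ φ : ℝ → W → W, IsLocalFlow V T p φ ∧ φ T p = q ∧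
    ∀ v : TangentSpace (𝓡 m) p,
      (mfderiv (𝓡 m) (𝓡 m) (φ T) p v : EuclideanSpace ℝ (Fin m)) = D v

/-- `q = Φ(z, ρ)`, where `Φ(z, 1) = z` and `∂_ρ Φ = ρ⁻¹ X(Φ)`; that is, `q` is the image of `z`
under the time `log ρ` flow of `X`. -/
def CylCoord (X : VField m W) (z : W) (ρ : ℝ) (q : W) : Prop :=
  0 < ρ ∧ ∃ γ : ℝ → W, IsMIntegralCurveOn γ X (uIcc 0 (Real.log ρ)) ∧ γ 0 = z ∧
    γ (Real.log ρ) = q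

end Flows

section Contact

variable {m : ℕ} {W : Type*} [TopologicalSpace W] [ChartedSpace (EuclideanSpace ℝ (Fin m)) W]

/-- `v` is the Reeb vector at `z` of the contact form `α` restricted to the hypersurface `S`. -/
def IsReebVector (α : DForm m 1 W) (S : Set W) (z : W) (v : TangentSpace (𝓡 m) z) : Prop :=
  v ∈ tangentOf S z ∧ (∀ w ∈ tangentOf S z, α.d z ![v, w] = 0) ∧ α z ![v] = 1

/-- `x : [0, l] → S` is a Reeb chord of `Λ` in the contact manifold `(S, α)`. -/
def IsReebChord (α : DForm m 1 W) (S Λ : Set W) (l : ℝ) (x : ℝ → W) : Prop :=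
  0 < l ∧ x 0 ∈ Λ ∧ x l ∈ Λ ∧ ∀ t ∈ Icc 0 l, x t ∈ S ∧
    ∃ v : TangentSpace (𝓡 m) (x t), IsReebVector α S (x t) v ∧
      HasMFDerivWithinAt 𝓘(ℝ, ℝ) (𝓡 m) x (Icc 0 l) t (ContinuousLinearMap.toSpanSingleton ℝ
        (v : EuclideanSpace ℝ (Fin m)))

/-- The action spectrum: the set of the integrals `∫ x^* α` over the Reeb chords `x`. -/
def actionSpectrum (α : DForm m 1 W) (S Λ : Set W) : Set ℝ :=
  {A | ∃ l x, IsReebChord α S Λ l x ∧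
    A = ∫ t in (0 : ℝ)..l, α (x t) ![mfderivWithin 𝓘(ℝ, ℝ) (𝓡 m) x (Icc 0 l) t (1 : ℝ)]}

end Contact

section Liouville

variable {n : ℕ} {W : Type*} [TopologicalSpace W]
  [ChartedSpace (EuclideanSpace ℝ (Fin (2 * n))) W]

/-- `(M, Ω|_M, X|_M, L)` is a Liouville quadruple, for a domain `M` of the `2n`-manifold `W`
and smooth `Ω`, `X` given on `W`. -/
structure IsLiouvilleQuadruple (n : ℕ) {W : Type*} [TopologicalSpace W]
    [ChartedSpace (EuclideanSpace ℝ (Fin (2 * n))) W] [IsManifold (𝓡 (2 * n)) ∞ W]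
    (M : Set W) (Ω : DForm (2 * n) 2 W) (X : VField (2 * n) W) (L : Set W) : Prop where
  compact : IsCompact M
  domain : IsSubmanifold (2 * n) 0 M
  smooth_form : Ω.IsSmooth
  closed : ∀ x ∈ M, Ω.d x = 0
  nondegenerate : ∀ x ∈ M, ∀ v, (∀ w, Ω x ![v, w] = 0) → v = 0
  smooth_field : X.IsSmooth
  lie_eq : ∀ x ∈ M, DForm.lie X Ω x = Ω x
  outward : PointsOutward X M
  subset : L ⊆ M
  submanifold : IsSubmanifold (2 * n) n L
  isotropic : ∀ q ∈ L, ∀ v ∈ tangentOf (m := 2 * n) L q, ∀ w ∈ tangentOf (m := 2 * n) L q,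
    Ω q ![v, w] = 0
  field_tangent : ∀ q ∈ L, X q ∈ tangentOf L q
  transverse : ∀ q ∈ L ∩ bdry (2 * n) 0 M,
    tangentOf (m := 2 * n) L q ⊔ tangentOf (bdry (2 * n) 0 M) q = ⊤
  bdry_eq : bdry (2 * n) n L = L ∩ bdry (2 * n) 0 M

/-- `(W, Ω, X)` is the completion `M ∪ ∂M × [1, ∞)` of the Liouville domain `M ⊆ W`:
with `λ = i_X Ω`, the coordinates `(z, ρ) ↦ Φ(z, ρ)` in which `X = ρ ∂_ρ` identify
`∂M × [1, ∞)` with the complement of the interior of `M`, and there `λ = ρ λ|_{∂M}`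
and `Ω = dλ`. -/
structure IsCompletion (n : ℕ) {W : Type*} [TopologicalSpace W]
    [ChartedSpace (EuclideanSpace ℝ (Fin (2 * n))) W]
    (M : Set W) (Ω : DForm (2 * n) 2 W) (X : VField (2 * n) W) : Prop where
  exists_point : ∀ z ∈ bdry (2 * n) 0 M, ∀ ρ : ℝ, 1 ≤ ρ → ∃ q ∉ interior M, CylCoord X z ρ q ∧
    ∃ D, IsFlowDifferential X (Real.log ρ) z q D ∧
      ∀ v ∈ tangentOf (bdry (2 * n) 0 M) z,
        DForm.interior X Ω q ![D v] = ρ * DForm.interior X Ω z ![v]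
  existsUnique_coord : ∀ q ∉ interior M,
    ∃! zρ : W × ℝ, zρ.1 ∈ bdry (2 * n) 0 M ∧ 1 ≤ zρ.2 ∧ CylCoord X zρ.1 zρ.2 q
  exact : ∀ q ∉ interior M, (DForm.interior X Ω).d q = Ω q
  nondegenerate : ∀ q ∉ interior M, ∀ v, (∀ w, Ω q ![v, w] = 0) → v = 0

/-- `L̂ = L ∪ ∂L × [1, ∞)`. -/
def completedLagrangian (X : VField (2 * n) W) (L : Set W) : Set W :=
  L ∪ {q | ∃ z ∈ bdry (2 * n) n L, ∃ ρ : ℝ, 1 ≤ ρ ∧ CylCoord X z ρ q}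

end Liouville

section Hamiltonians

variable {n : ℕ} {W : Type*} [TopologicalSpace W]
  [ChartedSpace (EuclideanSpace ℝ (Fin (2 * n))) W]

/-- The Hamiltonian vector field: the vector field with `dH = - i_{X_H} Ω` (unique for
nondegenerate `Ω`). -/
def hamField (Ω : DForm (2 * n) 2 W) (H : W → ℝ) : VField (2 * n) W :=
  fun x => Classical.epsilon fun ξ : TangentSpace (𝓡 (2 * n)) x =>
    ∀ v : TangentSpace (𝓡 (2 * n)) x,
      (mfderiv (𝓡 (2 * n)) 𝓘(ℝ, ℝ) H x v : ℝ) = - Ω x ![ξ, v]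

/-- `x : [0, 1] → W` is a Hamiltonian chord of `H` with ends on `Lhat`. -/
def IsChord (Ω : DForm (2 * n) 2 W) (Lhat : Set W) (H : W → ℝ) (x : ℝ → W) : Prop :=
  IsMIntegralCurveOn x (hamField Ω H) (Icc 0 1) ∧ x 0 ∈ Lhat ∧ x 1 ∈ Lhat

/-- With `Φ₁` the differential at `x 0` of the time `1` flow of `X_H`, the subspaces
`Φ₁ (T_{x 0} Lhat)` and `T_{x 1} Lhat` intersect in `0`. -/
def IsNondegenerateChord (Ω : DForm (2 * n) 2 W) (Lhat : Set W) (H : W → ℝ) (x : ℝ → W) :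
    Prop :=
  ∃ D, IsFlowDifferential (hamField Ω H) 1 (x 0) (x 1) D ∧
    (tangentOf Lhat (x 0)).map D.toLinearMap ⊓ tangentOf Lhat (x 1) = ⊥

/-- `H(z, ρ) = a(z) ρ + b` outside the compact set `K ⊇ M`, with `a` smooth and positive on
`∂M`. -/
structure IsContactType (M : Set W) (X : VField (2 * n) W) (K : Set W) (H : W → ℝ)
    (a : W → ℝ) (b : ℝ) : Prop where
  smooth : ContMDiff (𝓡 (2 * n)) 𝓘(ℝ, ℝ) ∞ H
  compact : IsCompact K
  subset : M ⊆ K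
  smooth_slope : ContMDiff (𝓡 (2 * n)) 𝓘(ℝ, ℝ) ∞ a
  slope_pos : ∀ z ∈ bdry (2 * n) 0 M, 0 < a z
  eq : ∀ z ∈ bdry (2 * n) 0 M, ∀ ρ : ℝ, ∀ q ∉ K, CylCoord X z ρ q → H q = a z * ρ + b

/-- The form `a⁻¹ λ`, where `λ = i_X Ω`. -/
def rescaledForm (Ω : DForm (2 * n) 2 W) (X : VField (2 * n) W) (a : W → ℝ) :
    DForm (2 * n) 1 W :=
  fun x => (a x)⁻¹ • DForm.interior X Ω x

/-- `H` is an admissible Hamiltonian on the completion of `(M, Ω, X, L)`. -/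
def IsAdmissible (M : Set W) (Ω : DForm (2 * n) 2 W) (X : VField (2 * n) W) (L : Set W)
    (H : W → ℝ) : Prop :=
  (∃ K a b, IsContactType M X K H a b ∧
    (1 : ℝ) ∉ actionSpectrum (rescaledForm Ω X a) (bdry (2 * n) 0 M) (bdry (2 * n) n L)) ∧
  ∀ x, IsChord Ω (completedLagrangian X L) H x →
    IsNondegenerateChord Ω (completedLagrangian X L) H x

/-- `(Hs s)_{s ∈ ℝ}` is a monotone homotopy from `H` to `H'`. -/
def IsMonotoneHomotopy (M : Set W) (X : VField (2 * n) W) (H H' : W → ℝ) (Hs : ℝ → W → ℝ) :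
    Prop :=
  ContMDiff (𝓘(ℝ, ℝ).prod (𝓡 (2 * n))) 𝓘(ℝ, ℝ) ∞ (fun y : ℝ × W => Hs y.1 y.2) ∧
  ∃ (K : Set W) (a : ℝ → W → ℝ) (b : ℝ → ℝ),
    (∀ s, IsContactType M X K (Hs s) (a s) (b s)) ∧
    ∃ s₀ : ℝ, 0 < s₀ ∧ (∀ s ≤ -s₀, Hs s = H) ∧ (∀ s ≥ s₀, Hs s = H') ∧
      ∀ s ∈ Ioo (-s₀) s₀, (∀ x, 0 < deriv (fun r => Hs r x) s) ∧
        ∀ z ∈ bdry (2 * n) 0 M, 0 < deriv (fun r => a r z) s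

/-- `J` is a smooth almost complex structure for which `Ω(·, J ·)` is a Riemannian metric. -/
structure IsCompatible [IsManifold (𝓡 (2 * n)) ∞ W] (Ω : DForm (2 * n) 2 W)
    (J : (x : W) → TangentSpace (𝓡 (2 * n)) x →L[ℝ] TangentSpace (𝓡 (2 * n)) x) : Prop where
  smooth : ∀ V : VField (2 * n) W, V.IsSmooth → VField.IsSmooth (fun x => J x (V x))
  sq : ∀ x v, J x (J x v) = -v
  symm : ∀ x v w, Ω x ![v, J x w] = Ω x ![w, J x v]
  pos : ∀ x v, v ≠ 0 → 0 < Ω x ![v, J x v]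

/-- `J` preserves `ξ̄` and `J ∂_ρ = ρ⁻¹ R̄` at the points `(z, ρ)`, `ρ₀ < ρ ≤ 1`, of the collar
of `∂N`. Here `λ = i_X Ω`, `R` and `ξ = ker λ` are the Reeb vector field and the contact
distribution of `(∂N, λ)`, `∂_ρ = ρ⁻¹ X`, and `v̄ = (v, 0)` is the image of `v ∈ T_z ∂N` under
the differential `D` of `z ↦ Φ(z, ρ)`, the time `log ρ` flow of `X`. -/
def IsContactTypeOnCollar (N : Set W) (Ω : DForm (2 * n) 2 W) (X : VField (2 * n) W) (ρ₀ : ℝ)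
    (J : (x : W) → TangentSpace (𝓡 (2 * n)) x →L[ℝ] TangentSpace (𝓡 (2 * n)) x) : Prop :=
  ∀ z ∈ bdry (2 * n) 0 N, ∀ ρ : ℝ, ρ₀ < ρ → ρ ≤ 1 → ∀ q, CylCoord X z ρ q →
    ∃ D R, IsFlowDifferential X (Real.log ρ) z q D ∧
      IsReebVector (DForm.interior X Ω) (bdry (2 * n) 0 N) z R ∧
      (∀ v ∈ tangentOf (bdry (2 * n) 0 N) z, DForm.interior X Ω z ![v] = 0 →
        ∃ w ∈ tangentOf (bdry (2 * n) 0 N) z, DForm.interior X Ω z ![w] = 0 ∧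
          J q (D v) = D w) ∧
      J q (ρ⁻¹ • X q) = ρ⁻¹ • D R

/-- The strip `ℝ × [0, 1]`. -/
def strip : Set (ℝ × ℝ) := univ ×ˢ Icc 0 1

/-- `u : ℝ × [0, 1] → W` is a Floer trajectory of `(Hs, J)` from `xm` to `xp`: a smooth solution of
`∂_s u - J (∂_t u - X_{Hs}(u)) = 0` with boundary on `Lhat` such that `u(s, ·) → xm` as
`s → -∞` and `u(s, ·) → xp` as `s → ∞`, uniformly on `[0, 1]`. -/
structure IsFloerTrajectory (Ω : DForm (2 * n) 2 W) (Lhat : Set W) (Hs : ℝ → W → ℝ)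
    (J : ℝ → ℝ → (x : W) → TangentSpace (𝓡 (2 * n)) x →L[ℝ] TangentSpace (𝓡 (2 * n)) x)
    (xm xp : ℝ → W) (u : ℝ × ℝ → W) : Prop where
  smooth : ContMDiffOn 𝓘(ℝ, ℝ × ℝ) (𝓡 (2 * n)) ∞ u strip
  floer : ∀ y ∈ strip,
    mfderivWithin 𝓘(ℝ, ℝ × ℝ) (𝓡 (2 * n)) u strip y ((1, 0) : ℝ × ℝ) -
      J y.1 y.2 (u y) (mfderivWithin 𝓘(ℝ, ℝ × ℝ) (𝓡 (2 * n)) u strip y ((0, 1) : ℝ × ℝ) -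
        hamField Ω (Hs y.1) (u y)) = 0
  boundary : ∀ s : ℝ, u (s, 0) ∈ Lhat ∧ u (s, 1) ∈ Lhat
  /- Since `[0, 1]` is compact and `xm`, `xp` are continuous, convergence along
  `atBot ×ˢ 𝓝[Icc 0 1] t` at every `t` is uniform convergence. -/
  tendsto_atBot : ∀ t ∈ Icc (0 : ℝ) 1, Tendsto u (atBot ×ˢ 𝓝[Icc 0 1] t) (𝓝 (xm t))
  tendsto_atTop : ∀ t ∈ Icc (0 : ℝ) 1, Tendsto u (atTop ×ˢ 𝓝[Icc 0 1] t) (𝓝 (xp t))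

end Hamiltonians

end LiouvilleFloer

end

/-!
# Floer strips with ends in a Liouville subdomain stay in the subdomain

Write `λ = i_X Ω` and `N` for the subdomain `Min`, and let `ρ` be the coordinate on the collar of
`∂N` given by the flow of `X`.

*The radial function.* The homotopy satisfies `H^s = a(s) (ρ - ν)` on the collar, and `a` is not
constant, so `ρ` extends to the smooth function `r = (H^s - H^{s'}) / (a(s) - a(s')) + ν` on the whole
manifold (`IsMonotoneHomotopy.exists_radial`). On the collar `dr(X) = r`, and the contact type
condition says that `λ ∘ J = dr` (`IsRadial.liouville_comp_J`).

*The limit chords lie in the interior of `N`* (`chord_notMem_bdry`). On the collar `dr(X_H) = 0`, so a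
chord in `N` that meets `∂N` stays in `∂N`. As `λ(X_H) - H` is constant on the collar, the
linearized flow along such a chord preserves both `λ` and `Ω`, hence maps `X` to `X`. But `X` is
tangent to the completed Lagrangian, so the chord is degenerate.

*The energy estimate* (`cutoff_comp_eq_zero`). Choose a cutoff function `F ≥ 0` that is `1` outside
`N`, a monotone function of `r` near `∂N` inside `N`, and `0` on the rest of `N`, in particular near
the limit chords (`IsRadial.exists_cutoff`). By Floer's equation the vector field
`(F (H^s(u) - λ(∂_t u) + a ν), F λ(∂_s u))` on the strip has as divergence a sum of nonnegative terms,
one of which is `F Ω(∂_s u, J ∂_s u)`. It has bounded support in `s`, and its second component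
vanishes on the boundary of the strip, because `λ` vanishes on velocities of curves in the completed
Lagrangian (`interior_velocity_eq_zero`). So the divergence vanishes, `∂_s u = 0` where `F(u) > 0`, and
`F(u)` does not depend on `s`. Since it vanishes for large `|s|`, it vanishes identically, and `u` takes
values in `N`.

The behaviour of `λ`, `Ω` and `X` under flows, which is used on the collar, along the chords and on
the cylindrical end, comes from Cartan's formula for the pullback of a one-form by a flow
(`IsLocalFlow.form_eq`).
-/

noncomputable section
namespace LiouvilleFloer

/-! ### Pullbacks of differential forms -/

section Pullback
variable {m : ℕ} {W : Type*} [TopologicalSpace W] [ChartedSpace (EuclideanSpace ℝ (Fin m)) W]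

/-- The function `p ↦ α(∂_{e₁} v, …, ∂_{e_k} v)` for a map `v` from (a subset `S` of) a normed space
and constant vectors `e_i`: a coefficient of the pulled back form `v^* α`. -/
def DForm.pullCoeff {P : Type*} [NormedAddCommGroup P] [NormedSpace ℝ P] {k : ℕ}
    (α : DForm m k W) (v : P → W) (S : Set P) (e : Fin k → P) : P → ℝ :=
  fun p => α (v p) (fun i => mfderivWithin 𝓘(ℝ, P) (𝓡 m) v S p (e i))

theorem DForm.congr_point {k : ℕ} (α : DForm m k W) {x y : W} (h : x = y)
    (w : Fin k → EuclideanSpace ℝ (Fin m)) : α x w = α y w := by subst h; rfl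

theorem contDiff_curryLeft {E : Type*} [NormedAddCommGroup E] [NormedSpace ℝ E] (k : ℕ)
    {r : WithTop ℕ∞} :
    ContDiff ℝ r (fun f : E [⋀^Fin (k + 1)]→L[ℝ] ℝ => f.curryLeft) := by
  refine IsBoundedLinearMap.contDiff ⟨⟨fun f g => ?_, fun a f => ?_⟩, 1, one_pos, fun f => ?_⟩
  · simp
  · simp
  · simp

/-- Evaluation of alternating forms on vectors is smooth. -/
theorem ContDiffWithinAt.alternating_apply {P E : Type*} [NormedAddCommGroup P] [NormedSpace ℝ P]
    [NormedAddCommGroup E] [NormedSpace ℝ E] {r : WithTop ℕ∞} {S : Set P} {p : P} :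
    ∀ {k : ℕ} {f : P → E [⋀^Fin k]→L[ℝ] ℝ} {g : Fin k → P → E}, ContDiffWithinAt ℝ r f S p →
      (∀ i, ContDiffWithinAt ℝ r (g i) S p) →
      ContDiffWithinAt ℝ r (fun q => f q (fun i => g i q)) S p := by
  intro k
  induction k with
  | zero =>
    intro f g hf _
    have h := (ContinuousAlternatingMap.apply ℝ E ℝ (ι := Fin 0) ![]).contDiff.comp_contDiffWithinAt hf
      (n := r)
    refine h.congr_of_eventuallyEq (Eventually.of_forall fun q => ?_) ?_
    · simp [Subsingleton.elim (fun i => g i q) ![]]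
    · simp [Subsingleton.elim (fun i => g i p) ![]]
  | succ k ih =>
    intro f g hf hg
    have h1 : ContDiffWithinAt ℝ r (fun q => (f q).curryLeft) S p :=
      (contDiff_curryLeft k).comp_contDiffWithinAt hf
    have h2 := ih (f := fun q => (f q).curryLeft (g 0 q)) (g := fun i => g i.succ)
      (h1.clm_apply (hg 0)) (fun i => hg i.succ)
    refine h2.congr_of_eventuallyEq (Eventually.of_forall fun q => ?_) ?_
    all_goals
      simp only [ContinuousAlternatingMap.curryLeft_apply_apply]
      congr 1
      ext i
      refine Fin.cases ?_ (fun j => ?_) i <;> simp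

section
variable [IsManifold (𝓡 m) ∞ W] {P : Type*} [NormedAddCommGroup P] [NormedSpace ℝ P] {k : ℕ}

theorem hasMFDerivAt_extChartAt_symm {x₀ : W} {y : EuclideanSpace ℝ (Fin m)}
    (hy : y ∈ (extChartAt (𝓡 m) x₀).target) :
    HasMFDerivAt (𝓡 m) (𝓡 m) (extChartAt (𝓡 m) x₀).symm y
      (mfderiv (𝓡 m) (𝓡 m) (extChartAt (𝓡 m) x₀).symm y) := by
  have : IsManifold (𝓡 m) 1 W := IsManifold.of_le (n := ∞) (by simp)
  have := mdifferentiableWithinAt_extChartAt_symm (I := 𝓡 m) hy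
  rw [ModelWithCorners.range_eq_univ, mdifferentiableWithinAt_univ] at this
  exact this.hasMFDerivAt

theorem mfderivWithin_eq_chart {v : P → W} {S : Set P} (x₀ : W) {p : P}
    (hS : UniqueDiffWithinAt ℝ S p)
    (hv : MDifferentiableWithinAt 𝓘(ℝ, P) (𝓡 m) v S p) (hx : v p ∈ (extChartAt (𝓡 m) x₀).source)
    (e : P) :
    (mfderivWithin 𝓘(ℝ, P) (𝓡 m) v S p e : EuclideanSpace ℝ (Fin m)) =
      (mfderiv (𝓡 m) (𝓡 m) (extChartAt (𝓡 m) x₀).symm (extChartAt (𝓡 m) x₀ (v p))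
        (fderivWithin ℝ (extChartAt (𝓡 m) x₀ ∘ v) S p e) : EuclideanSpace ℝ (Fin m)) := by
  have : IsManifold (𝓡 m) 1 W := IsManifold.of_le (n := ∞) (by simp)
  set c := extChartAt (𝓡 m) x₀ with hc
  have h1 : HasMFDerivWithinAt 𝓘(ℝ, P) (𝓡 m) (c ∘ v) S p
      (fderivWithin ℝ (c ∘ v) S p) := by
    have hd : MDifferentiableWithinAt 𝓘(ℝ, P) (𝓡 m) (c ∘ v) S p := by
      refine MDifferentiableAt.comp_mdifferentiableWithinAt (I' := 𝓡 m) p ?_ hv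
      exact mdifferentiableAt_extChartAt (by rwa [hc, extChartAt_source] at hx)
    exact (hd.differentiableWithinAt.hasFDerivWithinAt).hasMFDerivWithinAt
  have h3 := (hasMFDerivAt_extChartAt_symm (c.map_source hx)).comp_hasMFDerivWithinAt p h1
  have h4 : (c.symm ∘ (c ∘ v)) =ᶠ[𝓝[S] p] v := by
    have : ∀ᶠ q in 𝓝[S] p, v q ∈ c.source :=
      hv.continuousWithinAt (extChartAt_source_mem_nhds' hx)
    filter_upwards [this] with q hq using c.left_inv hq
  have h5 := h3.congr_of_eventuallyEq h4.symm (c.left_inv hx).symm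
  exact DFunLike.congr_fun (h5.mfderivWithin hS.uniqueMDiffWithinAt) e

theorem DForm.pullCoeff_eq_inChart (α : DForm m k W) {v : P → W} {S : Set P} (x₀ : W) {p : P}
    (hS : UniqueDiffWithinAt ℝ S p)
    (hv : MDifferentiableWithinAt 𝓘(ℝ, P) (𝓡 m) v S p) (hx : v p ∈ (extChartAt (𝓡 m) x₀).source)
    (e : Fin k → P) :
    α.pullCoeff v S e p = α.inChart x₀ (extChartAt (𝓡 m) x₀ (v p))
      (fun i => fderivWithin ℝ (extChartAt (𝓡 m) x₀ ∘ v) S p (e i)) := by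
  refine Eq.trans ?_ (α.congr_point ((extChartAt (𝓡 m) x₀).left_inv hx).symm _)
  exact congrArg (α (v p)) (funext fun i => mfderivWithin_eq_chart x₀ hS hv hx (e i))

theorem contDiffWithinAt_chart_comp {v : P → W} {S : Set P} (x₀ : W) {p : P}
    (hv : ContMDiffWithinAt 𝓘(ℝ, P) (𝓡 m) ∞ v S p) (hx : v p ∈ (extChartAt (𝓡 m) x₀).source) :
    ContDiffWithinAt ℝ ∞ (extChartAt (𝓡 m) x₀ ∘ v) S p := by
  have h : ContMDiffWithinAt 𝓘(ℝ, P) 𝓘(ℝ, EuclideanSpace ℝ (Fin m)) ∞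
      (extChartAt (𝓡 m) x₀ ∘ v) S p :=
    (contMDiffAt_extChartAt' (by rwa [extChartAt_source] at hx)).comp_contMDiffWithinAt p hv
  exact h.contDiffWithinAt

omit [IsManifold (𝓡 m) ∞ W] in
theorem DForm.IsSmooth.contDiffAt_inChart {α : DForm m k W} (hα : α.IsSmooth) {x₀ x : W}
    (hx : x ∈ (extChartAt (𝓡 m) x₀).source) :
    ContDiffAt ℝ ∞ (α.inChart x₀) (extChartAt (𝓡 m) x₀ x) :=
  (hα x₀).contDiffAt ((isOpen_extChartAt_target x₀).mem_nhds
    ((extChartAt (𝓡 m) x₀).map_source hx))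

/-- The coefficients of the pullback of a smooth form by a smooth map are smooth. -/
theorem DForm.IsSmooth.contDiffOn_pullCoeff {α : DForm m k W} (hα : α.IsSmooth) {v : P → W}
    {S : Set P} (hS : UniqueDiffOn ℝ S) (hv : ContMDiffOn 𝓘(ℝ, P) (𝓡 m) ∞ v S) (e : Fin k → P) :
    ContDiffOn ℝ ∞ (α.pullCoeff v S e) S := by
  intro p hp
  set x₀ := v p
  have hx : v p ∈ (extChartAt (𝓡 m) x₀).source := mem_extChartAt_source _
  have hc := contDiffWithinAt_chart_comp x₀ (hv p hp) hx
  have h1 : ContDiffWithinAt ℝ ∞ (fun q => α.inChart x₀ (extChartAt (𝓡 m) x₀ (v q))) S p :=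
    (hα.contDiffAt_inChart hx).comp_contDiffWithinAt (f := extChartAt (𝓡 m) x₀ ∘ v) p hc
  have h2 : ∀ i, ContDiffWithinAt ℝ ∞
      (fun q => fderivWithin ℝ (extChartAt (𝓡 m) x₀ ∘ v) S q (e i)) S p := fun i =>
    (hc.fderivWithin_right hS (m := ∞) (by simp) hp).clm_apply contDiffWithinAt_const
  have hev : ∀ᶠ q in 𝓝[S] p, v q ∈ (extChartAt (𝓡 m) x₀).source :=
    (hv p hp).continuousWithinAt (extChartAt_source_mem_nhds' hx)
  refine (ContDiffWithinAt.alternating_apply h1 h2).congr_of_eventuallyEq ?_ ?_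
  · filter_upwards [hev, self_mem_nhdsWithin] with q hq hqS
    exact α.pullCoeff_eq_inChart x₀ (hS q hqS) ((hv q hqS).mdifferentiableWithinAt (by simp)) hq e
  · exact α.pullCoeff_eq_inChart x₀ (hS p hp) ((hv p hp).mdifferentiableWithinAt (by simp)) hx e

theorem extDeriv_one_apply {E : Type*} [NormedAddCommGroup E] [NormedSpace ℝ E]
    {η : E → E [⋀^Fin 1]→L[ℝ] ℝ} {x : E} (h : DifferentiableAt ℝ η x) (v w : E) :
    extDeriv η x ![v, w] =
      fderiv ℝ (fun y => η y ![w]) x v - fderiv ℝ (fun y => η y ![v]) x w := by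
  rw [extDeriv_apply h]
  have h1 : (0 : Fin 2).removeNth ![v, w] = ![w] := by
    ext i; fin_cases i; rfl
  have h2 : (1 : Fin 2).removeNth ![v, w] = ![v] := by
    ext i; fin_cases i; rfl
  simp [Fin.sum_univ_two, h1, h2, sub_eq_add_neg]

/-- The exterior derivative commutes with pullback, in coefficients:
`∂_{e₁} (v^*α)(e₂) - ∂_{e₂} (v^*α)(e₁) = (v^* dα)(e₁, e₂)`. -/
theorem DForm.IsSmooth.fderiv_pullCoeff_sub {α : DForm m 1 W} (hα : α.IsSmooth) {v : P → W}
    {S : Set P} (hv : ContMDiffOn 𝓘(ℝ, P) (𝓡 m) ∞ v S) {p : P} (hp : S ∈ 𝓝 p)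
    (e₁ e₂ : P) :
    fderiv ℝ (α.pullCoeff v S ![e₂]) p e₁ - fderiv ℝ (α.pullCoeff v S ![e₁]) p e₂ =
      α.d.pullCoeff v S ![e₁, e₂] p := by
  have : IsManifold (𝓡 m) 1 W := IsManifold.of_le (n := ∞) (by simp)
  set x₀ := v p with hx₀
  have hx : v p ∈ (extChartAt (𝓡 m) x₀).source := mem_extChartAt_source _
  have hvp : ContMDiffAt 𝓘(ℝ, P) (𝓡 m) ∞ v p := (hv p (mem_of_mem_nhds hp)).contMDiffAt hp
  have hc : ContDiffAt ℝ ∞ (extChartAt (𝓡 m) x₀ ∘ v) p := by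
    have := contDiffWithinAt_chart_comp (S := univ) x₀ hvp.contMDiffWithinAt hx
    rwa [contDiffWithinAt_univ] at this
  set c := extChartAt (𝓡 m) x₀ ∘ v with hcdef
  set η := α.inChart x₀ with hη
  have hηs : ContDiffAt ℝ ∞ η (c p) := hα.contDiffAt_inChart hx
  set β : P → P [⋀^Fin 1]→L[ℝ] ℝ := fun q => (η (c q)).compContinuousLinearMap (fderiv ℝ c q)
  have hβ : ∀ᶠ q in 𝓝 p, ∀ e : Fin 1 → P, α.pullCoeff v S e q = β q e := by
    have hev : ∀ᶠ q in 𝓝 p, v q ∈ (extChartAt (𝓡 m) x₀).source :=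
      hvp.continuousAt (extChartAt_source_mem_nhds' hx)
    filter_upwards [hev, eventually_eventually_nhds.mpr hp] with q hq hqS e
    have hqS' : S ∈ 𝓝 q := hqS
    rw [α.pullCoeff_eq_inChart x₀ (uniqueDiffWithinAt_univ.mono_nhds
        (by rw [nhdsWithin_univ, nhdsWithin_eq_nhds.mpr hqS']))
      ((hv q (mem_of_mem_nhds hqS')).mdifferentiableWithinAt (by simp)) hq e,
      fderivWithin_of_mem_nhds hqS']
    rfl
  have hdβ : DifferentiableAt ℝ β p := by
    have h1 : DifferentiableAt ℝ (fun q => η (c q)) p :=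
      (hηs.differentiableAt (by simp)).comp p (hc.differentiableAt (by simp))
    have h2 : DifferentiableAt ℝ (fderiv ℝ c) p :=
      (hc.fderiv_right (m := ∞) (by simp)).differentiableAt (by simp)
    exact (h1.hasFDerivAt.continuousAlternatingMapCompContinuousLinearMap
      h2.hasFDerivAt).differentiableAt
  have hf : ∀ e : Fin 1 → P, fderiv ℝ (α.pullCoeff v S e) p = fderiv ℝ (fun q => β q e) p :=
    fun e => Filter.EventuallyEq.fderiv_eq (hβ.mono fun q hq => hq e)
  rw [hf, hf, ← extDeriv_one_apply hdβ]
  have h3 := extDeriv_pullback (f := c) (x := p) (r := ∞) (hηs.differentiableAt (by simp))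
    hc (by simp only [minSmoothness_of_isRCLikeNormedField]; exact WithTop.coe_le_coe.mpr le_top)
  have h3' : extDeriv β p = (extDeriv η (c p)).compContinuousLinearMap (fderiv ℝ c p) := h3
  rw [h3']
  have h4 : ∀ e : P, (mfderiv (𝓡 m) (𝓡 m) (extChartAt (𝓡 m) x₀) x₀
      (mfderivWithin 𝓘(ℝ, P) (𝓡 m) v S p e) : EuclideanSpace ℝ (Fin m)) = fderiv ℝ c p e := by
    intro e
    have h5 : HasMFDerivAt 𝓘(ℝ, P) (𝓡 m) v p (mfderivWithin 𝓘(ℝ, P) (𝓡 m) v S p) := by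
      rw [mfderivWithin_of_mem_nhds hp]
      exact (hvp.mdifferentiableAt (by simp)).hasMFDerivAt
    have h6 : MDifferentiableAt (𝓡 m) (𝓡 m) (extChartAt (𝓡 m) x₀) (v p) :=
      mdifferentiableAt_extChartAt (mem_chart_source _ _)
    have h7 := h6.hasMFDerivAt.comp p h5
    have h8 := (hc.differentiableAt (by simp)).hasFDerivAt.hasMFDerivAt
    exact DFunLike.congr_fun (hasMFDerivAt_unique h7 h8) e
  simp only [DForm.pullCoeff, DForm.d, ContinuousAlternatingMap.compContinuousLinearMap_apply]
  refine congrArg (extDeriv η (c p)) (funext fun i => ?_)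
  have h8 := h4 (![e₁, e₂] i)
  exact h8.symm

end

end Pullback

/-! ### Linear algebra of two-forms and smooth vector fields -/

section LinearAlgebra
variable {E : Type*} [NormedAddCommGroup E] [NormedSpace ℝ E]

theorem update_vec_zero {β : Type*} (a b x : β) : Function.update ![a, b] 0 x = ![x, b] := by
  ext i; fin_cases i <;> rfl

theorem update_vec_one {β : Type*} (a b x : β) : Function.update ![a, b] 1 x = ![a, x] := by
  ext i; fin_cases i <;> rfl

/-- The bilinear form underlying an alternating `2`-form. -/
def altBilin (f : E [⋀^Fin 2]→L[ℝ] ℝ) : E →ₗ[ℝ] E →ₗ[ℝ] ℝ :=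
  LinearMap.mk₂ ℝ (fun a b => f ![a, b])
    (fun a a' b => by simpa only [update_vec_zero] using f.map_update_add ![a, b] 0 a a')
    (fun r a b => by simpa only [update_vec_zero] using f.map_update_smul ![a, b] 0 r a)
    (fun a b b' => by simpa only [update_vec_one] using f.map_update_add ![a, b] 1 b b')
    (fun r a b => by simpa only [update_vec_one] using f.map_update_smul ![a, b] 1 r b)

theorem altBilin_apply (f : E [⋀^Fin 2]→L[ℝ] ℝ) (a b : E) : altBilin f a b = f ![a, b] := rfl

theorem altBilin_swap (f : E [⋀^Fin 2]→L[ℝ] ℝ) (a b : E) : altBilin f a b = -altBilin f b a := by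
  have := f.toAlternatingMap.map_swap ![b, a] (i := 0) (j := 1) (by simp)
  rw [altBilin_apply, altBilin_apply, ← ContinuousAlternatingMap.coe_toAlternatingMap, ← this]
  congr 1
  ext i
  fin_cases i <;> simp

theorem altBilin_self (f : E [⋀^Fin 2]→L[ℝ] ℝ) (a : E) : altBilin f a a = 0 := by
  have := altBilin_swap f a a
  linarith

/-- A nondegenerate `2`-form on a finite dimensional space represents every covector. -/
theorem exists_altBilin_eq [FiniteDimensional ℝ E] {f : E [⋀^Fin 2]→L[ℝ] ℝ}
    (hf : ∀ v, (∀ w, f ![v, w] = 0) → v = 0) (l : E →ₗ[ℝ] ℝ) : ∃ v, altBilin f v = l := by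
  have hinj : Function.Injective (altBilin f) := by
    rw [← LinearMap.ker_eq_bot, LinearMap.ker_eq_bot']
    exact fun v hv => hf v fun w => DFunLike.congr_fun hv w
  exact (LinearMap.injective_iff_surjective_of_finrank_eq_finrank
    (Subspace.dual_finrank_eq (K := ℝ) (V := E)).symm).mp hinj l

end LinearAlgebra

section
variable {m : ℕ} {W : Type*} [TopologicalSpace W] [ChartedSpace (EuclideanSpace ℝ (Fin m)) W]
  [IsManifold (𝓡 m) ∞ W]

theorem mfderiv_extChartAt_apply {x₀ q : W}
    (hq : q ∈ (chartAt (EuclideanSpace ℝ (Fin m)) x₀).source) (v : TangentSpace (𝓡 m) q) :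
    (mfderiv (𝓡 m) (𝓡 m) (extChartAt (𝓡 m) x₀) q v : EuclideanSpace ℝ (Fin m)) =
      (trivializationAt (EuclideanSpace ℝ (Fin m)) (TangentSpace (𝓡 m)) x₀ ⟨q, v⟩).2 := by
  have : IsManifold (𝓡 m) 1 W := IsManifold.of_le (n := ∞) (by simp)
  refine (DFunLike.congr_fun
    (TangentBundle.continuousLinearMapAt_trivializationAt (I := 𝓡 m) hq) v).symm.trans ?_
  refine (congrFun (Bundle.Trivialization.continuousLinearMapAt_apply ℝ
    (trivializationAt (EuclideanSpace ℝ (Fin m)) (TangentSpace (𝓡 m)) x₀) q) v).trans ?_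
  rw [Bundle.Trivialization.linearMapAt_apply]
  simp [hq]

theorem VField.IsSmooth.contMDiffAt_chart {V : VField m W} (hV : V.IsSmooth) {x₀ x : W}
    (hx : x ∈ (extChartAt (𝓡 m) x₀).source) :
    ContMDiffAt (𝓡 m) 𝓘(ℝ, EuclideanSpace ℝ (Fin m)) ∞
      (fun q => (mfderiv (𝓡 m) (𝓡 m) (extChartAt (𝓡 m) x₀) q (V q) :
        EuclideanSpace ℝ (Fin m))) x := by
  have : IsManifold (𝓡 m) 1 W := IsManifold.of_le (n := ∞) (by simp)
  have hx' : x ∈ (chartAt (EuclideanSpace ℝ (Fin m)) x₀).source := by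
    rwa [extChartAt_source] at hx
  have h := ((trivializationAt (EuclideanSpace ℝ (Fin m)) (TangentSpace (𝓡 m)) x₀).contMDiffAt_section_iff
    (IB := 𝓡 m) (n := ∞) (s := V) (x₀ := x) (by simpa using hx')).mp (hV x)
  refine h.congr_of_eventuallyEq ?_
  filter_upwards [(chartAt (EuclideanSpace ℝ (Fin m)) x₀).open_source.mem_nhds hx'] with q hq
  exact mfderiv_extChartAt_apply hq (V q)

theorem VField.isSmooth_of_chart {V : VField m W}
    (h : ∀ x : W, ContMDiffAt (𝓡 m) 𝓘(ℝ, EuclideanSpace ℝ (Fin m)) ∞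
      (fun q => (mfderiv (𝓡 m) (𝓡 m) (extChartAt (𝓡 m) x) q (V q) :
        EuclideanSpace ℝ (Fin m))) x) : V.IsSmooth := by
  have : IsManifold (𝓡 m) 1 W := IsManifold.of_le (n := ∞) (by simp)
  intro x
  refine ((trivializationAt (EuclideanSpace ℝ (Fin m)) (TangentSpace (𝓡 m)) x).contMDiffAt_section_iff
    (IB := 𝓡 m) (n := ∞) (s := V) (x₀ := x) (by simp)).mpr ?_
  refine (h x).congr_of_eventuallyEq ?_
  filter_upwards [(chartAt (EuclideanSpace ℝ (Fin m)) x).open_source.mem_nhds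
    (mem_chart_source _ x)] with q hq
  exact (mfderiv_extChartAt_apply hq (V q)).symm

theorem contMDiffAt_extChartAt_symm {x₀ : W} {y : EuclideanSpace ℝ (Fin m)}
    (hy : y ∈ (extChartAt (𝓡 m) x₀).target) :
    ContMDiffAt (𝓡 m) (𝓡 m) ∞ (extChartAt (𝓡 m) x₀).symm y :=
  (contMDiffOn_extChartAt_symm (I := 𝓡 m) (n := ∞) x₀).contMDiffAt
    ((isOpen_extChartAt_target x₀).mem_nhds hy)

/-- A vector field read in a chart. -/
def VField.inChart (V : VField m W) (x₀ : W) (y : EuclideanSpace ℝ (Fin m)) :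
    EuclideanSpace ℝ (Fin m) :=
  mfderiv (𝓡 m) (𝓡 m) (extChartAt (𝓡 m) x₀) ((extChartAt (𝓡 m) x₀).symm y)
    (V ((extChartAt (𝓡 m) x₀).symm y))

theorem VField.IsSmooth.contDiffOn_inChart {V : VField m W} (hV : V.IsSmooth) (x₀ : W) :
    ContDiffOn ℝ ∞ (V.inChart x₀) (extChartAt (𝓡 m) x₀).target := by
  intro y hy
  have h := (hV.contMDiffAt_chart ((extChartAt (𝓡 m) x₀).map_target hy)).comp y
    (contMDiffAt_extChartAt_symm hy)
  exact (contMDiffAt_iff_contDiffAt.mp h).contDiffWithinAt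

theorem mfderiv_symm_mfderiv {x₀ : W} {y : EuclideanSpace ℝ (Fin m)}
    (hy : y ∈ (extChartAt (𝓡 m) x₀).target) (v : EuclideanSpace ℝ (Fin m)) :
    (mfderiv (𝓡 m) (𝓡 m) (extChartAt (𝓡 m) x₀).symm y
      (mfderiv (𝓡 m) (𝓡 m) (extChartAt (𝓡 m) x₀) ((extChartAt (𝓡 m) x₀).symm y) v) :
      EuclideanSpace ℝ (Fin m)) = v := by
  have : IsManifold (𝓡 m) 1 W := IsManifold.of_le (n := ∞) (by simp)
  have h := mfderivWithin_extChartAt_symm_comp_mfderiv_extChartAt (I := 𝓡 m) hy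
  rw [ModelWithCorners.range_eq_univ, mfderivWithin_univ] at h
  exact DFunLike.congr_fun h v

theorem mfderiv_mfderiv_symm {x₀ : W} {y : EuclideanSpace ℝ (Fin m)}
    (hy : y ∈ (extChartAt (𝓡 m) x₀).target) (v : EuclideanSpace ℝ (Fin m)) :
    (mfderiv (𝓡 m) (𝓡 m) (extChartAt (𝓡 m) x₀) ((extChartAt (𝓡 m) x₀).symm y)
      (mfderiv (𝓡 m) (𝓡 m) (extChartAt (𝓡 m) x₀).symm y v) :
      EuclideanSpace ℝ (Fin m)) = v := by
  have : IsManifold (𝓡 m) 1 W := IsManifold.of_le (n := ∞) (by simp)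
  have h := mfderiv_extChartAt_comp_mfderivWithin_extChartAt_symm (I := 𝓡 m) hy
  rw [ModelWithCorners.range_eq_univ, mfderivWithin_univ] at h
  exact DFunLike.congr_fun h v

/-- The interior product of a smooth form with a smooth vector field is smooth. -/
theorem DForm.IsSmooth.interior {k : ℕ} {α : DForm m (k + 1) W} (hα : α.IsSmooth) {V : VField m W}
    (hV : V.IsSmooth) : (DForm.interior V α).IsSmooth := by
  intro x₀
  have h : ContDiffOn ℝ ∞ (fun y => (α.inChart x₀ y).curryLeft (V.inChart x₀ y))
      (extChartAt (𝓡 m) x₀).target :=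
    ((contDiff_curryLeft k).comp_contDiffOn (hα x₀)).clm_apply (hV.contDiffOn_inChart x₀)
  refine h.congr fun y hy => ?_
  have h2 := mfderiv_symm_mfderiv hy (V ((extChartAt (𝓡 m) x₀).symm y))
  ext w
  refine Eq.trans ?_ (congrArg (α ((extChartAt (𝓡 m) x₀).symm y)) (?_ :
    Matrix.vecCons (V ((extChartAt (𝓡 m) x₀).symm y) : EuclideanSpace ℝ (Fin m)) (fun i =>
      (mfderiv (𝓡 m) (𝓡 m) (extChartAt (𝓡 m) x₀).symm y (w i) : EuclideanSpace ℝ (Fin m))) = _))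
  · rfl
  · ext1 i
    refine Fin.cases ?_ (fun j => ?_) i
    · exact h2.symm
    · rfl

/-- The derivative of a smooth function along a smooth vector field is smooth. -/
theorem VField.IsSmooth.contMDiff_mfderiv {V : VField m W} (hV : V.IsSmooth) {H : W → ℝ}
    (hH : ContMDiff (𝓡 m) 𝓘(ℝ, ℝ) ∞ H) :
    ContMDiff (𝓡 m) 𝓘(ℝ, ℝ) ∞ (fun x => (mfderiv (𝓡 m) 𝓘(ℝ, ℝ) H x (V x) : ℝ)) := by
  have : IsManifold (𝓡 m) 1 W := IsManifold.of_le (n := ∞) (by simp)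
  exact (contMDiff_snd_tangentBundle_modelSpace ℝ 𝓘(ℝ, ℝ)).comp
    ((hH.contMDiff_tangentMap (m := ∞) (by simp)).comp hV)

end

/-! ### Differentials of functions and Hamiltonian fields -/

/-- The differential of a function on an `m`-manifold, as a covector on the model space. -/
def differential (m : ℕ) {W : Type*} [TopologicalSpace W]
    [ChartedSpace (EuclideanSpace ℝ (Fin m)) W] (K : W → ℝ) (x : W) :
    EuclideanSpace ℝ (Fin m) →L[ℝ] ℝ :=
  mfderiv (𝓡 m) 𝓘(ℝ, ℝ) K x

section
variable {n : ℕ} {W : Type*} [TopologicalSpace W]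
  [ChartedSpace (EuclideanSpace ℝ (Fin (2 * n))) W]

theorem mfderiv_eq_hamField {Ω : DForm (2 * n) 2 W}
    (hnd : ∀ x v, (∀ w, Ω x ![v, w] = 0) → v = 0) (H : W → ℝ) (x : W)
    (v : TangentSpace (𝓡 (2 * n)) x) :
    (mfderiv (𝓡 (2 * n)) 𝓘(ℝ, ℝ) H x v : ℝ) = - Ω x ![hamField Ω H x, v] := by
  have h : ∃ ξ : TangentSpace (𝓡 (2 * n)) x, ∀ v : TangentSpace (𝓡 (2 * n)) x,
      (mfderiv (𝓡 (2 * n)) 𝓘(ℝ, ℝ) H x v : ℝ) = - Ω x ![ξ, v] := by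
    obtain ⟨ξ, hξ⟩ := exists_altBilin_eq (E := EuclideanSpace ℝ (Fin (2 * n))) (f := Ω x)
      (hnd x) (-(mfderiv (𝓡 (2 * n)) 𝓘(ℝ, ℝ) H x :
        EuclideanSpace ℝ (Fin (2 * n)) →L[ℝ] ℝ).toLinearMap)
    refine ⟨ξ, fun v => ?_⟩
    have := DFunLike.congr_fun hξ v
    have hneg : ∀ a b : ℝ, a = -b → b = -a := fun a b hab => by linarith
    exact hneg _ _ this
  exact Classical.epsilon_spec h v

variable [IsManifold (𝓡 (2 * n)) ∞ W]

/-- The Hamiltonian vector field of a smooth function is smooth: in a chart it is obtained from the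
differential by the inverse of a smooth family of invertible linear maps. -/
theorem hamField_isSmooth {Ω : DForm (2 * n) 2 W} (hΩ : Ω.IsSmooth)
    (hnd : ∀ x v, (∀ w, Ω x ![v, w] = 0) → v = 0) {H : W → ℝ}
    (hH : ContMDiff (𝓡 (2 * n)) 𝓘(ℝ, ℝ) ∞ H) : (hamField Ω H).IsSmooth := by
  have hM1 : IsManifold (𝓡 (2 * n)) 1 W := IsManifold.of_le (n := ∞) (by simp)
  refine VField.isSmooth_of_chart fun x₀ => ?_
  set c := extChartAt (𝓡 (2 * n)) x₀ with hc
  let E := EuclideanSpace ℝ (Fin (2 * n))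
  let B : E → E →L[ℝ] (E →L[ℝ] ℝ) := fun y =>
    LinearMap.toContinuousBilinearMap (altBilin (Ω.inChart x₀ y))
  have hB : ∀ y a b, B y a b = Ω.inChart x₀ y ![a, b] := fun y a b => rfl
  have hy₀ : c x₀ ∈ c.target := c.map_source (mem_extChartAt_source _)
  have hBs : ContDiffAt ℝ ∞ B (c x₀) := by
    refine ContDiffOn.contDiffAt (s := c.target) ?_
      ((isOpen_extChartAt_target x₀).mem_nhds hy₀)
    refine contDiffOn_clm_apply.mpr fun a => contDiffOn_clm_apply.mpr fun b => fun y hy => ?_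
    exact ContDiffWithinAt.alternating_apply (hΩ x₀ y hy)
      (g := fun i _ => ![a, b] i) (fun i => contDiffWithinAt_const)
  have hsymm : ∀ (y : E) (a b : E), B y a b = Ω (c.symm y)
      ![mfderiv (𝓡 (2 * n)) (𝓡 (2 * n)) c.symm y a,
        mfderiv (𝓡 (2 * n)) (𝓡 (2 * n)) c.symm y b] := by
    intro y a b
    rw [hB]
    refine congrArg (Ω (c.symm y)) (funext fun i => ?_)
    fin_cases i <;> rfl
  -- nondegeneracy makes `v ↦ Ω(v, ·)` invertible in the chart, and inversion is smooth
  have hequiv : ∀ y ∈ c.target, ∃ e : E ≃L[ℝ] (E →L[ℝ] ℝ), (e : E →L[ℝ] (E →L[ℝ] ℝ)) = B y := by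
    intro y hy
    have hinj : Function.Injective (B y).toLinearMap := by
      rw [← LinearMap.ker_eq_bot, LinearMap.ker_eq_bot']
      intro a ha
      have h0 : (mfderiv (𝓡 (2 * n)) (𝓡 (2 * n)) c.symm y a : E) = 0 := by
        refine hnd (c.symm y) _ fun w => ?_
        have h1 : B y a (mfderiv (𝓡 (2 * n)) (𝓡 (2 * n)) c (c.symm y) w) = 0 := by
          have := DFunLike.congr_fun ha (mfderiv (𝓡 (2 * n)) (𝓡 (2 * n)) c (c.symm y) w)
          simpa using! this
        have h2 := mfderiv_symm_mfderiv hy w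
        refine Eq.trans (congrArg (Ω (c.symm y)) ?_) ((hsymm _ _ _).symm.trans h1)
        exact congrArg (fun z : E => ![(mfderiv (𝓡 (2 * n)) (𝓡 (2 * n)) c.symm y a : E), z]) h2.symm
      have h3 := mfderiv_mfderiv_symm hy a
      refine h3.symm.trans ?_
      refine (congrArg (mfderiv (𝓡 (2 * n)) (𝓡 (2 * n)) c (c.symm y)) h0).trans ?_
      exact map_zero (mfderiv (𝓡 (2 * n)) (𝓡 (2 * n)) c (c.symm y))
    have hfr : Module.finrank ℝ E = Module.finrank ℝ (E →L[ℝ] ℝ) := by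
      rw [← LinearEquiv.finrank_eq (LinearMap.toContinuousLinearMap (𝕜 := ℝ) (E := E) (F' := ℝ))]
      exact (Subspace.dual_finrank_eq (K := ℝ) (V := E)).symm
    have hbij : Function.Bijective (B y).toLinearMap :=
      ⟨hinj, (LinearMap.injective_iff_surjective_of_finrank_eq_finrank hfr).mp hinj⟩
    refine ⟨(LinearEquiv.ofBijective _ hbij).toContinuousLinearEquiv, ?_⟩
    ext a b
    rfl
  have hHs : ContDiffAt ℝ ∞ (fderiv ℝ (H ∘ c.symm)) (c x₀) := by
    have h := (hH (c.symm (c x₀))).comp (c x₀) (contMDiffAt_extChartAt_symm hy₀)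
    exact (contMDiffAt_iff_contDiffAt.mp h).fderiv_right (by simp)
  have hmain : ContDiffAt ℝ ∞ (fun y => (B y).inverse (-(fderiv ℝ (H ∘ c.symm) y))) (c x₀) := by
    obtain ⟨e, he⟩ := hequiv _ hy₀
    have h1 : ContDiffAt ℝ ∞ (fun y => (B y).inverse) (c x₀) := by
      have h2 : ContDiffAt ℝ ∞ ContinuousLinearMap.inverse (B (c x₀)) := by
        rw [← he]; exact contDiffAt_map_inverse e
      exact h2.comp (c x₀) hBs
    exact h1.clm_apply hHs.neg
  have hcx : ContMDiffAt (𝓡 (2 * n)) (𝓡 (2 * n)) ∞ c x₀ := contMDiffAt_extChartAt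
  have hfin := (contMDiffAt_iff_contDiffAt.mpr hmain).comp x₀ hcx
  refine hfin.congr_of_eventuallyEq ?_
  filter_upwards [extChartAt_source_mem_nhds (I := 𝓡 (2 * n)) x₀] with q hq
  have hy : c q ∈ c.target := c.map_source hq
  have hqy : c.symm (c q) = q := c.left_inv hq
  obtain ⟨e, he⟩ := hequiv _ hy
  suffices h : B (c q) (mfderiv (𝓡 (2 * n)) (𝓡 (2 * n)) c q (hamField Ω H q)) =
      -(fderiv ℝ (H ∘ c.symm) (c q)) by
    simp only [Function.comp_apply]
    rw [← h, ← he, ContinuousLinearMap.inverse_equiv]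
    exact (e.symm_apply_apply _).symm
  ext b
  refine (hsymm _ _ _).trans ?_
  have h1 : (mfderiv (𝓡 (2 * n)) (𝓡 (2 * n)) c.symm (c q)
      (mfderiv (𝓡 (2 * n)) (𝓡 (2 * n)) c q (hamField Ω H q)) : E) = hamField Ω H q := by
    have h := mfderiv_symm_mfderiv hy (hamField Ω H q)
    rw [hqy] at h
    exact h
  have h2 : ((fderiv ℝ (H ∘ c.symm) (c q)) b : ℝ) = mfderiv (𝓡 (2 * n)) 𝓘(ℝ, ℝ) H (c.symm (c q))
      (mfderiv (𝓡 (2 * n)) (𝓡 (2 * n)) c.symm (c q) b) := by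
    have h3 := ((hH.mdifferentiableAt (by simp) (x := c.symm (c q))).hasMFDerivAt).comp (c q)
      (hasMFDerivAt_extChartAt_symm hy)
    have h4 := h3.mfderiv
    rw [mfderiv_eq_fderiv] at h4
    exact DFunLike.congr_fun h4 b
  refine Eq.trans ?_ (congrArg Neg.neg h2).symm
  refine Eq.trans ?_ (congrArg Neg.neg (mfderiv_eq_hamField hnd H (c.symm (c q)) _)).symm
  refine Eq.trans ?_ (neg_neg (_ : ℝ)).symm
  refine (Ω.congr_point hqy _).trans (Eq.trans ?_ (Ω.congr_point hqy _).symm)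
  refine congrArg (Ω q) ?_
  have h5 : (hamField Ω H (c.symm (c q)) : E) = hamField Ω H q := by
    rw [hqy]
  exact congrArg₂ (fun z w : E => ![z, w]) (h1.trans h5.symm) rfl

end

/-! ### Flows in charts and the transport of forms -/

section Calculus

theorem eq_exp_mul_of_hasDerivAt {f : ℝ → ℝ} {κ T : ℝ}
    (hf : ∀ t ∈ uIcc 0 T, HasDerivAt f (κ * f t) t) : f T = Real.exp (κ * T) * f 0 := by
  have hg : ∀ t ∈ uIcc 0 T, HasDerivWithinAt (fun t => Real.exp (-(κ * t)) * f t) 0 (uIcc 0 T) t := by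
    intro t ht
    have h1 : HasDerivAt (fun t => Real.exp (-(κ * t))) (Real.exp (-(κ * t)) * -κ) t := by
      have := ((hasDerivAt_id t).const_mul κ).neg.exp
      simpa using this
    convert! (h1.mul (hf t ht)).hasDerivWithinAt using 1
    ring
  have h := (convex_uIcc (0 : ℝ) T).norm_image_sub_le_of_norm_hasDerivWithin_le (C := 0) hg
    (fun t _ => by simp) left_mem_uIcc right_mem_uIcc
  simp only [zero_mul, norm_le_zero_iff, sub_eq_zero] at h
  simp only [mul_zero, neg_zero, Real.exp_zero, one_mul] at h
  rw [← h, ← mul_assoc, ← Real.exp_add]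
  simp

variable {P : Type*} [NormedAddCommGroup P] [NormedSpace ℝ P]

theorem fderiv_fderiv_swap {f : P → ℝ} {p : P} (hf : ContDiffAt ℝ ∞ f p) (e e' : P) :
    fderiv ℝ (fun q => fderiv ℝ f q e) p e' = fderiv ℝ (fun q => fderiv ℝ f q e') p e := by
  have hd : DifferentiableAt ℝ (fderiv ℝ f) p :=
    (hf.fderiv_right (m := ∞) (by simp)).differentiableAt (by simp)
  rw [fderiv_clm_apply hd (differentiableAt_const _), fderiv_clm_apply hd (differentiableAt_const _)]
  simpa using! hf.isSymmSndFDerivAt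
    (by simp only [minSmoothness_of_isRCLikeNormedField]; exact WithTop.coe_le_coe.mpr le_top) e' e

theorem differentiableAt_fderiv_apply {f : P → ℝ} {p : P} (hf : ContDiffAt ℝ ∞ f p) (e : P) :
    DifferentiableAt ℝ (fun q => fderiv ℝ f q e) p :=
  ((hf.fderiv_right (m := ∞) (by simp)).differentiableAt (by simp)).clm_apply
    (differentiableAt_const _)

/-- If `∂₀ bᵢ = κ bᵢ + ∂ᵢ g` for `i = 1, 2`, then the curl of `(b₁, b₂)` grows at the rate `κ`. -/
theorem fderiv_curl_eq {b₁ b₂ g : P → ℝ} {S : Set P} (hS : IsOpen S) (hb₁ : ContDiffOn ℝ ∞ b₁ S)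
    (hb₂ : ContDiffOn ℝ ∞ b₂ S) (hg : ContDiffOn ℝ ∞ g S) {κ : ℝ} {e₀ e₁ e₂ : P}
    (h₁ : ∀ q ∈ S, fderiv ℝ b₁ q e₀ = κ * b₁ q + fderiv ℝ g q e₁)
    (h₂ : ∀ q ∈ S, fderiv ℝ b₂ q e₀ = κ * b₂ q + fderiv ℝ g q e₂) {p : P} (hp : p ∈ S) :
    fderiv ℝ (fun q => fderiv ℝ b₂ q e₁ - fderiv ℝ b₁ q e₂) p e₀ =
      κ * (fderiv ℝ b₂ p e₁ - fderiv ℝ b₁ p e₂) := by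
  have hSp : S ∈ 𝓝 p := hS.mem_nhds hp
  have c₁ := hb₁.contDiffAt hSp
  have c₂ := hb₂.contDiffAt hSp
  have cg := hg.contDiffAt hSp
  have key : ∀ {b : P → ℝ} {e : P}, ContDiffAt ℝ ∞ b p →
      (∀ q ∈ S, fderiv ℝ b q e₀ = κ * b q + fderiv ℝ g q e) → ∀ e',
      fderiv ℝ (fun q => fderiv ℝ b q e') p e₀ =
        κ * fderiv ℝ b p e' + fderiv ℝ (fun q => fderiv ℝ g q e) p e' := by
    intro b e hb h e'
    rw [fderiv_fderiv_swap hb]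
    have hev : (fun q => fderiv ℝ b q e₀) =ᶠ[𝓝 p] fun q => κ * b q + fderiv ℝ g q e := by
      filter_upwards [hSp] with q hq using h q hq
    rw [hev.fderiv_eq, fderiv_fun_add ((hb.differentiableAt (by simp)).const_mul κ)
      (differentiableAt_fderiv_apply cg e), fderiv_const_mul (hb.differentiableAt (by simp))]
    simp
  rw [fderiv_fun_sub (differentiableAt_fderiv_apply c₂ _) (differentiableAt_fderiv_apply c₁ _)]
  rw [sub_apply, key c₂ h₂, key c₁ h₁, fderiv_fderiv_swap cg e₂ e₁]
  ring

end Calculus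

section Flow
variable {m : ℕ} {W : Type*} [TopologicalSpace W] [ChartedSpace (EuclideanSpace ℝ (Fin m)) W]
  {P : Type*} [NormedAddCommGroup P] [NormedSpace ℝ P]

theorem DForm.pullCoeff_one (α : DForm m 1 W) (v : P → W) (S : Set P) (e q : P) :
    α.pullCoeff v S ![e] q = α (v q) ![mfderivWithin 𝓘(ℝ, P) (𝓡 m) v S q e] :=
  congrArg (α (v q)) (funext fun i => by fin_cases i; rfl)

theorem DForm.pullCoeff_two (α : DForm m 2 W) (v : P → W) (S : Set P) (e e' q : P) :
    α.pullCoeff v S ![e, e'] q = α (v q) ![mfderivWithin 𝓘(ℝ, P) (𝓡 m) v S q e,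
      mfderivWithin 𝓘(ℝ, P) (𝓡 m) v S q e'] :=
  congrArg (α (v q)) (funext fun i => by fin_cases i <;> rfl)

variable [IsManifold (𝓡 m) ∞ W]

theorem mfderiv_extChartAt_symm_self (p : W) (w : EuclideanSpace ℝ (Fin m)) :
    (mfderiv (𝓡 m) (𝓡 m) (extChartAt (𝓡 m) p).symm (extChartAt (𝓡 m) p p) w :
      EuclideanSpace ℝ (Fin m)) = w := by
  have : IsManifold (𝓡 m) 1 W := IsManifold.of_le (n := ∞) (by simp)
  have h := mfderivWithin_range_extChartAt_symm (I := 𝓡 m) (x := p)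
  rw [ModelWithCorners.range_eq_univ, mfderivWithin_univ] at h
  exact DFunLike.congr_fun h w

/-- The flow `φ` read in the chart at `p` on the source side. -/
def flowInChart (m : ℕ) {W : Type*} [TopologicalSpace W]
    [ChartedSpace (EuclideanSpace ℝ (Fin m)) W] (φ : ℝ → W → W) (p : W)
    (q : ℝ × EuclideanSpace ℝ (Fin m)) : W :=
  φ q.1 ((extChartAt (𝓡 m) p).symm q.2)

/-- The domain of `flowInChart`, for a flow that is defined on `U`. -/
def flowDomain (m : ℕ) {W : Type*} [TopologicalSpace W]
    [ChartedSpace (EuclideanSpace ℝ (Fin m)) W] (U : Set (ℝ × W)) (p : W) :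
    Set (ℝ × EuclideanSpace ℝ (Fin m)) :=
  (univ ×ˢ (extChartAt (𝓡 m) p).target) ∩
    (fun q => (q.1, (extChartAt (𝓡 m) p).symm q.2)) ⁻¹' U

omit [IsManifold (𝓡 m) ∞ W] in
theorem isOpen_flowDomain {U : Set (ℝ × W)} (hU : IsOpen U) (p : W) :
    IsOpen (flowDomain m U p) := by
  have hc : ContinuousOn (fun q : ℝ × EuclideanSpace ℝ (Fin m) =>
      (q.1, (extChartAt (𝓡 m) p).symm q.2)) (univ ×ˢ (extChartAt (𝓡 m) p).target) := by
    refine continuousOn_fst.prodMk ?_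
    exact (continuousOn_extChartAt_symm p).comp continuousOn_snd fun q hq => hq.2
  exact hc.isOpen_inter_preimage (isOpen_univ.prod (isOpen_extChartAt_target p)) hU

omit [IsManifold (𝓡 m) ∞ W] in
theorem mem_flowDomain {U : Set (ℝ × W)} {p : W} {t : ℝ} (h : (t, p) ∈ U) :
    (t, extChartAt (𝓡 m) p p) ∈ flowDomain m U p := by
  refine ⟨⟨mem_univ _, (extChartAt (𝓡 m) p).map_source (mem_extChartAt_source _)⟩, ?_⟩
  simpa using h

theorem contMDiffOn_flowInChart {U : Set (ℝ × W)} {φ : ℝ → W → W} (p : W)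
    (hφ : ContMDiffOn (𝓘(ℝ, ℝ).prod (𝓡 m)) (𝓡 m) ∞ (fun y : ℝ × W => φ y.1 y.2) U) :
    ContMDiffOn 𝓘(ℝ, ℝ × EuclideanSpace ℝ (Fin m)) (𝓡 m) ∞ (flowInChart m φ p)
      (flowDomain m U p) := by
  refine hφ.comp (f := fun q : ℝ × EuclideanSpace ℝ (Fin m) =>
      ((q.1, (extChartAt (𝓡 m) p).symm q.2) : ℝ × W)) ?_ fun q hq => hq.2
  refine ContMDiffOn.prodMk ?_ ?_
  · exact contDiff_fst.contMDiff.contMDiffOn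
  · exact (contMDiffOn_extChartAt_symm p).comp (t := (extChartAt (𝓡 m) p).target)
      contDiff_snd.contMDiff.contMDiffOn fun q hq => hq.1.2

omit [IsManifold (𝓡 m) ∞ W] in
theorem contMDiffAt_flow {U : Set (ℝ × W)} {φ : ℝ → W → W} (hU : IsOpen U)
    (hφ : ContMDiffOn (𝓘(ℝ, ℝ).prod (𝓡 m)) (𝓡 m) ∞ (fun y : ℝ × W => φ y.1 y.2) U)
    {t : ℝ} {p : W} (h : (t, p) ∈ U) : ContMDiffAt (𝓡 m) (𝓡 m) ∞ (φ t) p := by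
  have h1 : ContMDiffAt (𝓘(ℝ, ℝ).prod (𝓡 m)) (𝓡 m) ∞ (fun y : ℝ × W => φ y.1 y.2) (t, p) :=
    hφ.contMDiffAt (hU.mem_nhds h)
  exact h1.comp (f := fun q : W => ((t, q) : ℝ × W)) p
    (contMDiffAt_const.prodMk contMDiffAt_id)

/-- Spatial derivatives of a flow read in the chart. -/
theorem mfderivWithin_flowInChart_snd {U : Set (ℝ × W)} {φ : ℝ → W → W} (hU : IsOpen U)
    (hφ : ContMDiffOn (𝓘(ℝ, ℝ).prod (𝓡 m)) (𝓡 m) ∞ (fun y : ℝ × W => φ y.1 y.2) U)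
    {t : ℝ} {p : W} (h : (t, p) ∈ U) (w : EuclideanSpace ℝ (Fin m)) :
    (mfderivWithin 𝓘(ℝ, ℝ × EuclideanSpace ℝ (Fin m)) (𝓡 m) (flowInChart m φ p)
      (flowDomain m U p) (t, extChartAt (𝓡 m) p p) (0, w) : EuclideanSpace ℝ (Fin m)) =
      mfderiv (𝓡 m) (𝓡 m) (φ t) p w := by
  set y₀ := extChartAt (𝓡 m) p p with hy₀
  have hmem : (t, y₀) ∈ flowDomain m U p := mem_flowDomain h
  have hnh := (isOpen_flowDomain hU p).mem_nhds hmem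
  rw [mfderivWithin_of_mem_nhds hnh]
  have h1 : HasMFDerivAt 𝓘(ℝ, ℝ × EuclideanSpace ℝ (Fin m)) (𝓡 m) (flowInChart m φ p) (t, y₀)
      (mfderiv 𝓘(ℝ, ℝ × EuclideanSpace ℝ (Fin m)) (𝓡 m) (flowInChart m φ p) (t, y₀)) :=
    (((contMDiffOn_flowInChart p hφ).contMDiffAt hnh).mdifferentiableAt (by simp)).hasMFDerivAt
  have h2 : HasMFDerivAt (𝓡 m) 𝓘(ℝ, ℝ × EuclideanSpace ℝ (Fin m))
      (fun y : EuclideanSpace ℝ (Fin m) => (t, y)) y₀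
      (ContinuousLinearMap.inr ℝ ℝ (EuclideanSpace ℝ (Fin m))) :=
    (hasFDerivAt_prodMk_right t y₀).hasMFDerivAt
  have h3 := h1.comp y₀ h2
  have hp' : (extChartAt (𝓡 m) p).symm y₀ = p := by simp [hy₀]
  have h4 : HasMFDerivAt (𝓡 m) (𝓡 m) (φ t) ((extChartAt (𝓡 m) p).symm y₀)
      (mfderiv (𝓡 m) (𝓡 m) (φ t) ((extChartAt (𝓡 m) p).symm y₀)) := by
    rw [hp']
    exact ((contMDiffAt_flow hU hφ h).mdifferentiableAt (by simp)).hasMFDerivAt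
  have h5 := h4.comp y₀ (hasMFDerivAt_extChartAt_symm
    ((extChartAt (𝓡 m) p).map_source (mem_extChartAt_source _)))
  have h6 := DFunLike.congr_fun (hasMFDerivAt_unique h3 h5) w
  refine Eq.trans h6 ?_
  refine Eq.trans (congrArg (mfderiv (𝓡 m) (𝓡 m) (φ t) ((extChartAt (𝓡 m) p).symm y₀))
    (mfderiv_extChartAt_symm_self p w)) ?_
  rw [hp']

/-- The time derivative of a flow read in the chart. -/
theorem mfderivWithin_flowInChart_fst {V : VField m W} {U : Set (ℝ × W)} {φ : ℝ → W → W}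
    (hU : IsOpen U)
    (hφ : ContMDiffOn (𝓘(ℝ, ℝ).prod (𝓡 m)) (𝓡 m) ∞ (fun y : ℝ × W => φ y.1 y.2) U)
    (hV : ∀ t y, (t, y) ∈ U →
      HasMFDerivAt 𝓘(ℝ, ℝ) (𝓡 m) (fun r => φ r y) t (ContinuousLinearMap.toSpanSingleton ℝ
        (V (φ t y) : EuclideanSpace ℝ (Fin m))))
    {p : W} {q : ℝ × EuclideanSpace ℝ (Fin m)} (hq : q ∈ flowDomain m U p) :
    (mfderivWithin 𝓘(ℝ, ℝ × EuclideanSpace ℝ (Fin m)) (𝓡 m) (flowInChart m φ p)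
      (flowDomain m U p) q (1, 0) : EuclideanSpace ℝ (Fin m)) = V (flowInChart m φ p q) := by
  obtain ⟨t, y⟩ := q
  have hnh := (isOpen_flowDomain hU p).mem_nhds hq
  rw [mfderivWithin_of_mem_nhds hnh]
  have h1 : HasMFDerivAt 𝓘(ℝ, ℝ × EuclideanSpace ℝ (Fin m)) (𝓡 m) (flowInChart m φ p) (t, y)
      (mfderiv 𝓘(ℝ, ℝ × EuclideanSpace ℝ (Fin m)) (𝓡 m) (flowInChart m φ p) (t, y)) :=
    (((contMDiffOn_flowInChart p hφ).contMDiffAt hnh).mdifferentiableAt (by simp)).hasMFDerivAt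
  have h2 : HasMFDerivAt 𝓘(ℝ, ℝ) 𝓘(ℝ, ℝ × EuclideanSpace ℝ (Fin m))
      (fun r : ℝ => (r, y)) t (ContinuousLinearMap.inl ℝ ℝ (EuclideanSpace ℝ (Fin m))) :=
    (hasFDerivAt_prodMk_left t y).hasMFDerivAt
  have h3 := h1.comp t h2
  have h4 := hV t _ hq.2
  have h6 := DFunLike.congr_fun (hasMFDerivAt_unique h3 h4) (1 : ℝ)
  refine Eq.trans h6 ?_
  exact one_smul ℝ (V (φ t ((extChartAt (𝓡 m) p).symm y)) : EuclideanSpace ℝ (Fin m))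

/-- The flow of a vector field `V` with `i_V dα = κ α - dK` (so that
`L_V α = κ α + d(α(V) - K)`) scales `dα` by `exp (κ t)`; it scales `α` in the same way along an
orbit along which `d(α(V) - K)` vanishes. -/
theorem IsLocalFlow.form_eq {α : DForm m 1 W} (hα : α.IsSmooth) {V : VField m W} {K : W → ℝ}
    (hK : ContMDiff (𝓡 m) 𝓘(ℝ, ℝ) ∞ K) {κ : ℝ}
    (hV : ∀ x v, α.d x ![V x, v] = κ * α x ![v] - differential m K x v)
    {T : ℝ} {p : W} {φ : ℝ → W → W} (hφ : IsLocalFlow V T p φ) :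
    (∀ w₁ w₂ : EuclideanSpace ℝ (Fin m), α.d (φ T p)
      ![mfderiv (𝓡 m) (𝓡 m) (φ T) p w₁, mfderiv (𝓡 m) (𝓡 m) (φ T) p w₂] =
        Real.exp (κ * T) * α.d p ![w₁, w₂]) ∧
    ((∀ t ∈ uIcc 0 T, HasMFDerivAt (𝓡 m) 𝓘(ℝ, ℝ) (fun x => α x ![V x] - K x) (φ t p) 0) →
      ∀ w : EuclideanSpace ℝ (Fin m), α (φ T p) ![mfderiv (𝓡 m) (𝓡 m) (φ T) p w] =
        Real.exp (κ * T) * α p ![w]) := by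
  have hM1 : IsManifold (𝓡 m) 1 W := IsManifold.of_le (n := ∞) (by simp)
  obtain ⟨U, hU, hUT, hφs, hφ0, hφV⟩ := hφ
  set y₀ := extChartAt (𝓡 m) p p with hy₀
  set v := flowInChart m φ p with hv
  set S := flowDomain m U p with hSdef
  have hS : IsOpen S := isOpen_flowDomain hU p
  have hvs : ContMDiffOn 𝓘(ℝ, ℝ × EuclideanSpace ℝ (Fin m)) (𝓡 m) ∞ v S :=
    contMDiffOn_flowInChart p hφs
  have hmem : ∀ t ∈ uIcc 0 T, (t, y₀) ∈ S := fun t ht => mem_flowDomain (hUT ⟨ht, rfl⟩)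
  have hUt : ∀ t ∈ uIcc 0 T, (t, p) ∈ U := fun t ht => hUT ⟨ht, rfl⟩
  have hv0 : ∀ t, v (t, y₀) = φ t p := fun t => by simp [hv, flowInChart, hy₀]
  set b : ℝ × EuclideanSpace ℝ (Fin m) → ℝ × EuclideanSpace ℝ (Fin m) → ℝ :=
    fun e => α.pullCoeff v S ![e] with hb
  have hbs : ∀ e, ContDiffOn ℝ ∞ (b e) S := fun e => hα.contDiffOn_pullCoeff hS.uniqueDiffOn hvs _
  have hKv : ContDiffOn ℝ ∞ (K ∘ v) S := (hK.comp_contMDiffOn hvs).contDiffOn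
  set g : ℝ × EuclideanSpace ℝ (Fin m) → ℝ := fun q => b (1, 0) q - K (v q) with hg
  have hgs : ContDiffOn ℝ ∞ g S := (hbs _).sub hKv
  -- Cartan's formula for the pullback of `α` by the flow
  have hcartan : ∀ w, ∀ q ∈ S, fderiv ℝ (b (0, w)) q (1, 0) =
      κ * b (0, w) q + fderiv ℝ g q (0, w) := by
    intro w q hq
    have hSq := hS.mem_nhds hq
    have h1 := hα.fderiv_pullCoeff_sub hvs hSq (1, 0) (0, w)
    have h2 : α.d.pullCoeff v S ![(1, 0), (0, w)] q =
        κ * b (0, w) q - fderiv ℝ (K ∘ v) q (0, w) := by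
      rw [DForm.pullCoeff_two]
      have h3 := mfderivWithin_flowInChart_fst (V := V) hU hφs hφV hq
      refine (congrArg (fun z : EuclideanSpace ℝ (Fin m) => α.d (v q) ![z, _]) h3).trans ?_
      refine (hV (v q) _).trans ?_
      refine congrArg₂ (fun x y : ℝ => κ * x - y) (α.pullCoeff_one v S _ q).symm ?_
      rw [mfderivWithin_of_mem_nhds hSq]
      have h4 := ((hK (v q)).mdifferentiableAt (by simp)).hasMFDerivAt.comp q
        (((hvs.contMDiffAt hSq).mdifferentiableAt (by simp)).hasMFDerivAt)
      have h5 := ((hKv.contDiffAt hSq).differentiableAt (by simp)).hasFDerivAt.hasMFDerivAt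
      exact DFunLike.congr_fun (hasMFDerivAt_unique h4 h5) _
    have h3 : fderiv ℝ g q = fderiv ℝ (b (1, 0)) q - fderiv ℝ (K ∘ v) q :=
      fderiv_fun_sub (((hbs _).contDiffAt hSq).differentiableAt (by simp))
        ((hKv.contDiffAt hSq).differentiableAt (by simp))
    rw [h2] at h1
    rw [h3, sub_apply]
    linarith
  have hline : ∀ f : ℝ × EuclideanSpace ℝ (Fin m) → ℝ, ∀ t, DifferentiableAt ℝ f (t, y₀) →
      HasDerivAt (fun r => f (r, y₀)) (fderiv ℝ f (t, y₀) (1, 0)) t := by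
    intro f t hf
    have h0 : HasFDerivAt (fun r : ℝ => (r, y₀))
        (ContinuousLinearMap.inl ℝ ℝ (EuclideanSpace ℝ (Fin m))) t := hasFDerivAt_prodMk_left t y₀
    have h1 := HasFDerivAt.comp t hf.hasFDerivAt h0
    have h2 := h1.hasDerivAt
    simpa using! h2
  have hD : ∀ t ∈ uIcc 0 T, ∀ w : EuclideanSpace ℝ (Fin m),
      (mfderivWithin 𝓘(ℝ, ℝ × EuclideanSpace ℝ (Fin m)) (𝓡 m) v S (t, y₀) (0, w) :
        EuclideanSpace ℝ (Fin m)) = mfderiv (𝓡 m) (𝓡 m) (φ t) p w :=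
    fun t ht w => mfderivWithin_flowInChart_snd hU hφs (hUt t ht) w
  have hφ0p : φ 0 p = p := hφ0 p (hUt 0 left_mem_uIcc)
  have hD0 : ∀ w : EuclideanSpace ℝ (Fin m),
      (mfderiv (𝓡 m) (𝓡 m) (φ 0) p w : EuclideanSpace ℝ (Fin m)) = w := by
    intro w
    have h1 : HasMFDerivAt (𝓡 m) (𝓡 m) (φ 0) p
        (ContinuousLinearMap.id ℝ (TangentSpace (𝓡 m) p)) := by
      refine (hasMFDerivAt_id p).congr_of_eventuallyEq ?_
      have h2 : ∀ᶠ y in 𝓝 p, ((0 : ℝ), y) ∈ U :=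
        (Continuous.prodMk_right (0 : ℝ)).continuousAt.eventually_mem
          (hU.mem_nhds (hUt 0 left_mem_uIcc))
      filter_upwards [h2] with y hy using hφ0 y hy
    exact DFunLike.congr_fun h1.mfderiv w
  refine ⟨fun w₁ w₂ => ?_, fun hG w => ?_⟩
  · set σ : ℝ × EuclideanSpace ℝ (Fin m) → ℝ := fun q =>
      fderiv ℝ (b (0, w₂)) q (0, w₁) - fderiv ℝ (b (0, w₁)) q (0, w₂) with hσ
    have hode : ∀ t ∈ uIcc 0 T, HasDerivAt (fun r => σ (r, y₀)) (κ * σ (t, y₀)) t := by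
      intro t ht
      have hSt := hS.mem_nhds (hmem t ht)
      have h1 := hline σ t ((differentiableAt_fderiv_apply ((hbs _).contDiffAt hSt) _).sub
        (differentiableAt_fderiv_apply ((hbs _).contDiffAt hSt) _))
      rwa [fderiv_curl_eq hS (hbs _) (hbs _) hgs (hcartan w₁) (hcartan w₂) (hmem t ht)] at h1
    have hval : ∀ t ∈ uIcc 0 T, σ (t, y₀) = α.d (φ t p)
        ![mfderiv (𝓡 m) (𝓡 m) (φ t) p w₁, mfderiv (𝓡 m) (𝓡 m) (φ t) p w₂] := by
      intro t ht
      have h1 := hα.fderiv_pullCoeff_sub hvs (hS.mem_nhds (hmem t ht)) (0, w₁) (0, w₂)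
      refine h1.trans ((α.d.pullCoeff_two v S _ _ _).trans ?_)
      refine (α.d.congr_point (hv0 t) _).trans ?_
      exact congrArg₂ (fun z z' : EuclideanSpace ℝ (Fin m) => α.d (φ t p) ![z, z'])
        (hD t ht w₁) (hD t ht w₂)
    refine (hval T right_mem_uIcc).symm.trans ((eq_exp_mul_of_hasDerivAt hode).trans ?_)
    refine congrArg (Real.exp (κ * T) * ·) ((hval 0 left_mem_uIcc).trans ?_)
    refine (α.d.congr_point hφ0p _).trans ?_
    exact congrArg₂ (fun z z' : EuclideanSpace ℝ (Fin m) => α.d p ![z, z']) (hD0 w₁) (hD0 w₂)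
  · have hode : ∀ t ∈ uIcc 0 T, HasDerivAt (fun r => b (0, w) (r, y₀)) (κ * b (0, w) (t, y₀)) t := by
      intro t ht
      have hSt := hS.mem_nhds (hmem t ht)
      have h1 := hline (b (0, w)) t (((hbs _).contDiffAt hSt).differentiableAt (by simp))
      have hg0 : fderiv ℝ g (t, y₀) = 0 := by
        have h2 : g =ᶠ[𝓝 (t, y₀)] (fun x => α x ![V x] - K x) ∘ v := by
          filter_upwards [hSt] with q hq
          simp only [hg, hb, Function.comp_apply]
          refine congrArg (· - K (v q)) ((α.pullCoeff_one v S _ q).trans ?_)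
          exact congrArg (fun z : EuclideanSpace ℝ (Fin m) => α (v q) ![z])
            (mfderivWithin_flowInChart_fst (V := V) hU hφs hφV hq)
        rw [h2.fderiv_eq]
        have h3 : HasMFDerivAt (𝓡 m) 𝓘(ℝ, ℝ) (fun x => α x ![V x] - K x) (v (t, y₀)) 0 := by
          rw [hv0]; exact hG t ht
        have h4 := h3.comp (t, y₀)
          (((hvs.contMDiffAt hSt).mdifferentiableAt (by simp)).hasMFDerivAt)
        have h5 := h4.mfderiv
        rw [mfderiv_eq_fderiv] at h5
        exact h5.trans (ContinuousLinearMap.ext fun z => rfl)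
      rw [hcartan w _ (hmem t ht), hg0] at h1
      simpa using h1
    have hval : ∀ t ∈ uIcc 0 T, b (0, w) (t, y₀) =
        α (φ t p) ![mfderiv (𝓡 m) (𝓡 m) (φ t) p w] := by
      intro t ht
      refine (α.pullCoeff_one v S _ _).trans ?_
      refine (α.congr_point (hv0 t) _).trans ?_
      exact congrArg (fun z : EuclideanSpace ℝ (Fin m) => α (φ t p) ![z]) (hD t ht w)
    refine (hval T right_mem_uIcc).symm.trans ((eq_exp_mul_of_hasDerivAt hode).trans ?_)
    refine congrArg (Real.exp (κ * T) * ·) ((hval 0 left_mem_uIcc).trans ?_)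
    refine (α.congr_point hφ0p _).trans ?_
    exact congrArg (fun z : EuclideanSpace ℝ (Fin m) => α p ![z]) (hD0 w)

end Flow

/-! ### Curves, boundary charts and tangent spaces -/

section
variable {m : ℕ} {W : Type*} [TopologicalSpace W] [ChartedSpace (EuclideanSpace ℝ (Fin m)) W]

theorem hasDerivWithinAt_comp_curve {G : W → ℝ} {c : ℝ → W} {s : Set ℝ} {t : ℝ}
    {w : EuclideanSpace ℝ (Fin m)} (hG : MDifferentiableAt (𝓡 m) 𝓘(ℝ, ℝ) G (c t))
    (hc : HasMFDerivWithinAt 𝓘(ℝ, ℝ) (𝓡 m) c s t (ContinuousLinearMap.toSpanSingleton ℝ w)) :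
    HasDerivWithinAt (fun r => G (c r)) (differential m G (c t) w) s t := by
  have h1 := (hG.hasMFDerivAt.comp_hasMFDerivWithinAt t hc)
  have h2 : HasFDerivWithinAt (G ∘ c) (ContinuousLinearMap.toSpanSingleton ℝ
      (differential m G (c t) w)) s t := by
    refine (hasMFDerivWithinAt_iff_hasFDerivWithinAt.mp h1).congr_fderiv ?_
    refine ContinuousLinearMap.ext fun z => ?_
    exact (differential m G (c t)).map_smul z w
  have h3 := h2.hasDerivWithinAt
  simpa using! h3

theorem hasDerivAt_comp_curve {G : W → ℝ} {c : ℝ → W} {t : ℝ}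
    {w : EuclideanSpace ℝ (Fin m)} (hG : MDifferentiableAt (𝓡 m) 𝓘(ℝ, ℝ) G (c t))
    (hc : HasMFDerivAt 𝓘(ℝ, ℝ) (𝓡 m) c t (ContinuousLinearMap.toSpanSingleton ℝ w)) :
    HasDerivAt (fun r => G (c r)) (differential m G (c t) w) t := by
  rw [← hasDerivWithinAt_univ]
  exact hasDerivWithinAt_comp_curve hG hc.hasMFDerivWithinAt

variable [IsManifold (𝓡 m) ∞ W]

/-- A curve in the chart at `p` gives a curve in the manifold with the same velocity at `p`. -/
theorem hasMFDerivAt_symm_comp {p : W} {l : ℝ → EuclideanSpace ℝ (Fin m)}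
    {w : EuclideanSpace ℝ (Fin m)} (h0 : l 0 = extChartAt (𝓡 m) p p) (hl : HasDerivAt l w 0) :
    HasMFDerivAt 𝓘(ℝ, ℝ) (𝓡 m) (fun r => (extChartAt (𝓡 m) p).symm (l r)) 0
      (ContinuousLinearMap.toSpanSingleton ℝ w) := by
  have h1 : HasMFDerivAt (𝓡 m) (𝓡 m) (extChartAt (𝓡 m) p).symm (l 0)
      (mfderiv (𝓡 m) (𝓡 m) (extChartAt (𝓡 m) p).symm (l 0)) :=
    hasMFDerivAt_extChartAt_symm (by
      rw [h0]; exact (extChartAt (𝓡 m) p).map_source (mem_extChartAt_source _))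
  have h2 := h1.comp (0 : ℝ) hl.hasFDerivAt.hasMFDerivAt
  let A : EuclideanSpace ℝ (Fin m) →L[ℝ] EuclideanSpace ℝ (Fin m) :=
    mfderiv (𝓡 m) (𝓡 m) (extChartAt (𝓡 m) p).symm (l 0)
  have h3 : A w = w := by
    have h3 := mfderiv_extChartAt_symm_self p w
    rw [← h0] at h3
    exact h3
  have h4 : ContinuousLinearMap.toSpanSingleton ℝ w =
      A.comp (ContinuousLinearMap.toSpanSingleton ℝ w) := by
    ext
    simp [h3]
  exact h2.congr_mfderiv h4.symm

/-- The straight line in the chart at `p` with velocity `w`. -/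
def chartLine (m : ℕ) {W : Type*} [TopologicalSpace W]
    [ChartedSpace (EuclideanSpace ℝ (Fin m)) W] (p : W) (w : EuclideanSpace ℝ (Fin m)) (r : ℝ) : W :=
  (extChartAt (𝓡 m) p).symm (extChartAt (𝓡 m) p p + r • w)

omit [IsManifold (𝓡 m) ∞ W] in
theorem chartLine_zero (p : W) (w : EuclideanSpace ℝ (Fin m)) : chartLine m p w 0 = p := by
  simp [chartLine]

theorem hasMFDerivAt_chartLine (p : W) (w : EuclideanSpace ℝ (Fin m)) :
    HasMFDerivAt 𝓘(ℝ, ℝ) (𝓡 m) (chartLine m p w) 0 (ContinuousLinearMap.toSpanSingleton ℝ w) := by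
  refine hasMFDerivAt_symm_comp (l := fun r => extChartAt (𝓡 m) p p + r • w) (by simp) ?_
  simpa using ((hasDerivAt_id (0 : ℝ)).smul_const w).const_add (extChartAt (𝓡 m) p p)

theorem hasDerivAt_chartLine {G : W → ℝ} {p : W} (hG : MDifferentiableAt (𝓡 m) 𝓘(ℝ, ℝ) G p)
    (w : EuclideanSpace ℝ (Fin m)) :
    HasDerivAt (fun r => G (chartLine m p w r)) (differential m G p w) 0 := by
  have h := hasDerivAt_comp_curve (G := G) (by rwa [chartLine_zero]) (hasMFDerivAt_chartLine p w)
  rwa [chartLine_zero] at h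

theorem tendsto_chartLine (p : W) (w : EuclideanSpace ℝ (Fin m)) :
    Tendsto (chartLine m p w) (𝓝 0) (𝓝 p) := by
  have h := (hasMFDerivAt_chartLine p w).continuousAt
  rwa [ContinuousAt, chartLine_zero] at h

omit [IsManifold (𝓡 m) ∞ W] in
theorem IsInteriorPoint.mem_nhds {N : Set W} {p : W} (h : IsInteriorPoint (m := m) 0 N p) :
    N ∈ 𝓝 p := by
  obtain ⟨-, g, -, -, hg⟩ := h
  filter_upwards [hg] with q hq using hq.mpr (Subsingleton.elim _ _)

omit [IsManifold (𝓡 m) ∞ W] in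
theorem IsBoundaryChart.eventually_iff {N : Set W} {p : W} {g : W → EuclideanSpace ℝ (Fin 0)}
    {f : W → ℝ} (h : IsBoundaryChart (m := m) 0 N p g f) : ∀ᶠ q in 𝓝 p, q ∈ N ↔ f q ≤ 0 := by
  filter_upwards [h.2.2.2.2.2] with q hq
  rw [hq]
  exact and_iff_right (Subsingleton.elim _ _)

omit [IsManifold (𝓡 m) ∞ W] in
theorem IsBoundaryChart.exists_differential {N : Set W} {p : W} {g : W → EuclideanSpace ℝ (Fin 0)}
    {f : W → ℝ} (h : IsBoundaryChart (m := m) 0 N p g f) : ∃ v, differential m f p v = 1 := by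
  obtain ⟨v, -, hv⟩ := h.2.2.2.2.1 0 1
  exact ⟨v, hv⟩

omit [IsManifold (𝓡 m) ∞ W] in
theorem IsBoundaryChart.mdifferentiableAt {c : ℕ} {N : Set W} {p : W}
    {g : W → EuclideanSpace ℝ (Fin c)} {f : W → ℝ} (h : IsBoundaryChart (m := m) c N p g f) (q : W) :
    MDifferentiableAt (𝓡 m) 𝓘(ℝ, ℝ) f q := (h.2.2.2.1 q).mdifferentiableAt (by simp)

theorem eventually_pos_of_hasDerivAt {h : ℝ → ℝ} {d : ℝ} (hd : HasDerivAt h d 0) (h0 : h 0 = 0)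
    (hpos : 0 < d) : (∀ᶠ r in 𝓝[>] 0, 0 < h r) ∧ ∀ᶠ r in 𝓝[<] 0, h r < 0 := by
  have h1 := hasDerivAt_iff_tendsto_slope.mp hd
  have h2 : ∀ᶠ r in 𝓝[≠] (0 : ℝ), 0 < slope h 0 r := h1.eventually_const_lt hpos
  constructor
  · filter_upwards [h2.filter_mono (nhdsWithin_mono _ fun x hx => ne_of_gt hx),
      self_mem_nhdsWithin] with r hr hr0
    simp only [slope_def_field, h0, sub_zero] at hr
    have := mul_pos hr (mem_Ioi.mp hr0)
    rwa [div_mul_cancel₀ _ (ne_of_gt hr0)] at this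
  · filter_upwards [h2.filter_mono (nhdsWithin_mono _ fun x hx => ne_of_lt hx),
      self_mem_nhdsWithin] with r hr hr0
    simp only [slope_def_field, h0, sub_zero] at hr
    have := mul_neg_of_pos_of_neg hr (mem_Iio.mp hr0)
    rwa [div_mul_cancel₀ _ (ne_of_lt hr0)] at this

theorem IsBoundaryChart.notMem_nhds {N : Set W} {p : W} {g : W → EuclideanSpace ℝ (Fin 0)}
    {f : W → ℝ} (h : IsBoundaryChart (m := m) 0 N p g f) : N ∉ 𝓝 p := by
  intro hN
  obtain ⟨v, hv⟩ := h.exists_differential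
  have h1 := hasDerivAt_chartLine (h.mdifferentiableAt p) v
  rw [hv] at h1
  have h2 := (eventually_pos_of_hasDerivAt h1 (by rw [chartLine_zero]; exact h.2.1) one_pos).1
  have h3 := ((tendsto_chartLine p v).mono_left (nhdsWithin_le_nhds (s := Ioi 0))).eventually
    (h.eventually_iff.and hN)
  obtain ⟨r, hr1, hr2, hr3⟩ := (h2.and (h3 : ∀ᶠ r in 𝓝[>] (0 : ℝ), _)).exists
  exact absurd (hr2.mp hr3) (not_le.mpr hr1)

/-- The boundary of a domain is its topological boundary. -/
theorem bdry_eq_diff_interior {N : Set W} (hN : IsSubmanifold m 0 N) :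
    bdry m 0 N = N \ interior N := by
  ext p
  constructor
  · rintro ⟨g, f, h⟩
    exact ⟨h.1, fun hi => h.notMem_nhds (mem_interior_iff_mem_nhds.mp hi)⟩
  · rintro ⟨hp, hi⟩
    exact (hN p hp).resolve_left fun h => hi (mem_interior_iff_mem_nhds.mpr h.mem_nhds)

/-- A function that is constant on a domain has zero differential at its boundary points. -/
theorem differential_eq_zero_of_const {N : Set W} {p : W} (hp : p ∈ bdry m 0 N) {G : W → ℝ}
    (hG : MDifferentiableAt (𝓡 m) 𝓘(ℝ, ℝ) G p) {k : ℝ} (hk : ∀ᶠ q in 𝓝 p, q ∈ N → G q = k) :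
    differential m G p = 0 := by
  obtain ⟨g, f, h⟩ := hp
  obtain ⟨v₀, hv₀⟩ := h.exists_differential
  -- directions in which `f` increases: the line leaves `N` forwards, so `G` is constant backwards
  have key : ∀ v, 0 < differential m f p v → differential m G p v = 0 := by
    intro v hv
    have h1 := (eventually_pos_of_hasDerivAt (hasDerivAt_chartLine (h.mdifferentiableAt p) v)
      (by rw [chartLine_zero]; exact h.2.1) hv).2
    have h2 := ((tendsto_chartLine p v).mono_left (nhdsWithin_le_nhds (s := Iio 0))).eventually
      (h.eventually_iff.and hk)
    have h3 : (fun r => G (chartLine m p v r)) =ᶠ[𝓝[<] 0] fun _ => k := by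
      filter_upwards [h1, h2] with r hr1 hr2 using hr2.2 (hr2.1.mpr hr1.le)
    have h4 := (hasDerivAt_chartLine hG v).hasDerivWithinAt (s := Iio 0)
    have h5 : HasDerivWithinAt (fun r => G (chartLine m p v r)) 0 (Iio 0) 0 := by
      refine (hasDerivWithinAt_const (0 : ℝ) (Iio 0) k).congr_of_eventuallyEq h3 ?_
      rw [chartLine_zero]
      exact hk.self_of_nhds h.1
    exact (uniqueDiffWithinAt_Iio (0 : ℝ)).eq_deriv _ h4 h5
  ext w
  have h1 := key v₀ (by rw [hv₀]; exact one_pos)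
  have h2 := key (w + (1 - differential m f p w) • v₀) (by simp [hv₀])
  simpa [h1] using h2

theorem continuous_differential_apply {f : W → ℝ} (hf : ContMDiff (𝓡 m) 𝓘(ℝ, ℝ) ∞ f)
    {X : VField m W} (hX : X.IsSmooth) : Continuous fun q => differential m f q (X q) :=
  (hX.contMDiff_mfderiv hf).continuous

/-- The zero set of a boundary function consists of boundary points. -/
theorem IsBoundaryChart.eventually_mem_bdry {N : Set W} {p : W} {g : W → EuclideanSpace ℝ (Fin 0)}
    {f : W → ℝ} (h : IsBoundaryChart (m := m) 0 N p g f) {X : VField m W} (hX : X.IsSmooth)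
    (hpos : 0 < differential m f p (X p)) : ∀ᶠ q in 𝓝 p, f q = 0 → q ∈ bdry m 0 N := by
  have h1 : ∀ᶠ q in 𝓝 p, 0 < differential m f q (X q) :=
    (continuous_differential_apply h.2.2.2.1 hX).continuousAt.eventually_const_lt hpos
  filter_upwards [h1, h.2.2.2.2.2, h.2.2.2.2.2.eventually_nhds] with q hq1 hq2 hq3 hq0
  refine ⟨g, f, hq2.mpr ⟨Subsingleton.elim _ _, hq0.le⟩, hq0, h.2.2.1, h.2.2.2.1, fun a b => ?_, hq3⟩
  refine ⟨(b / differential m f q (X q)) • (X q : EuclideanSpace ℝ (Fin m)),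
    Subsingleton.elim (α := EuclideanSpace ℝ (Fin 0)) _ _, ?_⟩
  refine ((differential m f q).map_smul _ (X q)).trans ?_
  exact div_mul_cancel₀ b hq1.ne'

/-- The derivative of a function read in the chart at `p`. -/
theorem hasStrictFDerivAt_comp_symm {f : W → ℝ} (hf : ContMDiff (𝓡 m) 𝓘(ℝ, ℝ) ∞ f) (p : W) :
    HasStrictFDerivAt (fun y => f ((extChartAt (𝓡 m) p).symm y)) (differential m f p)
      (extChartAt (𝓡 m) p p) := by
  have hy₀ : extChartAt (𝓡 m) p p ∈ (extChartAt (𝓡 m) p).target :=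
    (extChartAt (𝓡 m) p).map_source (mem_extChartAt_source _)
  have hFs : ContDiffAt ℝ ∞ (fun y => f ((extChartAt (𝓡 m) p).symm y)) (extChartAt (𝓡 m) p p) :=
    contMDiffAt_iff_contDiffAt.mp
      ((hf _).comp (extChartAt (𝓡 m) p p) (contMDiffAt_extChartAt_symm hy₀))
  refine (hFs.hasStrictFDerivAt (by simp)).congr_fderiv (ContinuousLinearMap.ext fun v => ?_)
  have h1 := ((hf ((extChartAt (𝓡 m) p).symm (extChartAt (𝓡 m) p p))).mdifferentiableAt
    (by simp)).hasMFDerivAt.comp _ (hasMFDerivAt_extChartAt_symm hy₀)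
  have h2 := (hFs.differentiableAt (by simp)).hasFDerivAt.hasMFDerivAt
  refine (DFunLike.congr_fun (hasMFDerivAt_unique h2 h1) v).trans ?_
  refine (congrArg (differential m f ((extChartAt (𝓡 m) p).symm (extChartAt (𝓡 m) p p)))
    (mfderiv_extChartAt_symm_self p v)).trans ?_
  rw [extChartAt_to_inv]

/-- Vectors tangent to a level of the boundary function are tangent to the boundary. -/
theorem IsBoundaryChart.mem_tangentOf {N : Set W} {p : W} {g : W → EuclideanSpace ℝ (Fin 0)}
    {f : W → ℝ} (h : IsBoundaryChart (m := m) 0 N p g f) {X : VField m W} (hX : X.IsSmooth)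
    (hpos : 0 < differential m f p (X p)) {w : EuclideanSpace ℝ (Fin m)}
    (hw : differential m f p w = 0) : w ∈ tangentOf (m := m) (bdry m 0 N) p := by
  set c := extChartAt (𝓡 m) p with hc
  set F : EuclideanSpace ℝ (Fin m) → ℝ := f ∘ c.symm with hF
  have hst : HasStrictFDerivAt F (differential m f p) (c p) :=
    hasStrictFDerivAt_comp_symm h.2.2.2.1 p
  -- the implicit function theorem gives a curve in the level set of `f` with velocity `w`
  have hrange : (differential m f p).range = ⊤ := by
    rw [LinearMap.range_eq_top]
    intro b
    obtain ⟨v, hv⟩ := h.exists_differential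
    exact ⟨b • v, ((differential m f p).map_smul b v).trans (by rw [hv, smul_eq_mul, mul_one])⟩
  have hwk : w ∈ (differential m f p).ker := by
    rw [LinearMap.mem_ker]; exact hw
  let l : ℝ → EuclideanSpace ℝ (Fin m) := fun r =>
    hst.implicitFunction F (differential m f p) hrange (F (c p)) (r • ⟨w, hwk⟩)
  have hl0 : l 0 = c p := by
    have h1 := hst.implicitFunction_apply_image hrange
    simp only [l, zero_smul]
    exact h1
  have hl : HasDerivAt l w 0 := by
    have h1 := (hst.to_implicitFunction hrange).hasFDerivAt
    have h2 : HasDerivAt (fun r : ℝ => r • (⟨w, hwk⟩ : (differential m f p).ker)) ⟨w, hwk⟩ 0 := by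
      simpa using (hasDerivAt_id (0 : ℝ)).smul_const (⟨w, hwk⟩ : (differential m f p).ker)
    have h3 := HasFDerivAt.comp_hasDerivAt_of_eq (0 : ℝ) h1 h2 (by simp)
    exact h3
  refine Submodule.subset_span ⟨fun r => c.symm (l r), by simp [hl0, hc], ?_,
    (hasMFDerivAt_symm_comp hl0 hl).hasMFDerivWithinAt⟩
  have h1 : Tendsto (fun r => c.symm (l r)) (𝓝 0) (𝓝 p) := by
    have := (hasMFDerivAt_symm_comp hl0 hl).continuousAt
    rw [ContinuousAt, hl0] at this
    rwa [show c.symm (c p) = p by simp [hc]] at this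
  have h2 : ∀ᶠ r in 𝓝 (0 : ℝ), F (l r) = F (c p) := by
    have h3 := hst.map_implicitFunction_eq hrange
    have h4 : Tendsto (fun r : ℝ => (F (c p), r • (⟨w, hwk⟩ : (differential m f p).ker))) (𝓝 0)
        (𝓝 (F (c p), 0)) := by
      have : Continuous (fun r : ℝ => (F (c p), r • (⟨w, hwk⟩ : (differential m f p).ker))) := by
        fun_prop
      simpa using this.tendsto 0
    exact h4.eventually h3
  have h5 := h1.eventually (h.eventually_mem_bdry hX hpos)
  refine (h2.and h5).filter_mono nhdsWithin_le_nhds |>.mono fun r hr => hr.2 ?_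
  refine hr.1.trans ?_
  simp only [hF, Function.comp_apply, hc, extChartAt_to_inv]
  exact h.2.1

end

/-! ### Uniqueness of integral curves -/

section
variable {m : ℕ} {W : Type*} [TopologicalSpace W] [ChartedSpace (EuclideanSpace ℝ (Fin m)) W]

theorem smulRight_one_eq (v : EuclideanSpace ℝ (Fin m)) :
    (1 : ℝ →L[ℝ] ℝ).smulRight v = ContinuousLinearMap.toSpanSingleton ℝ v := by
  ext; simp

theorem isMIntegralCurveOn_iff_toSpanSingleton {γ : ℝ → W} {V : VField m W} {s : Set ℝ} :
    IsMIntegralCurveOn γ V s ↔ ∀ t ∈ s, HasMFDerivWithinAt 𝓘(ℝ, ℝ) (𝓡 m) γ s t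
      (ContinuousLinearMap.toSpanSingleton ℝ (V (γ t) : EuclideanSpace ℝ (Fin m))) :=
  forall₂_congr fun t _ =>
    iff_of_eq (congrArg (HasMFDerivWithinAt 𝓘(ℝ, ℝ) (𝓡 m) γ s t) (smulRight_one_eq (V (γ t))))

theorem hasMFDerivAt_of_isMIntegralCurveOn {γ : ℝ → W} {V : VField m W} {s : Set ℝ}
    (h : IsMIntegralCurveOn γ V s) {t : ℝ} (ht : s ∈ 𝓝 t) : HasMFDerivAt 𝓘(ℝ, ℝ) (𝓡 m) γ t
      (ContinuousLinearMap.toSpanSingleton ℝ (V (γ t) : EuclideanSpace ℝ (Fin m))) :=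
  (isMIntegralCurveOn_iff_toSpanSingleton.mp h t (mem_of_mem_nhds ht)).hasMFDerivAt ht

/-- The orbit of the base point under a local flow, on a slightly longer time interval. -/
theorem IsLocalFlow.exists_Ioo {V : VField m W} {T : ℝ} {p : W} {φ : ℝ → W → W}
    (h : IsLocalFlow V T p φ) : φ 0 p = p ∧ ∃ δ > 0, ∀ t ∈ Ioo (min 0 T - δ) (max 0 T + δ),
      HasMFDerivAt 𝓘(ℝ, ℝ) (𝓡 m) (fun r => φ r p) t (ContinuousLinearMap.toSpanSingleton ℝ
        (V (φ t p) : EuclideanSpace ℝ (Fin m))) := by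
  obtain ⟨U, hU, hUT, -, h0, hV⟩ := h
  have hUt : ∀ t ∈ uIcc 0 T, (t, p) ∈ U := fun t ht => hUT ⟨ht, rfl⟩
  refine ⟨h0 p (hUt 0 left_mem_uIcc), ?_⟩
  have hO : IsOpen {t : ℝ | (t, p) ∈ U} := hU.preimage (by fun_prop)
  obtain ⟨δ₁, hδ₁, h1⟩ := Metric.isOpen_iff.mp hO (min 0 T)
    (hUt _ ⟨le_rfl, min_le_max⟩)
  obtain ⟨δ₂, hδ₂, h2⟩ := Metric.isOpen_iff.mp hO (max 0 T) (hUt _ ⟨min_le_max, le_rfl⟩)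
  refine ⟨min δ₁ δ₂, lt_min hδ₁ hδ₂, fun t ht => hV t p ?_⟩
  have h3 := min_le_left δ₁ δ₂
  have h4 := min_le_right δ₁ δ₂
  obtain ⟨h5, h6⟩ := ht
  rcases lt_or_ge t (min 0 T) with h | h
  · refine h1 ?_
    rw [Metric.mem_ball, Real.dist_eq, abs_lt]
    constructor <;> linarith
  · rcases le_or_gt t (max 0 T) with h' | h'
    · exact hUt t ⟨h, h'⟩
    · refine h2 ?_
      rw [Metric.mem_ball, Real.dist_eq, abs_lt]
      constructor <;> linarith

variable [IsManifold (𝓡 m) ∞ W]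

/-- An integral curve on a closed time interval is an orbit of the local flow. -/
theorem IsLocalFlow.eqOn [T2Space W] {V : VField m W} (hV : V.IsSmooth) {T : ℝ} (hT : 0 ≤ T) {p : W}
    {φ : ℝ → W → W} (hφ : IsLocalFlow V T p φ) {γ : ℝ → W}
    (hγ : IsMIntegralCurveOn γ V (Icc 0 T)) (h0 : γ 0 = p) : ∀ t ∈ Icc 0 T, γ t = φ t p := by
  obtain ⟨hφ0, δ, hδ, hd⟩ := hφ.exists_Ioo
  rw [min_eq_left hT, max_eq_right hT, zero_sub] at hd
  rcases hT.eq_or_lt with rfl | hT0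
  · intro t ht
    obtain rfl : t = 0 := le_antisymm ht.2 ht.1
    rw [h0, hφ0]
  -- continue `γ` by the orbit to negative times, to compare curves on an open interval
  set η : ℝ → W := fun t => if t < 0 then φ t p else γ t with hη
  have hη1 : ∀ t ≤ 0, η t = φ t p := by
    intro t ht
    rcases ht.lt_or_eq with h | rfl
    · simp [hη, h]
    · simp [hη, h0, hφ0]
  have hη2 : ∀ t, 0 ≤ t → η t = γ t := fun t ht => by simp [hη, not_lt.mpr ht]
  have hηc : IsMIntegralCurveOn η V (Ioo (-δ) T) := by
    refine isMIntegralCurveOn_iff_toSpanSingleton.mpr fun t ht => ?_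
    refine HasMFDerivAt.hasMFDerivWithinAt ?_
    rcases lt_trichotomy t 0 with h | h | h
    · have h1 := hd t ⟨ht.1, by linarith⟩
      have h2 : η =ᶠ[𝓝 t] fun r => φ r p := by
        filter_upwards [Iio_mem_nhds h] with r hr using hη1 r (le_of_lt hr)
      rw [hη1 t h.le]
      exact h1.congr_of_eventuallyEq h2
    · subst h
      have h1 : HasMFDerivWithinAt 𝓘(ℝ, ℝ) (𝓡 m) η (Iic 0) 0
          (ContinuousLinearMap.toSpanSingleton ℝ (V (η 0) : EuclideanSpace ℝ (Fin m))) := by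
        have := (hd 0 ⟨by linarith, by linarith⟩).hasMFDerivWithinAt (s := Iic 0)
        rw [hη1 0 le_rfl]
        exact this.congr_of_eventuallyEq (eventually_of_mem self_mem_nhdsWithin hη1) (hη1 0 le_rfl)
      have h2 : HasMFDerivWithinAt 𝓘(ℝ, ℝ) (𝓡 m) η (Icc 0 T) 0
          (ContinuousLinearMap.toSpanSingleton ℝ (V (η 0) : EuclideanSpace ℝ (Fin m))) := by
        have := isMIntegralCurveOn_iff_toSpanSingleton.mp hγ 0 ⟨le_rfl, hT⟩
        rw [hη2 0 le_rfl]
        exact this.congr_of_eventuallyEq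
          (eventually_of_mem self_mem_nhdsWithin fun t ht => hη2 t ht.1) (hη2 0 le_rfl)
      refine (h1.union h2).hasMFDerivAt ?_
      rw [Iic_union_Icc_eq_Iic hT]
      exact Iic_mem_nhds hT0
    · have h1 := hasMFDerivAt_of_isMIntegralCurveOn hγ (Icc_mem_nhds h ht.2)
      have h2 : η =ᶠ[𝓝 t] γ := by
        filter_upwards [Ioi_mem_nhds h] with r hr using hη2 r (le_of_lt hr)
      rw [hη2 t h.le]
      exact h1.congr_of_eventuallyEq h2
  have hφc : IsMIntegralCurveOn (fun r => φ r p) V (Ioo (-δ) T) :=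
    isMIntegralCurveOn_iff_toSpanSingleton.mpr fun t ht =>
      (hd t ⟨ht.1, by linarith [ht.2]⟩).hasMFDerivWithinAt
  have heq := isMIntegralCurveOn_Ioo_eqOn_of_contMDiff_boundaryless (t₀ := 0)
    ⟨by linarith, hT0⟩ (ContMDiff.of_le hV (by simp)) hηc hφc (hη1 0 le_rfl)
  have heq' : ∀ t ∈ Ico 0 T, γ t = φ t p := fun t ht => by
    rw [← hη2 t ht.1]
    exact heq ⟨by linarith [ht.1], ht.2⟩
  intro t ht
  rcases ht.2.lt_or_eq with h | rfl
  · exact heq' t ⟨ht.1, h⟩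
  · have h1 : Tendsto γ (𝓝[Ico 0 t] t) (𝓝 (γ t)) :=
      (hγ.continuousWithinAt ht).mono Ico_subset_Icc_self
    have h2 : Tendsto (fun r => φ r p) (𝓝[Ico 0 t] t) (𝓝 (φ t p)) :=
      (hd t ⟨by linarith, by linarith⟩).continuousAt.continuousWithinAt
    have h3 : (𝓝[Ico 0 t] t).NeBot := by
      rw [nhdsWithin_Ico_eq_nhdsLT hT0]; infer_instance
    exact tendsto_nhds_unique (h1.congr' (eventually_of_mem self_mem_nhdsWithin heq')) h2

end

/-! ### Liouville fields and the differentials of their flows -/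

section
variable {n : ℕ} {W : Type*} [TopologicalSpace W]
  [ChartedSpace (EuclideanSpace ℝ (Fin (2 * n))) W] [IsManifold (𝓡 (2 * n)) ∞ W]

/-- `Ω` is a symplectic form on `W` with Liouville field `X`: `Ω = d(i_X Ω)`. -/
structure IsLiouvilleField (Ω : DForm (2 * n) 2 W) (X : VField (2 * n) W) : Prop where
  smooth_form : Ω.IsSmooth
  smooth_field : X.IsSmooth
  exact : ∀ q, (DForm.interior X Ω).d q = Ω q
  nondegenerate : ∀ x v, (∀ w, Ω x ![v, w] = 0) → v = 0

theorem IsLiouvilleQuadruple.isLiouvilleField {M L : Set W} {Ω : DForm (2 * n) 2 W}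
    {X : VField (2 * n) W} (hM : IsLiouvilleQuadruple n M Ω X L) (hW : IsCompletion n M Ω X) :
    IsLiouvilleField Ω X where
  smooth_form := hM.smooth_form
  smooth_field := hM.smooth_field
  exact := by
    intro q
    by_cases hq : q ∈ interior M
    · have h1 := hM.lie_eq q (interior_subset hq)
      have h2 : DForm.interior X Ω.d q = 0 := by
        have h3 := hM.closed q (interior_subset hq)
        refine ContinuousAlternatingMap.ext fun w => ?_
        exact DFunLike.congr_fun h3 _
      rw [DForm.lie, h2, add_zero] at h1
      exact h1
    · exact hW.exact q hq
  nondegenerate := by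
    intro q
    by_cases hq : q ∈ interior M
    · exact hM.nondegenerate q (interior_subset hq)
    · exact hW.nondegenerate q hq

omit [IsManifold (𝓡 (2 * n)) ∞ W] in
theorem DForm.interior_self (X : VField (2 * n) W) (Ω : DForm (2 * n) 2 W) (x : W) :
    DForm.interior X Ω x ![X x] = 0 :=
  altBilin_self (E := EuclideanSpace ℝ (Fin (2 * n))) (f := Ω x) (X x)

variable {Ω : DForm (2 * n) 2 W} {X : VField (2 * n) W}

/-- A linear map that scales the symplectic form by `c ≠ 0` is bijective. -/
theorem IsLiouvilleField.bijective_of_scale (h : IsLiouvilleField Ω X) {p q : W} {c : ℝ}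
    (hc : c ≠ 0) (D : EuclideanSpace ℝ (Fin (2 * n)) →L[ℝ] EuclideanSpace ℝ (Fin (2 * n)))
    (hD : ∀ v w : EuclideanSpace ℝ (Fin (2 * n)), Ω q ![D v, D w] = c * Ω p ![v, w]) :
    Function.Bijective D := by
  have hi : Function.Injective D := by
    refine (injective_iff_map_eq_zero D).mpr fun v hv => ?_
    refine h.nondegenerate p v fun w => ?_
    have h1 := hD v w
    rw [hv] at h1
    have h2 : Ω q ![(0 : EuclideanSpace ℝ (Fin (2 * n))), D w] = 0 :=
      (congrArg (fun l : EuclideanSpace ℝ (Fin (2 * n)) →ₗ[ℝ] ℝ => l (D w))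
        (altBilin (E := EuclideanSpace ℝ (Fin (2 * n))) (Ω q)).map_zero)
    exact (mul_eq_zero.mp (h1.symm.trans h2)).resolve_left hc
  exact ⟨hi, LinearMap.injective_iff_surjective (f := D.toLinearMap) |>.mp hi⟩

/-- A linear map that scales both the symplectic form and the Liouville form by the same constant
preserves the Liouville field. -/
theorem IsLiouvilleField.map_field_of_scale (h : IsLiouvilleField Ω X) {p q : W} {c : ℝ}
    (hc : c ≠ 0) (D : EuclideanSpace ℝ (Fin (2 * n)) →L[ℝ] EuclideanSpace ℝ (Fin (2 * n)))
    (hD : ∀ v w : EuclideanSpace ℝ (Fin (2 * n)), Ω q ![D v, D w] = c * Ω p ![v, w])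
    (hl : ∀ w : EuclideanSpace ℝ (Fin (2 * n)),
      DForm.interior X Ω q ![D w] = c * DForm.interior X Ω p ![w]) : D (X p) = X q := by
  let B := altBilin (E := EuclideanSpace ℝ (Fin (2 * n))) (Ω q)
  let Y : EuclideanSpace ℝ (Fin (2 * n)) := X q
  let Z : EuclideanSpace ℝ (Fin (2 * n)) := D (X p)
  have key : Z - Y = 0 := by
    refine h.nondegenerate q (Z - Y) fun w => ?_
    obtain ⟨w', rfl⟩ := (h.bijective_of_scale hc D hD).2 w
    have h1 : B (Z - Y) (D w') = B Z (D w') - B Y (D w') := by rw [map_sub]; rfl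
    refine h1.trans (sub_eq_zero.mpr ?_)
    exact (hD (X p) w').trans (hl w').symm
  exact sub_eq_zero.mp key

/-- The differential of the flow of the Liouville field. -/
theorem IsLiouvilleField.flow_field (h : IsLiouvilleField Ω X) {T : ℝ} {p q : W}
    {D : EuclideanSpace ℝ (Fin (2 * n)) →L[ℝ] EuclideanSpace ℝ (Fin (2 * n))}
    (hD : IsFlowDifferential X T p q D) :
    (∀ v w : EuclideanSpace ℝ (Fin (2 * n)), Ω q ![D v, D w] = Real.exp T * Ω p ![v, w]) ∧
    ∀ w : EuclideanSpace ℝ (Fin (2 * n)),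
      DForm.interior X Ω q ![D w] = Real.exp T * DForm.interior X Ω p ![w] := by
  obtain ⟨φ, hφ, rfl, hDφ⟩ := hD
  have hV : ∀ x (v : EuclideanSpace ℝ (Fin (2 * n))), (DForm.interior X Ω).d x ![X x, v] =
      1 * DForm.interior X Ω x ![v] - differential (2 * n) (fun _ : W => (0 : ℝ)) x v := by
    intro x v
    have h1 : differential (2 * n) (fun _ : W => (0 : ℝ)) x v = 0 := by
      simp only [differential, mfderiv_const]; rfl
    rw [h1, sub_zero, one_mul, h.exact]
    rfl
  obtain ⟨h1, h2⟩ := hφ.form_eq (h.smooth_form.interior h.smooth_field) contMDiff_const hV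
  rw [one_mul] at h1 h2
  constructor
  · intro v w
    have h3 := h1 v w
    rw [h.exact, h.exact] at h3
    refine Eq.trans ?_ h3
    exact congrArg₂ (fun z z' : EuclideanSpace ℝ (Fin (2 * n)) => Ω (φ T p) ![z, z'])
      (hDφ v).symm (hDφ w).symm
  · intro w
    refine Eq.trans ?_ (h2 ?_ w)
    · exact congrArg (fun z : EuclideanSpace ℝ (Fin (2 * n)) =>
        DForm.interior X Ω (φ T p) ![z]) (hDφ w).symm
    · intro t ht
      have h3 : (fun x => DForm.interior X Ω x ![X x] - (0 : ℝ)) = fun _ => 0 :=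
        funext fun x => by rw [DForm.interior_self, sub_zero]
      rw [h3]
      exact hasMFDerivAt_const _ _

/-- The differential of the Hamiltonian flow, along an orbit along which `λ(X_K) - K` has vanishing
differential. -/
theorem IsLiouvilleField.flow_hamField (h : IsLiouvilleField Ω X) {K : W → ℝ}
    (hK : ContMDiff (𝓡 (2 * n)) 𝓘(ℝ, ℝ) ∞ K) {T : ℝ} {p : W} {φ : ℝ → W → W}
    (hφ : IsLocalFlow (hamField Ω K) T p φ)
    {D : EuclideanSpace ℝ (Fin (2 * n)) →L[ℝ] EuclideanSpace ℝ (Fin (2 * n))}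
    (hDφ : ∀ v, (mfderiv (𝓡 (2 * n)) (𝓡 (2 * n)) (φ T) p v : EuclideanSpace ℝ (Fin (2 * n))) = D v)
    (hG : ∀ t ∈ uIcc 0 T, HasMFDerivAt (𝓡 (2 * n)) 𝓘(ℝ, ℝ)
      (fun x => DForm.interior X Ω x ![hamField Ω K x] - K x) (φ t p) 0) :
    D (X p) = X (φ T p) := by
  have hV : ∀ x (v : EuclideanSpace ℝ (Fin (2 * n))),
      (DForm.interior X Ω).d x ![hamField Ω K x, v] =
      0 * DForm.interior X Ω x ![v] - differential (2 * n) K x v := by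
    intro x v
    rw [h.exact, zero_mul, zero_sub]
    exact eq_neg_of_add_eq_zero_left
      (by rw [show differential (2 * n) K x v = _ from mfderiv_eq_hamField h.nondegenerate K x v]
          exact add_neg_cancel _)
  obtain ⟨h1, h2⟩ := hφ.form_eq (h.smooth_form.interior h.smooth_field) hK hV
  rw [zero_mul, Real.exp_zero] at h1 h2
  refine h.map_field_of_scale one_ne_zero D (fun v w => ?_) fun w => ?_
  · have h3 := h1 v w
    rw [h.exact, h.exact] at h3
    refine Eq.trans ?_ h3
    exact congrArg₂ (fun z z' : EuclideanSpace ℝ (Fin (2 * n)) => Ω (φ T p) ![z, z'])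
      (hDφ v).symm (hDφ w).symm
  · refine Eq.trans ?_ (h2 hG w)
    exact congrArg (fun z : EuclideanSpace ℝ (Fin (2 * n)) =>
        DForm.interior X Ω (φ T p) ![z]) (hDφ w).symm

end

/-! ### The collar of the boundary -/

section
variable {m : ℕ} {W : Type*} [TopologicalSpace W] [ChartedSpace (EuclideanSpace ℝ (Fin m)) W]

/-- A local flow on a neighbourhood of the orbit segment of `p`: for `q` near `p` the orbit of `q`
is defined for all times in `[[0, T]]`. -/
theorem IsLocalFlow.eventually {V : VField m W} {T : ℝ} {p : W} {φ : ℝ → W → W}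
    (h : IsLocalFlow V T p φ) : ∀ᶠ q in 𝓝 p, φ 0 q = q ∧ ∀ t ∈ uIcc 0 T,
      HasMFDerivAt 𝓘(ℝ, ℝ) (𝓡 m) (fun r => φ r q) t (ContinuousLinearMap.toSpanSingleton ℝ
        (V (φ t q) : EuclideanSpace ℝ (Fin m))) := by
  obtain ⟨U, hU, hUT, -, h0, hV⟩ := h
  obtain ⟨A, B, -, hB, hA, hpB, hAB⟩ :=
    generalized_tube_lemma isCompact_uIcc isCompact_singleton hU hUT
  filter_upwards [hB.mem_nhds (hpB rfl)] with q hq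
  exact ⟨h0 q (hAB ⟨hA left_mem_uIcc, hq⟩), fun t ht => hV t q (hAB ⟨hA ht, hq⟩)⟩

theorem cylCoord_of_flow {X : VField m W} {φ : ℝ → W → W} {q : W} {T : ℝ} (h0 : φ 0 q = q)
    (h : ∀ t ∈ uIcc 0 T, HasMFDerivAt 𝓘(ℝ, ℝ) (𝓡 m) (fun r => φ r q) t
      (ContinuousLinearMap.toSpanSingleton ℝ (X (φ t q) : EuclideanSpace ℝ (Fin m)))) :
    CylCoord X q (Real.exp T) (φ T q) := by
  refine ⟨Real.exp_pos T, fun r => φ r q, ?_, h0, by rw [Real.log_exp]⟩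
  rw [Real.log_exp]
  exact isMIntegralCurveOn_iff_toSpanSingleton.mpr fun t ht => (h t ht).hasMFDerivWithinAt

/-- If the time `T` flow of `X` maps `q` to `z`, then `q = (z, exp (-T))`. -/
theorem cylCoord_of_flow_reverse {X : VField m W} {φ : ℝ → W → W} {q : W} {T : ℝ} (h0 : φ 0 q = q)
    (h : ∀ t ∈ uIcc 0 T, HasMFDerivAt 𝓘(ℝ, ℝ) (𝓡 m) (fun r => φ r q) t
      (ContinuousLinearMap.toSpanSingleton ℝ (X (φ t q) : EuclideanSpace ℝ (Fin m)))) :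
    CylCoord X (φ T q) (Real.exp (-T)) q := by
  refine ⟨Real.exp_pos _, fun r => φ (r + T) q, ?_, by simp, by simp [Real.log_exp, h0]⟩
  rw [Real.log_exp]
  have h1 : IsMIntegralCurveOn (fun r => φ r q) X (uIcc 0 T) :=
    isMIntegralCurveOn_iff_toSpanSingleton.mpr fun t ht => (h t ht).hasMFDerivWithinAt
  have h2 := h1.comp_add T
  refine h2.mono fun t ht => ?_
  have h3 : t + T ∈ uIcc (0 + T) (-T + T) := by
    rw [← image_add_const_uIcc]; exact ⟨t, ht, rfl⟩
  rw [zero_add, neg_add_cancel, uIcc_comm] at h3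
  exact h3

theorem cylCoord_one (X : VField m W) (z : W) : CylCoord X z 1 z := by
  refine ⟨one_pos, fun _ => z, ?_, rfl, rfl⟩
  rw [Real.log_one, uIcc_self]
  rintro t ht
  rw [mem_singleton_iff] at ht
  subst ht
  refine ⟨continuousWithinAt_const, ?_⟩
  have h1 : ((extChartAt 𝓘(ℝ, ℝ) (0 : ℝ)).symm ⁻¹' {0} ∩ range 𝓘(ℝ, ℝ)) = {(0 : ℝ)} := by
    ext; simp [chartAt_self_eq]
  rw [h1]
  exact HasFDerivWithinAt.singleton (E := ℝ) (F := EuclideanSpace ℝ (Fin m))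

theorem CylCoord.eq_of_one {X : VField m W} {z q : W} (h : CylCoord X z 1 q) : q = z := by
  obtain ⟨-, γ, -, h0, h1⟩ := h
  rw [← h1, Real.log_one, h0]

theorem CylCoord.mono {X : VField m W} {z q : W} {ρ : ℝ} (h : CylCoord X z ρ q) :
    ∃ γ : ℝ → W, IsMIntegralCurveOn γ X (uIcc 0 (Real.log ρ)) ∧ γ (Real.log ρ) = q ∧
      ∀ t ∈ uIcc 0 (Real.log ρ), CylCoord X z (Real.exp t) (γ t) := by
  obtain ⟨-, γ, hγ, h0, h1⟩ := h
  refine ⟨γ, hγ, h1, fun t ht => ⟨Real.exp_pos t, γ, ?_, h0, by rw [Real.log_exp]⟩⟩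
  rw [Real.log_exp]
  exact hγ.mono (uIcc_subset_uIcc left_mem_uIcc ht)

/-- The part `ρ₀ < ρ ≤ 1` of the collar of `∂N`. -/
def collar (m : ℕ) {W : Type*} [TopologicalSpace W] [ChartedSpace (EuclideanSpace ℝ (Fin m)) W]
    (X : VField m W) (N : Set W) (ρ₀ : ℝ) : Set W :=
  {q | ∃ z ∈ bdry m 0 N, ∃ ρ, ρ₀ < ρ ∧ ρ ≤ 1 ∧ CylCoord X z ρ q}

variable [IsManifold (𝓡 m) ∞ W]

omit [IsManifold (𝓡 m) ∞ W] in
theorem IsLocalFlow.continuousAt {V : VField m W} {T : ℝ} {p : W} {φ : ℝ → W → W}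
    (h : IsLocalFlow V T p φ) {t : ℝ} (ht : t ∈ uIcc 0 T) : ContinuousAt (φ t) p := by
  obtain ⟨U, hU, hUT, hs, -, -⟩ := h
  exact (contMDiffAt_flow hU hs (hUT ⟨ht, rfl⟩)).continuousAt

omit [IsManifold (𝓡 m) ∞ W] in
theorem IsLocalFlow.exists_extend {V : VField m W} {T : ℝ} {p : W} {φ : ℝ → W → W}
    (h : IsLocalFlow V T p φ) (hT : 0 ≤ T) :
    ∃ δ > 0, ∀ T' ∈ Ico 0 (T + δ), IsLocalFlow V T' p φ := by
  obtain ⟨U, hU, hUT, hs, h0, hV⟩ := h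
  have hO : IsOpen {t : ℝ | (t, p) ∈ U} := hU.preimage (by fun_prop)
  obtain ⟨δ, hδ, h1⟩ := Metric.isOpen_iff.mp hO T (hUT ⟨right_mem_uIcc, rfl⟩)
  refine ⟨δ, hδ, fun T' hT' => ⟨U, hU, ?_, hs, h0, hV⟩⟩
  rintro ⟨t, y⟩ ⟨ht, rfl⟩
  rw [uIcc_of_le hT'.1] at ht
  rcases le_or_gt t T with h | h
  · exact hUT ⟨by rw [uIcc_of_le hT]; exact ⟨ht.1, h⟩, rfl⟩
  · refine h1 ?_
    rw [Metric.mem_ball, Real.dist_eq, abs_lt]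
    constructor <;> linarith [ht.1, ht.2, hT'.2]

/-- Near a boundary point, every point of `N` lies in the collar: the outward flow reaches the
boundary in a short time. -/
theorem eventually_mem_collar {N : Set W} {X : VField m W} (hX : X.IsSmooth)
    {z : W} {g : W → EuclideanSpace ℝ (Fin 0)} {f : W → ℝ}
    (hf : IsBoundaryChart (m := m) 0 N z g f) (hpos : 0 < differential m f z (X z))
    {φ : ℝ → W → W} (hφ : IsLocalFlow X 0 z φ) {ρ₀ : ℝ} (hρ₀ : ρ₀ < 1) :
    ∀ᶠ q in 𝓝 z, q ∈ N → q ∈ collar m X N ρ₀ := by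
  obtain ⟨hφ0, δ, hδ, hd⟩ := hφ.exists_Ioo
  rw [min_self, max_self, zero_sub, zero_add] at hd
  have hd0 := hd 0 ⟨by linarith, hδ⟩
  rw [hφ0] at hd0
  have hd1 : HasDerivAt (fun t => f (φ t z)) (differential m f z (X z)) 0 := by
    have := hasDerivAt_comp_curve (G := f) (c := fun t => φ t z) (t := 0)
      (w := X z) (hf.mdifferentiableAt _) hd0
    have h2 : differential m f (φ 0 z) (X z : EuclideanSpace ℝ (Fin m)) =
      differential m f z (X z) := by rw [hφ0]
    rwa [h2] at this
  have hfpos := (eventually_pos_of_hasDerivAt hd1 (by rw [hφ0]; exact hf.2.1) hpos).1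
  have hG := (hf.eventually_iff.and (hf.eventually_mem_bdry hX hpos)).eventually_nhds
  -- a short time `τ` at which the orbit of `z` has left `N` but is still in the boundary chart
  have hnear : ∀ᶠ t in 𝓝[>] (0 : ℝ), ∀ r ∈ Icc 0 t, ∀ᶠ q in 𝓝 (φ r z), (q ∈ N ↔ f q ≤ 0) ∧
      (f q = 0 → q ∈ bdry m 0 N) := by
    have h1 : ∀ᶠ t in 𝓝 (0 : ℝ), ∀ᶠ q in 𝓝 (φ t z), (q ∈ N ↔ f q ≤ 0) ∧
        (f q = 0 → q ∈ bdry m 0 N) := by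
      have h2 := (hd 0 ⟨by linarith, hδ⟩).continuousAt
      refine h2.eventually (p := fun y => ∀ᶠ q in 𝓝 y, (q ∈ N ↔ f q ≤ 0) ∧
        (f q = 0 → q ∈ bdry m 0 N)) ?_
      simp only [hφ0]
      exact hG
    obtain ⟨ε, hε, h3⟩ := Metric.eventually_nhds_iff.mp h1
    filter_upwards [Ioo_mem_nhdsGT hε] with t ht r hr
    refine h3 ?_
    rw [Real.dist_eq, sub_zero, abs_of_nonneg hr.1]
    exact hr.2.trans_lt ht.2
  have hρ : ∀ᶠ t in 𝓝[>] (0 : ℝ), ρ₀ < Real.exp (-t) := by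
    have : Tendsto (fun t : ℝ => Real.exp (-t)) (𝓝 0) (𝓝 1) := by
      have h1 : Continuous fun t : ℝ => Real.exp (-t) := by fun_prop
      simpa using h1.tendsto 0
    exact (this.eventually_const_lt hρ₀).filter_mono nhdsWithin_le_nhds
  obtain ⟨δ', hδ', hT⟩ := hφ.exists_extend le_rfl
  rw [zero_add] at hT
  have hδ'' : ∀ᶠ t in 𝓝[>] (0 : ℝ), t ∈ Ioo 0 δ' := Ioo_mem_nhdsGT hδ'
  have hgt : ∀ᶠ t in 𝓝[>] (0 : ℝ), t ∈ Ioi (0 : ℝ) := self_mem_nhdsWithin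
  obtain ⟨τ, hτ1, hτ2, hτ3, hτ4, hτ0⟩ := (hfpos.and (hnear.and (hρ.and
    (hδ''.and hgt)))).exists
  rw [mem_Ioi] at hτ0
  have hφτ := hT τ ⟨hτ4.1.le, hτ4.2⟩
  -- the same for the nearby orbits
  have hq1 : ∀ᶠ q in 𝓝 z, 0 < f (φ τ q) := by
    have h1 : ContinuousAt (fun q => f (φ τ q)) z :=
      ContinuousAt.comp (g := f) (hf.mdifferentiableAt _).continuousAt
        (hφτ.continuousAt right_mem_uIcc)
    exact h1.eventually_const_lt hτ1
  have hq2 : ∀ᶠ q in 𝓝 z, ∀ r ∈ uIcc 0 τ, (φ r q ∈ N ↔ f (φ r q) ≤ 0) ∧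
      (f (φ r q) = 0 → φ r q ∈ bdry m 0 N) := by
    obtain ⟨U, hU, hUT, hs, -, -⟩ := hφτ
    have hO : IsOpen (U ∩ (fun y : ℝ × W => φ y.1 y.2) ⁻¹' {x | ∀ᶠ q in 𝓝 x,
        (q ∈ N ↔ f q ≤ 0) ∧ (f q = 0 → q ∈ bdry m 0 N)}) :=
      hs.continuousOn.isOpen_inter_preimage hU isOpen_setOfPred_eventually_nhds
    obtain ⟨A, B, -, hB, hA, hpB, hAB⟩ :=
      generalized_tube_lemma (isCompact_uIcc (a := 0) (b := τ)) (isCompact_singleton (x := z)) hO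
        (by
          rintro ⟨r, y⟩ ⟨hr, hy⟩
          refine ⟨hUT ⟨hr, hy⟩, ?_⟩
          rw [mem_singleton_iff] at hy
          subst hy
          rw [uIcc_of_le hτ0.le] at hr
          exact hτ2 r hr)
    filter_upwards [hB.mem_nhds (hpB rfl)] with q hq r hr
    exact (hAB (mk_mem_prod (hA hr) hq)).2.self_of_nhds
  filter_upwards [hq1, hq2, hφτ.eventually] with q h1 h2 h3 hqN
  have h4 : f (φ 0 q) ≤ 0 := (h2 0 left_mem_uIcc).1.mp (by rwa [h3.1])
  have h5 : ContinuousOn (fun r => f (φ r q)) (uIcc 0 τ) := fun r hr =>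
    (ContinuousAt.comp (g := f) (f := fun r => φ r q) (hf.mdifferentiableAt _).continuousAt
      (h3.2 r hr).continuousAt).continuousWithinAt
  obtain ⟨r, hr, hr0⟩ := intermediate_value_uIcc h5
    (show (0 : ℝ) ∈ uIcc (f (φ 0 q)) (f (φ τ q)) by
      rw [uIcc_of_le (h4.trans h1.le)]; exact ⟨h4, h1.le⟩)
  refine ⟨φ r q, (h2 r hr).2 hr0, Real.exp (-r), ?_, ?_,
    cylCoord_of_flow_reverse h3.1 fun t ht => h3.2 t (uIcc_subset_uIcc left_mem_uIcc hr ht)⟩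
  · rw [uIcc_of_le hτ0.le] at hr
    exact hτ3.trans_le (Real.exp_le_exp.mpr (neg_le_neg hr.2))
  · rw [uIcc_of_le hτ0.le] at hr
    rw [← Real.exp_zero]
    exact Real.exp_le_exp.mpr (by linarith [hr.1])

end

/-! ### The radial coordinate and compatible complex structures -/

section
variable {m : ℕ} {W : Type*} [TopologicalSpace W] [ChartedSpace (EuclideanSpace ℝ (Fin m)) W]

/-- `r` is a smooth function on `W` that equals the coordinate `ρ` on the part `ρ₀ < ρ ≤ 1` of the
collar of `∂N`. -/
structure IsRadial (X : VField m W) (N : Set W) (ρ₀ : ℝ) (r : W → ℝ) : Prop where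
  smooth : ContMDiff (𝓡 m) 𝓘(ℝ, ℝ) ∞ r
  eq : ∀ z ∈ bdry m 0 N, ∀ ρ : ℝ, ρ₀ < ρ → ρ ≤ 1 → ∀ q, CylCoord X z ρ q → r q = ρ

variable {X : VField m W} {N : Set W} {ρ₀ : ℝ} {r : W → ℝ}

theorem IsRadial.mdifferentiableAt (h : IsRadial X N ρ₀ r) (q : W) :
    MDifferentiableAt (𝓡 m) 𝓘(ℝ, ℝ) r q := (h.smooth q).mdifferentiableAt (by simp)

theorem IsRadial.eq_one (h : IsRadial X N ρ₀ r) (hρ₀ : ρ₀ < 1) {z : W} (hz : z ∈ bdry m 0 N) :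
    r z = 1 := h.eq z hz 1 hρ₀ le_rfl z (cylCoord_one X z)

theorem IsRadial.le_one (h : IsRadial X N ρ₀ r) {q : W} (hq : q ∈ collar m X N ρ₀) : r q ≤ 1 := by
  obtain ⟨z, hz, ρ, h1, h2, h3⟩ := hq
  rwa [h.eq z hz ρ h1 h2 q h3]

theorem IsRadial.mem_bdry (h : IsRadial X N ρ₀ r) {q : W} (hq : q ∈ collar m X N ρ₀)
    (h1 : r q = 1) : q ∈ bdry m 0 N := by
  obtain ⟨z, hz, ρ, h2, h3, h4⟩ := hq
  rw [h.eq z hz ρ h2 h3 q h4] at h1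
  subst h1
  rwa [h4.eq_of_one]

/-- On the collar `∂_ρ` is `ρ⁻¹ X`, so that `dr(X) = r`. -/
theorem IsRadial.differential_field (h : IsRadial X N ρ₀ r) (hρ₀ : 0 < ρ₀) {z : W}
    (hz : z ∈ bdry m 0 N) {ρ : ℝ} (hρ : ρ₀ < ρ) (hρ1 : ρ ≤ 1) {φ : ℝ → W → W}
    (hφ : IsLocalFlow X (Real.log ρ) z φ) :
    differential m r (φ (Real.log ρ) z) (X (φ (Real.log ρ) z)) = ρ := by
  have hρpos : 0 < ρ := hρ₀.trans hρ
  have hT : Real.log ρ ≤ 0 := Real.log_nonpos hρpos.le hρ1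
  obtain ⟨hφ0, δ, hδ, hd⟩ := hφ.exists_Ioo
  rw [min_eq_right hT, max_eq_left hT] at hd
  set T := Real.log ρ with hTdef
  have hexp : Real.exp T = ρ := Real.exp_log hρpos
  -- the coordinate `ρ` along the orbit, slightly beyond `T`
  have hev : ∀ᶠ t in 𝓝[≤] T, r (φ t z) = Real.exp t := by
    have h1 : ∀ᶠ t in 𝓝[≤] T, ρ₀ < Real.exp t :=
      (Real.continuous_exp.continuousAt.eventually_const_lt (by rwa [hexp])).filter_mono
        nhdsWithin_le_nhds
    have h2 : ∀ᶠ t in 𝓝[≤] T, T - δ < t :=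
      (eventually_gt_nhds (by linarith)).filter_mono nhdsWithin_le_nhds
    filter_upwards [h1, h2, self_mem_nhdsWithin] with t ht1 ht2 ht3
    have ht4 : t ≤ 0 := le_trans (mem_Iic.mp ht3) hT
    refine h.eq z hz _ ht1 (Real.exp_le_one_iff.mpr ht4) _ (cylCoord_of_flow hφ0 fun s hs => ?_)
    rw [uIcc_of_ge ht4] at hs
    exact hd s ⟨by linarith [hs.1], by linarith [hs.2]⟩
  have h1 := (hasDerivAt_comp_curve (h.mdifferentiableAt (φ T z))
    (hd T ⟨by linarith, by linarith⟩)).hasDerivWithinAt (s := Iic T)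
  have h2 : HasDerivWithinAt (fun t => r (φ t z)) (Real.exp T) (Iic T) T :=
    ((Real.hasDerivAt_exp T).hasDerivWithinAt).congr_of_eventuallyEq hev
      (hev.self_of_nhdsWithin self_mem_Iic)
  rw [← hexp]
  exact (uniqueDiffWithinAt_Iic T).eq_deriv _ h1 h2

/-- The function `r` is constant along the hypersurfaces `∂N × {ρ}`. -/
theorem IsRadial.differential_tangent (h : IsRadial X N ρ₀ r) {z : W}
    {ρ : ℝ} (hρpos : 0 < ρ) (hρ : ρ₀ < ρ) (hρ1 : ρ ≤ 1) {φ : ℝ → W → W}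
    (hφ : IsLocalFlow X (Real.log ρ) z φ)
    {D : EuclideanSpace ℝ (Fin m) →L[ℝ] EuclideanSpace ℝ (Fin m)}
    (hD : ∀ v, (mfderiv (𝓡 m) (𝓡 m) (φ (Real.log ρ)) z v : EuclideanSpace ℝ (Fin m)) = D v)
    {w : EuclideanSpace ℝ (Fin m)} (hw : w ∈ tangentOf (m := m) (bdry m 0 N) z) :
    differential m r (φ (Real.log ρ) z) (D w) = 0 := by
  set T := Real.log ρ with hTdef
  have hexp : Real.exp T = ρ := Real.exp_log hρpos
  let l : EuclideanSpace ℝ (Fin m) →L[ℝ] ℝ := (differential m r (φ T z)).comp D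
  suffices hle : tangentOf (m := m) (bdry m 0 N) z ≤ LinearMap.ker l.toLinearMap from hle hw
  refine Submodule.span_le.mpr ?_
  rintro v ⟨c, hc0, hcN, hc⟩
  have hev : ∀ᶠ t in 𝓝[≥] (0 : ℝ), r (φ T (c t)) = ρ := by
    have h1 : Tendsto c (𝓝[≥] 0) (𝓝 z) := by
      have := hc.continuousWithinAt
      rwa [ContinuousWithinAt, hc0] at this
    filter_upwards [hcN, h1.eventually hφ.eventually] with t ht1 ht2
    have h3 := cylCoord_of_flow ht2.1 ht2.2
    rw [hexp] at h3
    exact h.eq _ ht1 ρ hρ hρ1 _ h3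
  have hφT : MDifferentiableAt (𝓡 m) (𝓡 m) (φ T) z := by
    obtain ⟨U, hU, hUT, hs, -, -⟩ := hφ
    exact (contMDiffAt_flow hU hs (hUT ⟨right_mem_uIcc, rfl⟩)).mdifferentiableAt (by simp)
  have hcomp : MDifferentiableAt (𝓡 m) 𝓘(ℝ, ℝ) (fun y => r (φ T y)) (c 0) := by
    rw [hc0]; exact MDifferentiableAt.comp z (h.mdifferentiableAt _) hφT
  have h1 := hasDerivWithinAt_comp_curve (w := v) hcomp hc
  have h2 : HasDerivWithinAt (fun t => r (φ T (c t))) 0 (Ici 0) 0 :=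
    (hasDerivWithinAt_const (0 : ℝ) (Ici 0) ρ).congr_of_eventuallyEq hev
      (hev.self_of_nhdsWithin self_mem_Ici)
  have h3 := (uniqueDiffWithinAt_Ici (0 : ℝ)).eq_deriv _ h1 h2
  rw [hc0] at h3
  have h4 := ((h.mdifferentiableAt (φ T z)).hasMFDerivAt.comp z hφT.hasMFDerivAt).mfderiv
  have h5 := DFunLike.congr_fun h4 v
  have h6 : differential m r (φ T z) (D v) = 0 :=
    ((congrArg (differential m r (φ T z)) (hD v)).symm.trans h5.symm).trans h3
  exact h6

end

section
variable {n : ℕ} {W : Type*} [TopologicalSpace W]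
  [ChartedSpace (EuclideanSpace ℝ (Fin (2 * n))) W] [IsManifold (𝓡 (2 * n)) ∞ W]
  {Ω : DForm (2 * n) 2 W} {X : VField (2 * n) W} {N : Set W} {ρ₀ : ℝ} {r : W → ℝ}

/-- On the collar `dr(X) = r` and `λ ∘ J = dr`: both sides of the latter vanish on the images of
vectors `w` tangent to `∂N` (for `λ ∘ J` because `Ω(D w, D R) = ρ dλ(w, R) = 0`), and both are
`ρ` on `X`. -/
theorem IsRadial.liouville_comp_J (h : IsRadial X N ρ₀ r) (hL : IsLiouvilleField Ω X)
    (hout : PointsOutward X N) (hρ₀ : 0 < ρ₀)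
    {J : (x : W) → TangentSpace (𝓡 (2 * n)) x →L[ℝ] TangentSpace (𝓡 (2 * n)) x}
    (hJ : IsCompatible Ω J) (hJN : IsContactTypeOnCollar N Ω X ρ₀ J) {q : W}
    (hq : q ∈ collar (2 * n) X N ρ₀) :
    differential (2 * n) r q (X q) = r q ∧ ∀ v : EuclideanSpace ℝ (Fin (2 * n)),
      DForm.interior X Ω q ![J q v] = differential (2 * n) r q v := by
  obtain ⟨z, hz, ρ, hρ, hρ1, hcyl⟩ := hq
  have hρpos : 0 < ρ := hρ₀.trans hρ
  obtain ⟨D', R', hD, ⟨-, hR2, hR3⟩, -, hJX⟩ := hJN z hz ρ hρ hρ1 q hcyl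
  let D : EuclideanSpace ℝ (Fin (2 * n)) →L[ℝ] EuclideanSpace ℝ (Fin (2 * n)) := D'
  let R : EuclideanSpace ℝ (Fin (2 * n)) := R'
  have hscale := hL.flow_field (D := D) hD
  rw [Real.exp_log hρpos] at hscale
  obtain ⟨hΩ, hlam⟩ := hscale
  have hDX : D (X z) = X q := hL.map_field_of_scale hρpos.ne' D hΩ hlam
  obtain ⟨φ, hφ, hφq, hφD⟩ := hD
  have hrq : r q = ρ := h.eq z hz ρ hρ hρ1 q hcyl
  have hdX : differential (2 * n) r q (X q) = ρ := by
    have := h.differential_field hρ₀ hz hρ hρ1 hφ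
    rwa [hφq] at this
  have hdT : ∀ w ∈ tangentOf (m := 2 * n) (bdry (2 * n) 0 N) z,
      differential (2 * n) r q (D w) = 0 := by
    intro w hw
    have := h.differential_tangent hρpos hρ hρ1 hφ (D := D) hφD hw
    rwa [hφq] at this
  refine ⟨hdX.trans hrq.symm, ?_⟩
  let Bq := altBilin (E := EuclideanSpace ℝ (Fin (2 * n))) (Ω q)
  let Bz := altBilin (E := EuclideanSpace ℝ (Fin (2 * n))) (Ω z)
  let Xz : EuclideanSpace ℝ (Fin (2 * n)) := X z
  let Xq : EuclideanSpace ℝ (Fin (2 * n)) := X q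
  have hscale : ∀ v w, Bq (D v) (D w) = ρ * Bz v w := hΩ
  have hR2' : ∀ w ∈ tangentOf (m := 2 * n) (bdry (2 * n) 0 N) z, Bz w R = 0 := by
    intro w hw
    have h1 := hR2 w hw
    rw [hL.exact] at h1
    have h2 : Bz R w = 0 := h1
    exact (altBilin_swap (E := EuclideanSpace ℝ (Fin (2 * n))) (Ω z) w R).trans
      ((congrArg Neg.neg h2).trans neg_zero)
  have hR3' : Bz Xz R = 1 := hR3
  -- `dr = Ω(·, D R)`
  have key : ∀ v, differential (2 * n) r q v = Bq v (D R) := by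
    intro v
    obtain ⟨w, rfl⟩ := (hL.bijective_of_scale hρpos.ne' D hΩ).2 v
    obtain ⟨g, f, hf, hpos⟩ := hout z hz
    have hpos' : 0 < differential (2 * n) f z Xz := hpos
    set c := differential (2 * n) f z w / differential (2 * n) f z Xz with hc
    have hw' : w - c • Xz ∈ tangentOf (m := 2 * n) (bdry (2 * n) 0 N) z := by
      refine hf.mem_tangentOf hL.smooth_field hpos (w := w - c • Xz) ?_
      rw [map_sub, map_smul, smul_eq_mul, hc, div_mul_cancel₀ _ hpos'.ne', sub_self]
    have h1 := hdT _ hw'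
    have h2 := hR2' _ hw'
    have hDX' : D Xz = Xq := hDX
    have hdX' : differential (2 * n) r q Xq = ρ := hdX
    rw [map_sub, map_smul, hDX', map_sub, map_smul, hdX', smul_eq_mul, sub_eq_zero] at h1
    rw [map_sub, map_smul, LinearMap.sub_apply, LinearMap.smul_apply, hR3', smul_eq_mul, mul_one,
      sub_eq_zero] at h2
    rw [h1, hscale, h2, mul_comm]
  have hJX' : (J q (X q) : EuclideanSpace ℝ (Fin (2 * n))) = D R := by
    let A : EuclideanSpace ℝ (Fin (2 * n)) →L[ℝ] EuclideanSpace ℝ (Fin (2 * n)) := J q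
    have h1 : A (ρ⁻¹ • Xq) = ρ⁻¹ • D R := hJX
    rw [map_smul] at h1
    exact smul_right_injective _ (inv_ne_zero hρpos.ne') h1
  intro v
  refine Eq.trans ?_ (key v).symm
  refine (hJ.symm q (X q) v).trans ?_
  exact congrArg (fun y : EuclideanSpace ℝ (Fin (2 * n)) => Bq v y) hJX'

end

/-! ### Chords avoid the boundary -/

section
variable {m : ℕ} {W : Type*} [TopologicalSpace W] [ChartedSpace (EuclideanSpace ℝ (Fin m)) W]

theorem differential_congr {G G' : W → ℝ} {p : W} (h : G =ᶠ[𝓝 p] G') :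
    differential m G p = differential m G' p := h.mfderiv_eq

theorem differential_const (p : W) (k : ℝ) : differential m (fun _ : W => k) p = 0 := mfderiv_const

variable [IsManifold (𝓡 m) ∞ W]

/-- A function that is constant on a domain has zero differential at the points of the domain. -/
theorem differential_eq_zero_of_const_on {N : Set W} (hN : IsSubmanifold m 0 N) {p : W} (hp : p ∈ N)
    {G : W → ℝ} (hG : MDifferentiableAt (𝓡 m) 𝓘(ℝ, ℝ) G p) {k : ℝ}
    (hk : ∀ᶠ q in 𝓝 p, q ∈ N → G q = k) : differential m G p = 0 := by
  rcases hN p hp with h | h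
  · have h1 : G =ᶠ[𝓝 p] fun _ => k := by
      filter_upwards [hk, h.mem_nhds] with q h1 h2 using h1 h2
    rw [differential_congr h1, differential_const]
  · exact differential_eq_zero_of_const h hG hk

omit [IsManifold (𝓡 m) ∞ W] in
theorem differential_sub_mul {G r : W → ℝ} {p : W} (hG : MDifferentiableAt (𝓡 m) 𝓘(ℝ, ℝ) G p)
    (hr : MDifferentiableAt (𝓡 m) 𝓘(ℝ, ℝ) r p) (c ν : ℝ) :
    HasMFDerivAt (𝓡 m) 𝓘(ℝ, ℝ) (fun q => G q - c * (r q - ν)) p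
      (differential m G p - c • differential m r p) :=
  hG.hasMFDerivAt.sub ((hr.hasMFDerivAt.sub (hasMFDerivAt_const ν p)).const_smul c |>.congr_mfderiv
    (congrArg (c • ·) (sub_zero (differential m r p))))

theorem differential_eq_smul {N : Set W} (hN : IsSubmanifold m 0 N) {p : W} (hp : p ∈ N)
    {G r : W → ℝ} (hG : MDifferentiableAt (𝓡 m) 𝓘(ℝ, ℝ) G p)
    (hr : MDifferentiableAt (𝓡 m) 𝓘(ℝ, ℝ) r p) {c ν : ℝ}
    (h : ∀ᶠ q in 𝓝 p, q ∈ N → G q = c * (r q - ν)) :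
    differential m G p = c • differential m r p := by
  have h1 := differential_sub_mul hG hr c ν
  have h2 := differential_eq_zero_of_const_on hN hp h1.mdifferentiableAt (k := 0)
    (h.mono fun q hq hqN => sub_eq_zero.mpr (hq hqN))
  exact sub_eq_zero.mp (h1.mfderiv.symm.trans h2)

end

section
variable {n : ℕ} {W : Type*} [TopologicalSpace W]
  [ChartedSpace (EuclideanSpace ℝ (Fin (2 * n))) W]
  {Ω : DForm (2 * n) 2 W} {X : VField (2 * n) W}

theorem DForm.interior_hamField (hnd : ∀ x v, (∀ w, Ω x ![v, w] = 0) → v = 0) (K : W → ℝ) (q : W) :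
    DForm.interior X Ω q ![hamField Ω K q] = differential (2 * n) K q (X q) := by
  refine Eq.trans ?_ (mfderiv_eq_hamField hnd K q (X q)).symm
  exact altBilin_swap (E := EuclideanSpace ℝ (Fin (2 * n))) (Ω q) (X q) (hamField Ω K q)

/-- If `dK = c dr` at a point, then `dr(X_K) = 0` there. -/
theorem differential_hamField_eq_zero (hnd : ∀ x v, (∀ w, Ω x ![v, w] = 0) → v = 0)
    {K r : W → ℝ} {q : W} {c : ℝ}
    (h : differential (2 * n) K q = c • differential (2 * n) r q) :
    differential (2 * n) r q (hamField Ω K q) = 0 := by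
  let B := altBilin (E := EuclideanSpace ℝ (Fin (2 * n))) (Ω q)
  let Y : EuclideanSpace ℝ (Fin (2 * n)) := hamField Ω K q
  let Z : EuclideanSpace ℝ (Fin (2 * n)) := hamField Ω r q
  have h1 : differential (2 * n) r q Y = -B Z Y := mfderiv_eq_hamField hnd r q Y
  have h2 : differential (2 * n) K q Z = -B Y Z := mfderiv_eq_hamField hnd K q Z
  have h3 : differential (2 * n) r q Z = -B Z Z := mfderiv_eq_hamField hnd r q Z
  have h4 : B Z Z = 0 := altBilin_self _ _
  have h5 : B Z Y = -B Y Z := altBilin_swap _ _ _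
  have h6 : differential (2 * n) K q Z = c * differential (2 * n) r q Z := by rw [h]; rfl
  have h7 : differential (2 * n) r q Y = 0 := by
    rw [h1, h5, ← h2, h6, h3, h4]; ring
  exact h7

variable [IsManifold (𝓡 (2 * n)) ∞ W] {N : Set W} {ρ₀ : ℝ} {r : W → ℝ}

/-- A nondegenerate chord in `N` of a Hamiltonian `K` that has the form `c (r - ν)` on the collar
does not meet `∂N`: otherwise it stays in `∂N`, and the linearized flow along it maps `X` to `X`,
a vector tangent to the Lagrangian at both ends. It does so because `λ(X_K) - K = dK(X) - K` is the
constant `c ν` on the collar, so that the flow preserves `λ` along `∂N`. -/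
theorem chord_notMem_bdry [T2Space W] (hr : IsRadial X N ρ₀ r) (hρ₀ : ρ₀ < 1)
    (hL : IsLiouvilleField Ω X) (hN : IsSubmanifold (2 * n) 0 N)
    (hout : PointsOutward X N)
    (hcol : ∀ z ∈ bdry (2 * n) 0 N, ∀ᶠ q in 𝓝 z, q ∈ N → q ∈ collar (2 * n) X N ρ₀)
    (hdr : ∀ q ∈ collar (2 * n) X N ρ₀, differential (2 * n) r q (X q) = r q)
    {K : W → ℝ} (hK : ContMDiff (𝓡 (2 * n)) 𝓘(ℝ, ℝ) ∞ K) {c ν : ℝ}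
    (hKc : ∀ q ∈ collar (2 * n) X N ρ₀, K q = c * (r q - ν)) {Lhat : Set W}
    (hX : ∀ q ∈ Lhat, X q ∈ tangentOf (m := 2 * n) Lhat q) {x : ℝ → W}
    (hx : IsChord Ω Lhat K x) (hnd : IsNondegenerateChord Ω Lhat K x)
    (hxN : ∀ t ∈ Icc (0 : ℝ) 1, x t ∈ N) : ∀ t ∈ Icc (0 : ℝ) 1, x t ∉ bdry (2 * n) 0 N := by
  intro t₀ ht₀ hb₀
  have hKd : ∀ q, MDifferentiableAt (𝓡 (2 * n)) 𝓘(ℝ, ℝ) K q := fun q =>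
    (hK q).mdifferentiableAt (by simp)
  have hdK : ∀ q ∈ N, (∀ᶠ q' in 𝓝 q, q' ∈ N → q' ∈ collar (2 * n) X N ρ₀) →
      differential (2 * n) K q = c • differential (2 * n) r q := fun q hq h =>
    differential_eq_smul hN hq (hKd q) (hr.mdifferentiableAt q)
      (h.mono fun q' h' hq' => hKc q' (h' hq'))
  have hxc : ContinuousOn x (Icc 0 1) := hx.1.continuousOn
  -- the chord stays in `∂N`
  have hstay : ∀ t ∈ Icc (0 : ℝ) 1, x t ∈ bdry (2 * n) 0 N := by
    let S : Set (Icc (0 : ℝ) 1) := {t | x t ∈ bdry (2 * n) 0 N}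
    have hS : IsClopen S := by
      constructor
      · have h1 : S = (fun t : Icc (0 : ℝ) 1 => x t) ⁻¹' (interior N)ᶜ := by
          ext t
          simp only [S, mem_ofPred_eq, bdry_eq_diff_interior hN, mem_preimage, mem_compl_iff, Set.mem_sdiff]
          exact and_iff_right (hxN t t.2)
        rw [h1]
        exact isOpen_interior.isClosed_compl.preimage (continuousOn_iff_continuous_domRestrict.mp hxc)
      · rw [isOpen_iff_mem_nhds]
        rintro ⟨t, ht⟩ htS
        have h1 : ∀ᶠ t' in 𝓝[Icc 0 1] t, ∀ᶠ q' in 𝓝 (x t'), q' ∈ N →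
            q' ∈ collar (2 * n) X N ρ₀ :=
          (hxc t ht).eventually (hcol _ htS).eventually_nhds
        obtain ⟨ε, hε, h2⟩ := Metric.mem_nhdsWithin_iff.mp h1
        have hconst : ∀ t' ∈ Metric.ball t ε ∩ Icc 0 1, r (x t') = r (x t) := by
          intro t' ht'
          have h3 : ∀ y ∈ Metric.ball t ε ∩ Icc 0 1, HasDerivWithinAt (fun s => r (x s)) 0
              (Metric.ball t ε ∩ Icc 0 1) y := by
            intro y hy
            have h4 := (isMIntegralCurveOn_iff_toSpanSingleton.mp hx.1 y hy.2).mono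
              (inter_subset_right (s := Metric.ball t ε))
            have h5 := hasDerivWithinAt_comp_curve (hr.mdifferentiableAt _) h4
            have h6 := differential_hamField_eq_zero hL.nondegenerate
              (hdK (x y) (hxN y hy.2) (h2 hy))
            rwa [h6] at h5
          have h7 := Convex.norm_image_sub_le_of_norm_hasDerivWithin_le (C := 0) h3
            (fun y hy => by simp) ((convex_ball t ε).inter (convex_Icc 0 1))
            ⟨Metric.mem_ball_self hε, ht⟩ ht'
          rw [zero_mul] at h7
          exact sub_eq_zero.mp (norm_le_zero_iff.mp h7)
        rw [nhds_subtype_eq_comap]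
        refine ⟨Metric.ball t ε, Metric.ball_mem_nhds t hε, ?_⟩
        rintro ⟨t', ht'⟩ hb
        refine hr.mem_bdry ((h2 ⟨hb, ht'⟩ : ∀ᶠ q' in 𝓝 (x t'), q' ∈ N →
            q' ∈ collar (2 * n) X N ρ₀).self_of_nhds (hxN t' ht')) ?_
        rw [hconst t' ⟨hb, ht'⟩, hr.eq_one hρ₀ htS]
    have huniv := hS.eq_univ ⟨⟨t₀, ht₀⟩, hb₀⟩
    intro t ht
    exact (huniv ▸ mem_univ _ : (⟨t, ht⟩ : Icc (0 : ℝ) 1) ∈ S)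
  obtain ⟨D', ⟨φ, hφ, hφ1, hφD⟩, hbot⟩ := hnd
  let D : EuclideanSpace ℝ (Fin (2 * n)) →L[ℝ] EuclideanSpace ℝ (Fin (2 * n)) := D'
  have hflow := hφ.eqOn (hamField_isSmooth hL.smooth_form hL.nondegenerate hK) zero_le_one hx.1 rfl
  have hDX : D (X (x 0)) = X (φ 1 (x 0)) := by
    refine hL.flow_hamField hK hφ (D := D) hφD fun t ht => ?_
    rw [uIcc_of_le zero_le_one] at ht
    rw [← hflow t ht]
    have hfun : (fun y => DForm.interior X Ω y ![hamField Ω K y] - K y) =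
        fun y => differential (2 * n) K y (X y) - K y :=
      funext fun y => by rw [DForm.interior_hamField hL.nondegenerate]
    rw [hfun]
    have hG : MDifferentiableAt (𝓡 (2 * n)) 𝓘(ℝ, ℝ)
        (fun y => differential (2 * n) K y (X y) - K y) (x t) :=
      MDifferentiableAt.sub
        ((hL.smooth_field.contMDiff_mfderiv hK (x t)).mdifferentiableAt (by simp)) (hKd _)
    have h0 := differential_eq_zero_of_const (k := c * ν) (hstay t ht) hG (by
      filter_upwards [hcol _ (hstay t ht), (hcol _ (hstay t ht)).eventually_nhds] with q h1 h2 hq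
      rw [hdK q hq h2, hKc q (h1 hq)]
      have h3 : (c • differential (2 * n) r q) (X q) = c * r q := by
        rw [← hdr q (h1 hq)]; rfl
      rw [h3]; ring)
    exact hG.hasMFDerivAt.congr_mfderiv h0
  have hX1 : X (x 1) ∈ (tangentOf Lhat (x 0)).map D'.toLinearMap ⊓ tangentOf Lhat (x 1) := by
    refine ⟨⟨X (x 0), hX _ hx.2.1, ?_⟩, hX _ hx.2.2⟩
    refine hDX.trans ?_
    rw [hφ1]
  rw [hbot, Submodule.mem_bot] at hX1
  obtain ⟨g, f, -, hpos⟩ := hout (x 1) (hstay 1 ⟨zero_le_one, le_rfl⟩)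
  have h0 : differential (2 * n) f (x 1) (X (x 1)) = 0 :=
    (congrArg (differential (2 * n) f (x 1)) hX1).trans (map_zero _)
  exact absurd h0 (ne_of_gt hpos)

end

/-! ### The radial coordinate of a monotone homotopy -/

theorem deriv_nonneg_of_const_off {f : ℝ → ℝ} (hf : Differentiable ℝ f) {s₀ A B : ℝ}
    (hA : ∀ s ≤ -s₀, f s = A) (hB : ∀ s ≥ s₀, f s = B)
    (hpos : ∀ s ∈ Ioo (-s₀) s₀, 0 ≤ deriv f s) (s : ℝ) : 0 ≤ deriv f s := by
  rcases le_or_gt s (-s₀) with h | h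
  · have h1 : HasDerivWithinAt f 0 (Iic s) s :=
      (hasDerivWithinAt_const s (Iic s) A).congr (fun t ht => hA t (le_trans ht h)) (hA s h)
    rw [(uniqueDiffWithinAt_Iic s).eq_deriv _ (hf s).hasDerivAt.hasDerivWithinAt h1]
  · rcases le_or_gt s₀ s with h' | h'
    · have h1 : HasDerivWithinAt f 0 (Ici s) s :=
        (hasDerivWithinAt_const s (Ici s) B).congr (fun t ht => hB t (le_trans h' ht)) (hB s h')
      rw [(uniqueDiffWithinAt_Ici s).eq_deriv _ (hf s).hasDerivAt.hasDerivWithinAt h1]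
    · exact hpos s ⟨h, h'⟩

section
variable {n : ℕ} {W : Type*} [TopologicalSpace W]
  [ChartedSpace (EuclideanSpace ℝ (Fin (2 * n))) W]
  {X : VField (2 * n) W} {M : Set W} {H H' : W → ℝ} {Hs : ℝ → W → ℝ}

theorem IsMonotoneHomotopy.differentiable (h : IsMonotoneHomotopy M X H H' Hs) (x : W) :
    Differentiable ℝ fun s => Hs s x := by
  have h1 : ContMDiff 𝓘(ℝ, ℝ) 𝓘(ℝ, ℝ) ∞ fun s => Hs s x :=
    h.1.comp (f := fun s : ℝ => ((s, x) : ℝ × W)) (contMDiff_id.prodMk contMDiff_const)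
  exact h1.contDiff.differentiable (by simp)

theorem IsMonotoneHomotopy.smooth (h : IsMonotoneHomotopy M X H H' Hs) (s : ℝ) :
    ContMDiff (𝓡 (2 * n)) 𝓘(ℝ, ℝ) ∞ (Hs s) := by
  obtain ⟨-, K, a, b, hK, -⟩ := h
  exact (hK s).smooth

theorem IsMonotoneHomotopy.deriv_nonneg (h : IsMonotoneHomotopy M X H H' Hs) (s : ℝ) (x : W) :
    0 ≤ deriv (fun r => Hs r x) s := by
  have hd := h.differentiable x
  obtain ⟨-, _, b, _, -, s₀, -, hA, hB, hpos⟩ := h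
  exact deriv_nonneg_of_const_off hd (A := H x) (B := H' x) (fun s hs => by rw [hA s hs])
    (fun s hs => by rw [hB s hs]) (fun s hs => ((hpos s hs).1 x).le) s

/-- Where `H^s = a(s) (ρ - ν)` holds for all `s`, the coordinate `ρ` is the difference quotient
`(H^s - H^{s'}) / (a(s) - a(s')) + ν`, and so it extends to a smooth function on `W`. When `∂N` is
empty the slope `a` is arbitrary; it is replaced by `0` to make it monotone. -/
theorem IsMonotoneHomotopy.exists_radial (h : IsMonotoneHomotopy M X H H' Hs) {N : Set W}
    {a : ℝ → ℝ} (ha : ContDiff ℝ ∞ a) {ν ρ₀ : ℝ} (hν1 : ν < 1) (hρ₀ : ρ₀ < 1)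
    (heq : ∀ s : ℝ, ∀ z ∈ bdry (2 * n) 0 N, ∀ ρ : ℝ, ρ₀ < ρ → ρ ≤ 1 →
      ∀ q, CylCoord X z ρ q → Hs s q = a s * (ρ - ν)) :
    ∃ (r : W → ℝ) (a' : ℝ → ℝ), IsRadial X N ρ₀ r ∧ ContDiff ℝ ∞ a' ∧ (∀ s, 0 ≤ deriv a' s) ∧
      ∀ s, ∀ q ∈ collar (2 * n) X N ρ₀, Hs s q = a' s * (r q - ν) := by
  rcases (bdry (2 * n) 0 N).eq_empty_or_nonempty with hempty | ⟨z, hz⟩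
  · refine ⟨fun _ => 0, fun _ => 0, ⟨contMDiff_const, ?_⟩, contDiff_const, by simp, ?_⟩
    · intro z hz
      rw [hempty] at hz
      exact hz.elim
    · rintro s q ⟨z, hz, -⟩
      rw [hempty] at hz
      exact hz.elim
  have hz1 : ∀ s, Hs s z = a s * (1 - ν) := fun s =>
    heq s z hz 1 hρ₀ le_rfl z (cylCoord_one X z)
  have hν : 0 < 1 - ν := by linarith
  have had : Differentiable ℝ a := ha.differentiable (by simp)
  have hderiv : ∀ s, deriv (fun r => Hs r z) s = deriv a s * (1 - ν) := by
    intro s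
    rw [show (fun r => Hs r z) = fun r => a r * (1 - ν) from funext hz1]
    exact deriv_mul_const (had s) _
  have hmono : ∀ s, 0 ≤ deriv a s := by
    intro s
    have h1 := h.deriv_nonneg s z
    rw [hderiv] at h1
    exact nonneg_of_mul_nonneg_left h1 hν
  -- on `∂N` the strict monotonicity of `H^s` in `s` is that of `a`
  obtain ⟨s₀, hs₀, hlt⟩ : ∃ s₀ > 0, a 0 < a (s₀ / 2) := by
    obtain ⟨-, _, b, _, -, s₀, hs₀, -, -, hpos⟩ := h
    refine ⟨s₀, hs₀, ?_⟩
    refine strictMonoOn_of_deriv_pos (convex_Icc 0 (s₀ / 2)) had.continuous.continuousOn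
      (fun s hs => ?_) ⟨le_rfl, by linarith⟩ ⟨by linarith, le_rfl⟩ (by linarith)
    rw [interior_Icc] at hs
    have h1 := (hpos s ⟨by linarith [hs.1], by linarith [hs.2]⟩).1 z
    rw [hderiv] at h1
    exact pos_of_mul_pos_left h1 hν.le
  have hne : a (s₀ / 2) - a 0 ≠ 0 := by linarith
  set r : W → ℝ := fun q => (a (s₀ / 2) - a 0)⁻¹ * (Hs (s₀ / 2) q - Hs 0 q) + ν with hr
  have hrad : ∀ z ∈ bdry (2 * n) 0 N, ∀ ρ : ℝ, ρ₀ < ρ → ρ ≤ 1 → ∀ q, CylCoord X z ρ q → r q = ρ := by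
    intro z hz ρ h1 h2 q hq
    simp only [hr, heq _ z hz ρ h1 h2 q hq]
    field_simp
    ring
  refine ⟨r, a, ⟨?_, hrad⟩, ha, hmono, ?_⟩
  · exact (contMDiff_const.mul ((h.smooth _).sub (h.smooth _))).add contMDiff_const
  · rintro s q ⟨z, hz, ρ, h1, h2, hq⟩
    rw [heq s z hz ρ h1 h2 q hq, hrad z hz ρ h1 h2 q hq]

end

/-! ### Flow decomposition near the end -/

section
variable {m : ℕ} {W : Type*} [TopologicalSpace W] [ChartedSpace (EuclideanSpace ℝ (Fin m)) W]

theorem hasMFDerivAt_comp_const_add {c : ℝ → W} {s : ℝ} {w : EuclideanSpace ℝ (Fin m)}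
    (hc : HasMFDerivAt 𝓘(ℝ, ℝ) (𝓡 m) c s (ContinuousLinearMap.toSpanSingleton ℝ w)) :
    HasMFDerivAt 𝓘(ℝ, ℝ) (𝓡 m) (fun r => c (s + r)) 0
      (ContinuousLinearMap.toSpanSingleton ℝ w) := by
  have h1 : HasMFDerivAt 𝓘(ℝ, ℝ) 𝓘(ℝ, ℝ) (fun r : ℝ => s + r) 0 (ContinuousLinearMap.id ℝ ℝ) :=
    ((hasFDerivAt_id (0 : ℝ)).const_add s).hasMFDerivAt
  have h2 : HasMFDerivAt 𝓘(ℝ, ℝ) (𝓡 m) c (s + 0) (ContinuousLinearMap.toSpanSingleton ℝ w) := by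
    rwa [add_zero]
  exact h2.comp (0 : ℝ) h1

theorem mem_tangentOf_of_eventually {S : Set W} {c : ℝ → W} {w : EuclideanSpace ℝ (Fin m)}
    (hc : HasMFDerivAt 𝓘(ℝ, ℝ) (𝓡 m) c 0 (ContinuousLinearMap.toSpanSingleton ℝ w))
    (hS : ∀ᶠ s in 𝓝 (0 : ℝ), c s ∈ S) : w ∈ tangentOf (m := m) S (c 0) :=
  Submodule.subset_span ⟨c, rfl, hS.filter_mono nhdsWithin_le_nhds, hc.hasMFDerivWithinAt⟩

theorem tangentOf_mono {S S' : Set W} (h : S ⊆ S') (p : W) :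
    tangentOf (m := m) S p ≤ tangentOf (m := m) S' p :=
  Submodule.span_mono fun _ ⟨c, h0, hc, hd⟩ => ⟨c, h0, hc.mono fun _ ht => h ht, hd⟩

variable [IsManifold (𝓡 m) ∞ W]

theorem mfderiv_extChartAt_self (p : W) (w : EuclideanSpace ℝ (Fin m)) :
    (mfderiv (𝓡 m) (𝓡 m) (extChartAt (𝓡 m) p) p w : EuclideanSpace ℝ (Fin m)) = w := by
  have h := mfderiv_mfderiv_symm (m := m)
    ((extChartAt (𝓡 m) p).map_source (mem_extChartAt_source p)) w
  have h1 := mfderiv_extChartAt_symm_self p w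
  rw [extChartAt_to_inv] at h
  exact (congrArg (mfderiv (𝓡 m) (𝓡 m) (extChartAt (𝓡 m) p) p) h1).symm.trans h

theorem hasMFDerivAt_extChartAt_self (p : W) :
    HasMFDerivAt (𝓡 m) (𝓡 m) (extChartAt (𝓡 m) p) p
      (ContinuousLinearMap.id ℝ (EuclideanSpace ℝ (Fin m))) := by
  have hM1 : IsManifold (𝓡 m) 1 W := IsManifold.of_le (n := ∞) (by simp)
  have h1 := (mdifferentiableAt_extChartAt (I := 𝓡 m) (mem_chart_source _ p)).hasMFDerivAt
  exact h1.congr_mfderiv (ContinuousLinearMap.ext fun w => mfderiv_extChartAt_self p w)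

theorem hasMFDerivAt_flowInChart {V : VField m W} {U : Set (ℝ × W)} {φ : ℝ → W → W}
    (hU : IsOpen U)
    (hφ : ContMDiffOn (𝓘(ℝ, ℝ).prod (𝓡 m)) (𝓡 m) ∞ (fun y : ℝ × W => φ y.1 y.2) U)
    (hV : ∀ t y, (t, y) ∈ U →
      HasMFDerivAt 𝓘(ℝ, ℝ) (𝓡 m) (fun r => φ r y) t (ContinuousLinearMap.toSpanSingleton ℝ
        (V (φ t y) : EuclideanSpace ℝ (Fin m)))) {t : ℝ} {p : W} (h : (t, p) ∈ U)
    {D : EuclideanSpace ℝ (Fin m) →L[ℝ] EuclideanSpace ℝ (Fin m)}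
    (hD : ∀ w, (mfderiv (𝓡 m) (𝓡 m) (φ t) p w : EuclideanSpace ℝ (Fin m)) = D w) :
    HasMFDerivAt 𝓘(ℝ, ℝ × EuclideanSpace ℝ (Fin m)) (𝓡 m) (flowInChart m φ p)
      (t, extChartAt (𝓡 m) p p)
      ((ContinuousLinearMap.toSpanSingleton ℝ (V (φ t p) : EuclideanSpace ℝ (Fin m))).coprod D) := by
  have hmem := mem_flowDomain (m := m) h
  have hnh := (isOpen_flowDomain hU p).mem_nhds hmem
  have h1 : HasMFDerivAt 𝓘(ℝ, ℝ × EuclideanSpace ℝ (Fin m)) (𝓡 m) (flowInChart m φ p)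
      (t, extChartAt (𝓡 m) p p) _ :=
    (((contMDiffOn_flowInChart p hφ).contMDiffAt hnh).mdifferentiableAt (by simp)).hasMFDerivAt
  refine h1.congr_mfderiv ?_
  let A : ℝ × EuclideanSpace ℝ (Fin m) →L[ℝ] EuclideanSpace ℝ (Fin m) :=
    mfderiv 𝓘(ℝ, ℝ × EuclideanSpace ℝ (Fin m)) (𝓡 m) (flowInChart m φ p)
      (t, extChartAt (𝓡 m) p p)
  have hA1 : A (1, 0) = V (φ t p) := by
    have h2 := mfderivWithin_flowInChart_fst (V := V) hU hφ hV hmem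
    rw [mfderivWithin_of_mem_nhds hnh] at h2
    have h3 : ∀ {x x' : W}, x = x' → (V x : EuclideanSpace ℝ (Fin m)) = V x' := by
      rintro x _ rfl; rfl
    exact Eq.trans h2 (h3 (by simp [flowInChart]))
  have hA2 : ∀ w, A (0, w) = D w := by
    intro w
    have h2 := mfderivWithin_flowInChart_snd hU hφ h w
    rw [mfderivWithin_of_mem_nhds hnh] at h2
    exact Eq.trans h2 (hD w)
  refine ContinuousLinearMap.ext fun z => ?_
  obtain ⟨τ, w⟩ := z
  have h3 : A (τ, w) = τ • A (1, 0) + A (0, w) := by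
    rw [← map_smul, ← map_add]; simp
  rw [hA1, hA2] at h3
  exact h3

/-- Straightening the flow across the hypersurface `{f = 0}`: a differentiable curve near
`φ T p`, where `f p = 0` and `df(V) > 0` at `p`, has the form `φ (τ s) (y s)` with
differentiable `τ` and a differentiable curve `y` in `{f = 0}`. -/
theorem exists_flow_decomposition {V : VField m W} {T : ℝ} {p : W} {φ : ℝ → W → W}
    (hφ : IsLocalFlow V T p φ) {D : EuclideanSpace ℝ (Fin m) →L[ℝ] EuclideanSpace ℝ (Fin m)}
    (hD : ∀ w, (mfderiv (𝓡 m) (𝓡 m) (φ T) p w : EuclideanSpace ℝ (Fin m)) = D w)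
    (hDi : Function.Injective D) {Y : EuclideanSpace ℝ (Fin m)}
    (hY : (V (φ T p) : EuclideanSpace ℝ (Fin m)) = Y) (hDV : D (V p) = Y) {f : W → ℝ}
    (hf : ContMDiff (𝓡 m) 𝓘(ℝ, ℝ) ∞ f) (hf0 : f p = 0) (hpos : 0 < differential m f p (V p))
    {c : ℝ → W} (hc0 : c 0 = φ T p) {w : EuclideanSpace ℝ (Fin m)}
    (hc : HasMFDerivAt 𝓘(ℝ, ℝ) (𝓡 m) c 0 (ContinuousLinearMap.toSpanSingleton ℝ w)) :
    ∃ (τ : ℝ → ℝ) (y : ℝ → W) (b : ℝ) (v : EuclideanSpace ℝ (Fin m)),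
      Tendsto τ (𝓝 0) (𝓝 T) ∧ y 0 = p ∧
      HasMFDerivAt 𝓘(ℝ, ℝ) (𝓡 m) y 0 (ContinuousLinearMap.toSpanSingleton ℝ v) ∧
      (∀ᶠ s in 𝓝 0, f (y s) = 0 ∧ c s = φ (τ s) (y s)) ∧
      w = b • Y + D v := by
  obtain ⟨U, hU, hUT, hφs, hφ0, hφV⟩ := hφ
  have hTU : (T, p) ∈ U := hUT ⟨right_mem_uIcc, rfl⟩
  subst hY
  set q := φ T p with hq
  set y₀ := extChartAt (𝓡 m) p p with hy₀
  let v := flowInChart m φ p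
  let Vp : EuclideanSpace ℝ (Fin m) := V p
  let Vq : EuclideanSpace ℝ (Fin m) := V q
  have hv0 : v (T, y₀) = q := by simp [v, flowInChart, hy₀, hq]
  have hnh := (isOpen_flowDomain hU p).mem_nhds (mem_flowDomain (m := m) hTU)
  have hvs : ContMDiffAt 𝓘(ℝ, ℝ × EuclideanSpace ℝ (Fin m)) (𝓡 m) ∞ v (T, y₀) :=
    (contMDiffOn_flowInChart p hφs).contMDiffAt hnh
  let A : ℝ × EuclideanSpace ℝ (Fin m) →L[ℝ] EuclideanSpace ℝ (Fin m) :=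
    (ContinuousLinearMap.toSpanSingleton ℝ Vq).coprod D
  have hvd : HasMFDerivAt 𝓘(ℝ, ℝ × EuclideanSpace ℝ (Fin m)) (𝓡 m) v (T, y₀) A :=
    hasMFDerivAt_flowInChart hU hφs hφV hTU hD
  -- the flow in charts, together with the boundary function, is a local diffeomorphism
  let g : ℝ × EuclideanSpace ℝ (Fin m) → EuclideanSpace ℝ (Fin m) := fun z =>
    extChartAt (𝓡 m) q (v z)
  have hgs : HasStrictFDerivAt g A (T, y₀) := by
    have h1 : ContDiffAt ℝ ∞ g (T, y₀) := by
      refine contMDiffAt_iff_contDiffAt.mp ?_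
      refine ContMDiffAt.comp (T, y₀) ?_ hvs
      rw [hv0]
      exact contMDiffAt_extChartAt
    refine (h1.hasStrictFDerivAt (by simp)).congr_fderiv ?_
    have h2 : HasMFDerivAt (𝓡 m) (𝓡 m) (extChartAt (𝓡 m) q) (v (T, y₀))
        (ContinuousLinearMap.id ℝ (EuclideanSpace ℝ (Fin m))) := by
      rw [hv0]; exact hasMFDerivAt_extChartAt_self q
    have h3 := h2.comp (T, y₀) hvd
    have h4 := (h1.differentiableAt (by simp)).hasFDerivAt.hasMFDerivAt
    exact hasMFDerivAt_unique h4 h3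
  let F : ℝ × EuclideanSpace ℝ (Fin m) → EuclideanSpace ℝ (Fin m) × ℝ := fun z =>
    (g z, f ((extChartAt (𝓡 m) p).symm z.2))
  let F' : ℝ × EuclideanSpace ℝ (Fin m) →L[ℝ] EuclideanSpace ℝ (Fin m) × ℝ :=
    A.prod ((differential m f p).comp (ContinuousLinearMap.snd ℝ ℝ (EuclideanSpace ℝ (Fin m))))
  have hF : HasStrictFDerivAt F F' (T, y₀) := by
    refine hgs.prodMk ?_
    have h5 : HasStrictFDerivAt (fun z : ℝ × EuclideanSpace ℝ (Fin m) => z.2)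
        (ContinuousLinearMap.snd ℝ ℝ (EuclideanSpace ℝ (Fin m))) (T, y₀) := hasStrictFDerivAt_snd
    have h6 : HasStrictFDerivAt (fun y => f ((extChartAt (𝓡 m) p).symm y)) (differential m f p)
      ((T, y₀) : ℝ × EuclideanSpace ℝ (Fin m)).2 := hasStrictFDerivAt_comp_symm hf p
    exact h6.comp (T, y₀) h5
  -- `D` maps `V p` to `V (φ T p)`, and `V p` is transverse to the kernel of `df`
  have hinj : Function.Injective F' := by
    refine (injective_iff_map_eq_zero F').mpr ?_
    rintro ⟨t, x⟩ h
    have h1 : t • Vq + D x = 0 := congrArg Prod.fst h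
    have h2 : differential m f p x = 0 := congrArg Prod.snd h
    have hDV' : D Vp = Vq := hDV
    have h3 : t • Vp + x = 0 := hDi (by rw [map_add, map_smul, hDV', h1, map_zero])
    have h4 : differential m f p (t • Vp + x) = 0 := by rw [h3, map_zero]
    rw [map_add, map_smul, h2, add_zero, smul_eq_mul] at h4
    have h5 : t = 0 := (mul_eq_zero.mp h4).resolve_right (ne_of_gt hpos)
    rw [h5, zero_smul, zero_add] at h3
    rw [h5, h3]; rfl
  let e : (ℝ × EuclideanSpace ℝ (Fin m)) ≃L[ℝ] EuclideanSpace ℝ (Fin m) × ℝ :=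
    (LinearMap.linearEquivOfInjective F'.toLinearMap hinj (by
      simp [Module.finrank_prod, add_comm])).toContinuousLinearEquiv
  have heF : (e : (ℝ × EuclideanSpace ℝ (Fin m)) →L[ℝ] EuclideanSpace ℝ (Fin m) × ℝ) = F' := by
    exact ContinuousLinearMap.ext fun z => rfl
  have hFe : HasStrictFDerivAt F (e : (ℝ × EuclideanSpace ℝ (Fin m)) →L[ℝ] _) (T, y₀) := by
    rwa [heF]
  have hF0 : F (T, y₀) = (extChartAt (𝓡 m) q q, 0) := by
    change (extChartAt (𝓡 m) q (v (T, y₀)), f ((extChartAt (𝓡 m) p).symm y₀)) = _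
    rw [hv0, hy₀, extChartAt_to_inv, hf0]
  -- the solution curve
  let k : ℝ → EuclideanSpace ℝ (Fin m) × ℝ := fun s => (extChartAt (𝓡 m) q (c s), 0)
  have hk0 : k 0 = F (T, y₀) := by rw [hF0]; simp only [k, hc0]
  have hkd : HasDerivAt k (w, 0) 0 := by
    refine HasDerivAt.prodMk ?_ (hasDerivAt_const _ _)
    have h1 : HasMFDerivAt (𝓡 m) (𝓡 m) (extChartAt (𝓡 m) q) (c 0)
        (ContinuousLinearMap.id ℝ (EuclideanSpace ℝ (Fin m))) := by
      rw [hc0]; exact hasMFDerivAt_extChartAt_self q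
    have h2 : HasFDerivAt (fun s => extChartAt (𝓡 m) q (c s))
        (ContinuousLinearMap.toSpanSingleton ℝ w) 0 :=
      hasMFDerivAt_iff_hasFDerivAt.mp (h1.comp (0 : ℝ) hc)
    simpa using! h2.hasDerivAt
  let P : ℝ → ℝ × EuclideanSpace ℝ (Fin m) := fun s => hFe.localInverse F e (T, y₀) (k s)
  have hP0 : P 0 = (T, y₀) := by
    simp only [P, hk0]
    exact hFe.localInverse_apply_image
  have hPd : HasDerivAt P (e.symm (w, 0)) 0 := by
    have h1 := hFe.to_localInverse.hasFDerivAt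
    exact h1.comp_hasDerivAt_of_eq (0 : ℝ) hkd hk0.symm
  have hPF : ∀ᶠ s in 𝓝 (0 : ℝ), F (P s) = k s := by
    have h1 := hFe.eventually_right_inverse
    have h2 : Tendsto k (𝓝 0) (𝓝 (F (T, y₀))) := by
      rw [← hk0]; exact hkd.continuousAt
    exact h2.eventually h1
  have hPt : Tendsto P (𝓝 0) (𝓝 (T, y₀)) := by
    rw [← hP0]; exact hPd.continuousAt
  obtain ⟨⟨b, x⟩, hbx⟩ : ∃ z, e.symm (w, 0) = z := ⟨_, rfl⟩
  have hP1 : HasDerivAt (fun s => (P s).1) b 0 := by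
    have := hPd.fst; rwa [hbx] at this
  have hP2 : HasDerivAt (fun s => (P s).2) x 0 := by
    have := hPd.snd; rwa [hbx] at this
  have hw : w = b • Vq + D x := by
    have h1 : F' (b, x) = (w, 0) := by
      rw [← heF, ← hbx]; exact e.apply_symm_apply _
    exact (congrArg Prod.fst h1).symm
  refine ⟨fun s => (P s).1, fun s => (extChartAt (𝓡 m) p).symm (P s).2, b, x, ?_, ?_,
    hasMFDerivAt_symm_comp (by rw [hP0]) hP2, ?_, hw⟩
  · exact (continuous_fst.tendsto (T, y₀)).comp hPt
  · simp only [hP0, hy₀, extChartAt_to_inv]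
  · have h1 : ∀ᶠ s in 𝓝 (0 : ℝ), c s ∈ (extChartAt (𝓡 m) q).source := by
      have h2 := hc.continuousAt
      rw [ContinuousAt, hc0] at h2
      exact h2.eventually (extChartAt_source_mem_nhds q)
    have h2 : ∀ᶠ s in 𝓝 (0 : ℝ), v (P s) ∈ (extChartAt (𝓡 m) q).source := by
      have h3 : Tendsto v (𝓝 (T, y₀)) (𝓝 q) := by
        rw [← hv0]; exact hvs.continuousAt
      exact (h3.comp hPt).eventually (extChartAt_source_mem_nhds q)
    filter_upwards [hPF, h1, h2] with s h3 h4 h5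
    refine ⟨congrArg Prod.snd h3, ?_⟩
    exact ((extChartAt (𝓡 m) q).injOn h5 h4 (congrArg Prod.fst h3)).symm

end

/-! ### Tangent vectors of the completed Lagrangian -/

section
variable {n : ℕ} {W : Type*} [TopologicalSpace W]
  [ChartedSpace (EuclideanSpace ℝ (Fin (2 * n))) W] [IsManifold (𝓡 (2 * n)) ∞ W]
  {Ω : DForm (2 * n) 2 W} {X : VField (2 * n) W} {M L : Set W}

theorem bdry_subset (m c : ℕ) {W : Type*} [TopologicalSpace W]
    [ChartedSpace (EuclideanSpace ℝ (Fin m)) W] (S : Set W) : bdry m c S ⊆ S := by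
  rintro p ⟨g, f, h⟩
  exact h.1

omit [IsManifold (𝓡 (2 * n)) ∞ W] in
theorem mem_completedLagrangian {q : W} (hq : q ∈ completedLagrangian X L) :
    q ∈ L ∨ ∃ z ∈ bdry (2 * n) n L, ∃ ρ : ℝ, 1 < ρ ∧ CylCoord X z ρ q := by
  rcases hq with h | ⟨z, hz, ρ, hρ, hq⟩
  · exact Or.inl h
  · rcases hρ.eq_or_lt with rfl | h
    · exact Or.inl (hq.eq_of_one ▸ bdry_subset _ _ _ hz)
    · exact Or.inr ⟨z, hz, ρ, h, hq⟩

/-- The Liouville field is tangent to the completed Lagrangian: along the cylindrical end, `-X` is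
the velocity of the ray traversed backwards. -/
theorem IsLiouvilleQuadruple.field_tangent_completed (hM : IsLiouvilleQuadruple n M Ω X L) {q : W}
    (hq : q ∈ completedLagrangian X L) :
    X q ∈ tangentOf (m := 2 * n) (completedLagrangian X L) q := by
  rcases mem_completedLagrangian hq with h | ⟨z, hz, ρ, hρ, hq⟩
  · exact tangentOf_mono subset_union_left q (hM.field_tangent q h)
  have hT : 0 < Real.log ρ := Real.log_pos hρ
  obtain ⟨γ, hγ, hγT, hcyl⟩ := hq.mono
  set T := Real.log ρ with hTdef
  rw [uIcc_of_le hT.le] at hγ hcyl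
  let Y : EuclideanSpace ℝ (Fin (2 * n)) := X q
  suffices h : -Y ∈ tangentOf (m := 2 * n) (completedLagrangian X L) q from
    (Submodule.neg_mem_iff (tangentOf (m := 2 * n) (completedLagrangian X L) q) (x := X q)).mp h
  refine Submodule.subset_span ⟨fun t => γ (T - t), ?_, ?_, ?_⟩
  · simp only [sub_zero]; exact hγT
  · filter_upwards [Icc_mem_nhdsGE hT] with t ht
    refine Or.inr ⟨z, hz, Real.exp (T - t), ?_, hcyl _ ⟨by linarith [ht.2], by linarith [ht.1]⟩⟩
    exact Real.one_le_exp (by linarith [ht.2])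
  · have h1 := isMIntegralCurveOn_iff_toSpanSingleton.mp hγ T ⟨hT.le, le_rfl⟩
    have h2 : HasMFDerivWithinAt 𝓘(ℝ, ℝ) 𝓘(ℝ, ℝ) (fun t : ℝ => T - t) (Icc 0 T) 0
        (-ContinuousLinearMap.id ℝ ℝ) :=
      (((hasFDerivAt_id (0 : ℝ)).const_sub T).hasFDerivWithinAt).hasMFDerivWithinAt
    have h3 : HasMFDerivWithinAt 𝓘(ℝ, ℝ) (𝓡 (2 * n)) γ (Icc 0 T) (T - 0)
        (ContinuousLinearMap.toSpanSingleton ℝ Y) := by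
      have h4 : ∀ {x : W}, x = q → (X x : EuclideanSpace ℝ (Fin (2 * n))) = Y := by
        rintro x rfl; rfl
      rw [sub_zero]
      exact h1.congr_mfderiv (congrArg (ContinuousLinearMap.toSpanSingleton ℝ) (h4 hγT))
    have h5 := h3.comp (0 : ℝ) h2 (fun t ht => ⟨by linarith [ht.2], by linarith [ht.1]⟩)
    have h6 : HasMFDerivWithinAt 𝓘(ℝ, ℝ) (𝓡 (2 * n)) (fun t => γ (T - t)) (Icc 0 T) 0
        (ContinuousLinearMap.toSpanSingleton ℝ (-Y)) := by
      refine h5.congr_mfderiv (ContinuousLinearMap.ext fun (a : ℝ) => ?_)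
      have h7 : (-a) • Y = a • (-Y) := by simp
      exact h7
    refine h6.mono_of_mem_nhdsWithin ?_
    exact Icc_mem_nhdsGE hT

/-- The rays `ρ > 1` lie outside `M`: the end point of such a ray is not an interior point of `M`,
and the points of `∂M` have `ρ = 1`. -/
theorem IsCompletion.notMem_of_cylCoord [T2Space W] (hM : IsLiouvilleQuadruple n M Ω X L)
    (hW : IsCompletion n M Ω X) {z q : W} (hz : z ∈ bdry (2 * n) 0 M) {ρ : ℝ} (hρ : 1 < ρ)
    (hq : CylCoord X z ρ q) : q ∉ M ∧ ∃ D, IsFlowDifferential X (Real.log ρ) z q D := by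
  have hT : 0 < Real.log ρ := Real.log_pos hρ
  obtain ⟨q', hq', -, D, hD, -⟩ := hW.exists_point z hz ρ hρ.le
  have hqq : q = q' := by
    obtain ⟨φ, hφ, hφq, -⟩ := hD
    obtain ⟨-, γ, hγ, h0, h1⟩ := hq
    rw [uIcc_of_le hT.le] at hγ
    rw [← h1, ← hφq]
    exact hφ.eqOn hM.smooth_field hT.le hγ h0 _ ⟨hT.le, le_rfl⟩
  subst hqq
  refine ⟨fun hqM => ?_, D, hD⟩
  have hqb : q ∈ bdry (2 * n) 0 M := by
    rw [bdry_eq_diff_interior hM.domain]; exact ⟨hqM, hq'⟩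
  have h1 := (hW.existsUnique_coord q hq').unique (y₁ := (z, ρ)) (y₂ := (q, 1))
    ⟨hz, hρ.le, hq⟩ ⟨hqb, le_rfl, cylCoord_one X q⟩
  exact hρ.ne' (congrArg Prod.snd h1)

/-- The Liouville form vanishes on velocities of curves in `L`. -/
theorem IsLiouvilleQuadruple.interior_velocity_eq_zero (hM : IsLiouvilleQuadruple n M Ω X L)
    {c : ℝ → W} {w : EuclideanSpace ℝ (Fin (2 * n))}
    (hc : HasMFDerivAt 𝓘(ℝ, ℝ) (𝓡 (2 * n)) c 0 (ContinuousLinearMap.toSpanSingleton ℝ w))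
    (hL : ∀ᶠ s in 𝓝 (0 : ℝ), c s ∈ L) : DForm.interior X Ω (c 0) ![w] = 0 :=
  hM.isotropic _ hL.self_of_nhds _ (hM.field_tangent _ hL.self_of_nhds) _
    (mem_tangentOf_of_eventually hc hL)

/-- The Liouville form vanishes on velocities of curves in the cylindrical end of the completed
Lagrangian: such a curve is `(y(s), ρ(s))` with a differentiable curve `y` in `∂L`, and
`λ = ρ λ|_{∂M}`. -/
theorem IsCompletion.interior_velocity_eq_zero [T2Space W] (hM : IsLiouvilleQuadruple n M Ω X L)
    (hW : IsCompletion n M Ω X) {c : ℝ → W} {w : EuclideanSpace ℝ (Fin (2 * n))}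
    (hc : HasMFDerivAt 𝓘(ℝ, ℝ) (𝓡 (2 * n)) c 0 (ContinuousLinearMap.toSpanSingleton ℝ w))
    (hL : ∀ s, c s ∈ completedLagrangian X L) (hcM : c 0 ∉ M) :
    DForm.interior X Ω (c 0) ![w] = 0 := by
  have hLF := hM.isLiouvilleField hW
  have hbdry : ∀ z ∈ bdry (2 * n) n L, z ∈ bdry (2 * n) 0 M := fun z hz => by
    rw [hM.bdry_eq] at hz; exact hz.2
  have hcoord : ∀ s, c s ∉ M → ∃ z ∈ bdry (2 * n) n L, ∃ ρ : ℝ, 1 < ρ ∧ CylCoord X z ρ (c s) :=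
    fun s hs => (mem_completedLagrangian (hL s)).resolve_left fun h => hs (hM.subset h)
  obtain ⟨z, hz, ρ, hρ, hcyl⟩ := hcoord 0 hcM
  have hT : 0 < Real.log ρ := Real.log_pos hρ
  obtain ⟨-, D', hD⟩ := hW.notMem_of_cylCoord hM (hbdry z hz) hρ hcyl
  let D : EuclideanSpace ℝ (Fin (2 * n)) →L[ℝ] EuclideanSpace ℝ (Fin (2 * n)) := D'
  obtain ⟨hΩ, hlam⟩ := hLF.flow_field (D := D) hD
  have hDX := hLF.map_field_of_scale (Real.exp_ne_zero _) D hΩ hlam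
  have hDi := (hLF.bijective_of_scale (Real.exp_ne_zero _) D hΩ).1
  obtain ⟨φ, hφ, hφq, hφD⟩ := hD
  obtain ⟨g, f, hf, hpos⟩ := hM.outward z (hbdry z hz)
  let Y : EuclideanSpace ℝ (Fin (2 * n)) := X (c 0)
  have hYq : (X (φ (Real.log ρ) z) : EuclideanSpace ℝ (Fin (2 * n))) = Y := by
    have h4 : ∀ {x x' : W}, x = x' → (X x : EuclideanSpace ℝ (Fin (2 * n))) = X x' := by
      rintro x _ rfl; rfl
    exact h4 hφq
  obtain ⟨τ, y, b, v, hτ, hy0, hyd, hev, hw⟩ := exists_flow_decomposition hφ (D := D) hφD hDi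
    (Y := Y) hYq hDX hf.2.2.2.1 hf.2.1 hpos hφq.symm hc
  -- the point `y s` is the boundary point on the ray through `c s`
  have hyL : ∀ᶠ s in 𝓝 (0 : ℝ), y s ∈ L := by
    have hyt : Tendsto y (𝓝 0) (𝓝 z) := by
      rw [← hy0]; exact hyd.continuousAt
    have hcM' : ∀ᶠ s in 𝓝 (0 : ℝ), c s ∉ M :=
      hc.continuousAt.eventually (hM.compact.isClosed.isOpen_compl.mem_nhds hcM)
    obtain ⟨δ, hδ, hext⟩ := hφ.exists_extend hT.le
    have hφ' := hext (Real.log ρ + δ / 2) ⟨by linarith, by linarith⟩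
    have hb := hyt.eventually (hf.eventually_mem_bdry hM.smooth_field hpos)
    filter_upwards [hev, hcM', hb, hyt.eventually hφ'.eventually,
      hτ.eventually (Ioo_mem_nhds hT (show Real.log ρ < Real.log ρ + δ / 2 by linarith))]
      with s h1 h2 h3 h4 h5
    have h6 : CylCoord X (y s) (Real.exp (τ s)) (c s) := by
      rw [h1.2]
      refine cylCoord_of_flow h4.1 fun t ht => h4.2 t ?_
      rw [uIcc_of_le h5.1.le] at ht
      rw [uIcc_of_le (by linarith)]
      exact ⟨ht.1, by linarith [ht.2, h5.2]⟩
    obtain ⟨z', hz', ρ', hρ', hcyl'⟩ := hcoord s h2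
    have h7 := (hW.existsUnique_coord (c s) fun h => h2 (interior_subset h)).unique
      (y₁ := (z', ρ')) (y₂ := (y s, Real.exp (τ s))) ⟨hbdry z' hz', hρ'.le, hcyl'⟩
      ⟨h3 h1.1, Real.one_le_exp h5.1.le, h6⟩
    have h8 : z' = y s := congrArg Prod.fst h7
    exact h8 ▸ bdry_subset _ _ _ hz'
  have hv := hM.interior_velocity_eq_zero hyd hyL
  rw [hy0] at hv
  let B := altBilin (E := EuclideanSpace ℝ (Fin (2 * n))) (Ω (c 0))
  have h1 : B Y Y = 0 := altBilin_self _ _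
  have h2 : B Y (D v) = 0 := (hlam v).trans (by rw [hv, mul_zero])
  have h3 : B Y w = 0 := by
    rw [hw, map_add, map_smul, h1, h2, smul_zero, add_zero]
  exact h3

/-- The Liouville form vanishes on velocities of curves in the completed Lagrangian. If it did not at
some time, then by continuity it would not at all nearby times, so that the curve would not enter the
cylindrical end and would stay in `L`. -/
theorem interior_velocity_eq_zero [T2Space W] (hM : IsLiouvilleQuadruple n M Ω X L)
    (hW : IsCompletion n M Ω X) {c : ℝ → W} {w : ℝ → EuclideanSpace ℝ (Fin (2 * n))}
    (hc : ∀ s, HasMFDerivAt 𝓘(ℝ, ℝ) (𝓡 (2 * n)) c s (ContinuousLinearMap.toSpanSingleton ℝ (w s)))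
    (hcont : Continuous fun s => DForm.interior X Ω (c s) ![w s])
    (hL : ∀ s, c s ∈ completedLagrangian X L) (s : ℝ) : DForm.interior X Ω (c s) ![w s] = 0 := by
  have hshift : ∀ s, DForm.interior X Ω (c (s + 0)) ![w s] = 0 →
      DForm.interior X Ω (c s) ![w s] = 0 := fun s h => by rwa [add_zero] at h
  have hout : ∀ s, c s ∉ M → DForm.interior X Ω (c s) ![w s] = 0 := fun s hs =>
    hshift s (hW.interior_velocity_eq_zero hM (hasMFDerivAt_comp_const_add (hc s))
      (fun r => hL _) (by rwa [add_zero]))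
  by_contra hne
  have hev : ∀ᶠ r in 𝓝 s, DForm.interior X Ω (c r) ![w r] ≠ 0 :=
    hcont.continuousAt.eventually_ne hne
  have hevL : ∀ᶠ r in 𝓝 s, c r ∈ L := by
    filter_upwards [hev] with r hr
    rcases mem_completedLagrangian (hL r) with h | ⟨z, hz, ρ, hρ, hq⟩
    · exact h
    · rw [hM.bdry_eq] at hz
      exact absurd (hout r (hW.notMem_of_cylCoord hM hz.2 hρ hq).1) hr
  refine hne (hshift s (hM.interior_velocity_eq_zero (hasMFDerivAt_comp_const_add (hc s)) ?_))
  have h1 : Tendsto (fun r => s + r) (𝓝 0) (𝓝 s) := by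
    have : Continuous fun r : ℝ => s + r := by fun_prop
    simpa using this.tendsto 0
  exact h1.eventually hevL

end

/-! ### Cutoff functions -/

section
variable {m : ℕ} {W : Type*} [TopologicalSpace W] [ChartedSpace (EuclideanSpace ℝ (Fin m)) W]
  [IsManifold (𝓡 m) ∞ W] {X : VField m W} {N : Set W} {ρ₀ : ℝ} {r : W → ℝ}

/-- A smooth cutoff function `F` that is `1` outside `N`, `0` on `N` away from a given
neighbourhood `O` of `∂N`, and a monotone function of `r` in between. -/
theorem IsRadial.exists_cutoff [T2Space W] (hr : IsRadial X N ρ₀ r) (hρ₀ : ρ₀ < 1)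
    (hN : IsSubmanifold m 0 N) (hNc : IsCompact N) {O : Set W} (hO : IsOpen O)
    (hbO : bdry m 0 N ⊆ O) (hcol : ∀ q ∈ O, q ∈ N → q ∈ collar m X N ρ₀) :
    ∃ F : W → ℝ, ContMDiff (𝓡 m) 𝓘(ℝ, ℝ) ∞ F ∧ (∀ q, 0 ≤ F q) ∧ (∀ q ∉ N, F q = 1) ∧
      (∀ q ∈ interior N, q ∉ O → ∀ᶠ q' in 𝓝 q, F q' = 0) ∧
      ∀ q, ∃ k : ℝ, 0 ≤ k ∧ differential m F q = k • differential m r q ∧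
        (k ≠ 0 → q ∈ N ∧ q ∈ O) := by
  classical
  have hlc : LocallyCompactSpace W := ChartedSpace.locallyCompactSpace (EuclideanSpace ℝ (Fin m)) W
  have hbc : IsCompact (bdry m 0 N) := by
    rw [bdry_eq_diff_interior hN]; exact hNc.diff isOpen_interior
  obtain ⟨C, hC, hbC, hCO⟩ := exists_compact_between hbc hO hbO
  have hK : IsCompact ((N ∩ C) \ interior C) := (hNc.inter hC).diff isOpen_interior
  -- `r` stays away from `1` on the transition region
  obtain ⟨r₀, hr₀, hKr⟩ : ∃ r₀ < 1, ∀ q ∈ (N ∩ C) \ interior C, r q < r₀ := by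
    have hlt : ∀ q ∈ (N ∩ C) \ interior C, r q < 1 := by
      rintro q ⟨⟨hqN, hqC⟩, hqi⟩
      have h1 := hcol q (hCO hqC) hqN
      exact lt_of_le_of_ne (hr.le_one h1) fun h => hqi (hbC (hr.mem_bdry h1 h))
    rcases ((N ∩ C) \ interior C).eq_empty_or_nonempty with he | hne
    · exact ⟨0, one_pos, fun q hq => by rw [he] at hq; exact hq.elim⟩
    · obtain ⟨q₀, hq₀, hmax⟩ := hK.exists_isMaxOn hne hr.smooth.continuous.continuousOn
      have h1 := hlt q₀ hq₀
      exact ⟨(r q₀ + 1) / 2, by linarith, fun q hq => by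
        have h2 : r q ≤ r q₀ := hmax hq
        linarith⟩
  -- `χ` is `0` below `r₀` and `1` above `(r₀ + 1) / 2`, hence near the value `1` of `r` on `∂N`
  let χ : ℝ → ℝ := fun x => Real.smoothTransition ((x - r₀) / ((1 - r₀) / 2))
  have hd : 0 < (1 - r₀) / 2 := by linarith
  have hχs : ContDiff ℝ ∞ χ :=
    Real.smoothTransition.contDiff.comp ((contDiff_id.sub contDiff_const).div_const _)
  have hχ0 : ∀ x ≤ r₀, χ x = 0 := fun x hx =>
    Real.smoothTransition.zero_of_nonpos (div_nonpos_of_nonpos_of_nonneg (by linarith) hd.le)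
  have hχ1 : ∀ x, (r₀ + 1) / 2 ≤ x → χ x = 1 := fun x hx =>
    Real.smoothTransition.one_of_one_le ((one_le_div hd).mpr (by linarith))
  have hχm : Monotone χ := Real.smoothTransition.monotone.comp fun x y hxy =>
    div_le_div_of_nonneg_right (by linarith) hd.le
  let F : W → ℝ := fun q => if q ∈ N then (if q ∈ interior C then χ (r q) else 0) else 1
  have hrc : Continuous r := hr.smooth.continuous
  have hFzero : ∀ q ∈ interior N, q ∉ interior C → ∀ᶠ q' in 𝓝 q, F q' = 0 := by
    intro q hqN hqi
    have h1 : ∀ᶠ q' in 𝓝 q, q' ∈ N := mem_interior_iff_mem_nhds.mp hqN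
    by_cases hqC : q ∈ C
    · have h2 : ∀ᶠ q' in 𝓝 q, r q' < r₀ :=
        hrc.continuousAt.eventually_lt_const (hKr q ⟨⟨interior_subset hqN, hqC⟩, hqi⟩)
      filter_upwards [h1, h2] with q' h3 h4
      simp [F, h3, hχ0 _ h4.le]
    · have h2 : ∀ᶠ q' in 𝓝 q, q' ∉ C := hC.isClosed.isOpen_compl.mem_nhds hqC
      filter_upwards [h1, h2] with q' h3 h4
      have h5 : q' ∉ interior C := fun h => h4 (interior_subset h)
      simp [F, h3, h5]
  -- `F` is locally constant or a function of `r`; the cases overlap where the formulas for `F` meet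
  have hloc : ∀ q, (∃ k : ℝ, F =ᶠ[𝓝 q] fun _ => k) ∨
      (q ∈ interior N ∧ q ∈ O ∧ F =ᶠ[𝓝 q] fun q' => χ (r q')) := by
    intro q
    by_cases hqN : q ∈ N
    · by_cases hqi : q ∈ interior N
      · by_cases hqC : q ∈ interior C
        · refine Or.inr ⟨hqi, hCO (interior_subset hqC), ?_⟩
          filter_upwards [mem_interior_iff_mem_nhds.mp hqi, isOpen_interior.mem_nhds hqC]
            with q' h1 h2
          simp [F, h1, h2]
        · exact Or.inl ⟨0, hFzero q hqi hqC⟩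
      · have hqb : q ∈ bdry m 0 N := by rw [bdry_eq_diff_interior hN]; exact ⟨hqN, hqi⟩
        refine Or.inl ⟨1, ?_⟩
        have h1 : ∀ᶠ q' in 𝓝 q, (r₀ + 1) / 2 < r q' :=
          hrc.continuousAt.eventually_const_lt (by rw [hr.eq_one hρ₀ hqb]; linarith)
        filter_upwards [h1, isOpen_interior.mem_nhds (hbC hqb)] with q' h1 h2
        simp [F, h2, hχ1 _ h1.le]
    · refine Or.inl ⟨1, ?_⟩
      filter_upwards [hNc.isClosed.isOpen_compl.mem_nhds hqN] with q' h1
      simp [F, show q' ∉ N from h1]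
  refine ⟨F, fun q => ?_, fun q => ?_, fun q hq => by simp [F, hq], fun q hqN hqO =>
    hFzero q hqN fun h => hqO (hCO (interior_subset h)), fun q => ?_⟩
  · rcases hloc q with ⟨k, hk⟩ | ⟨-, -, h⟩
    · exact (contMDiffAt_const (c := k)).congr_of_eventuallyEq hk
    · exact (hχs.contMDiff.contMDiffAt.comp q (hr.smooth q)).congr_of_eventuallyEq h
  · simp only [F]
    split_ifs
    · exact Real.smoothTransition.nonneg _
    · exact le_rfl
    · exact zero_le_one
  · rcases hloc q with ⟨k, hk⟩ | ⟨h1, h2, h⟩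
    · refine ⟨0, le_rfl, ?_, fun h => absurd rfl h⟩
      rw [differential_congr hk, differential_const, zero_smul]
    · refine ⟨deriv χ (r q), hχm.deriv_nonneg, ?_, fun _ => ⟨interior_subset h1, h2⟩⟩
      rw [differential_congr h]
      have h3 : HasMFDerivAt 𝓘(ℝ, ℝ) 𝓘(ℝ, ℝ) χ (r q)
          (ContinuousLinearMap.toSpanSingleton ℝ (deriv χ (r q))) :=
        ((hχs.differentiable (by simp)) (r q)).hasDerivAt.hasFDerivAt.hasMFDerivAt
      refine (h3.comp q (hr.mdifferentiableAt q).hasMFDerivAt).mfderiv.trans ?_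
      refine ContinuousLinearMap.ext fun v => ?_
      exact mul_comm (differential m r q v) _

end

/-! ### A divergence theorem on the strip -/

theorem uniqueDiffOn_strip : UniqueDiffOn ℝ strip :=
  uniqueDiffOn_univ.prod (uniqueDiffOn_Icc zero_lt_one)

theorem strip_mem_nhds {p : ℝ × ℝ} (hp : p.2 ∈ Ioo (0 : ℝ) 1) : strip ∈ 𝓝 p :=
  prod_mem_nhds univ_mem (Icc_mem_nhds hp.1 hp.2)

/-- A vector field `(P, Q)` on the strip with nonnegative divergence, such that `P` has bounded
support and `Q` vanishes on the boundary, is divergence free. -/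
theorem divergence_eq_zero {P Q : ℝ × ℝ → ℝ} (hP : ContDiffOn ℝ ∞ P strip)
    (hQ : ContDiffOn ℝ ∞ Q strip) {S : ℝ}
    (hS : ∀ s t, S ≤ |s| → t ∈ Icc (0 : ℝ) 1 → P (s, t) = 0) (hQ0 : ∀ s, Q (s, 0) = 0)
    (hQ1 : ∀ s, Q (s, 1) = 0)
    (hdiv : ∀ p : ℝ × ℝ, p.2 ∈ Ioo (0 : ℝ) 1 →
      0 ≤ fderiv ℝ P p (1, 0) + fderiv ℝ Q p (0, 1)) {p : ℝ × ℝ} (hp : p.2 ∈ Ioo (0 : ℝ) 1) :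
    fderiv ℝ P p (1, 0) + fderiv ℝ Q p (0, 1) = 0 := by
  set R := max S (|p.1| + 1) with hR
  have hR0 : 0 < R := lt_of_lt_of_le (by positivity) (le_max_right _ _)
  have hRS : ∀ t ∈ Icc (0 : ℝ) 1, P (R, t) = 0 ∧ P (-R, t) = 0 := fun t ht =>
    ⟨hS _ _ (by rw [abs_of_pos hR0]; exact le_max_left _ _) ht,
      hS _ _ (by rw [abs_neg, abs_of_pos hR0]; exact le_max_left _ _) ht⟩
  set G : ℝ × ℝ → ℝ := fun z => fderivWithin ℝ P strip z (1, 0) + fderivWithin ℝ Q strip z (0, 1)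
    with hG
  have hGc : ContinuousOn G strip :=
    ((hP.continuousOn_fderivWithin uniqueDiffOn_strip (by simp)).clm_apply continuousOn_const).add
      ((hQ.continuousOn_fderivWithin uniqueDiffOn_strip (by simp)).clm_apply continuousOn_const)
  have hGeq : ∀ z : ℝ × ℝ, z.2 ∈ Ioo (0 : ℝ) 1 →
      G z = fderiv ℝ P z (1, 0) + fderiv ℝ Q z (0, 1) := fun z hz => by
    simp only [hG, fderivWithin_of_mem_nhds (strip_mem_nhds hz)]
  have hrect : uIcc (-R) R ×ˢ uIcc (0 : ℝ) 1 ⊆ strip := fun z hz =>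
    ⟨mem_univ _, by rw [← uIcc_of_le zero_le_one]; exact hz.2⟩
  have hint : MeasureTheory.IntegrableOn G (uIcc (-R) R ×ˢ uIcc (0 : ℝ) 1) :=
    (hGc.mono hrect).integrableOn_compact (isCompact_uIcc.prod isCompact_uIcc)
  have hder : ∀ {f : ℝ × ℝ → ℝ}, ContDiffOn ℝ ∞ f strip →
      ∀ x ∈ Ioo (min (-R) R) (max (-R) R) ×ˢ Ioo (min (0 : ℝ) 1) (max 0 1) \ ∅,
        HasFDerivAt f (fderivWithin ℝ f strip x) x := by
    intro f hf x hx
    have hx2 : x.2 ∈ Ioo (0 : ℝ) 1 := by simpa using hx.1.2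
    have h1 := (hf.contDiffAt (strip_mem_nhds hx2)).differentiableAt (by simp)
    rw [fderivWithin_of_mem_nhds (strip_mem_nhds hx2)]
    exact h1.hasFDerivAt
  have hmain := MeasureTheory.integral2_divergence_prod_of_hasFDerivAt_off_countable P Q
    (fderivWithin ℝ P strip) (fderivWithin ℝ Q strip) (-R) 0 R 1 ∅ countable_empty
    (hP.continuousOn.mono hrect) (hQ.continuousOn.mono hrect) (hder hP) (hder hQ) hint
  have hb1 : ∫ y in (0 : ℝ)..1, P (R, y) = 0 := by
    rw [intervalIntegral.integral_congr (g := fun _ => 0)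
      (fun y hy => (hRS y (by rwa [uIcc_of_le zero_le_one] at hy)).1)]
    simp
  have hb2 : ∫ y in (0 : ℝ)..1, P (-R, y) = 0 := by
    rw [intervalIntegral.integral_congr (g := fun _ => 0)
      (fun y hy => (hRS y (by rwa [uIcc_of_le zero_le_one] at hy)).2)]
    simp
  rw [hb1, hb2] at hmain
  simp only [hQ0, hQ1, intervalIntegral.integral_zero, sub_zero, add_zero] at hmain
  have hIoc : Ioc (-R) R ×ˢ Ioc (0 : ℝ) 1 ⊆ uIcc (-R) R ×ˢ uIcc (0 : ℝ) 1 := by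
    rw [uIcc_of_le (by linarith), uIcc_of_le zero_le_one]
    exact prod_mono Ioc_subset_Icc_self Ioc_subset_Icc_self
  have hset : ∫ z in Ioc (-R) R ×ˢ Ioc (0 : ℝ) 1, G z = 0 := by
    rw [MeasureTheory.Measure.volume_eq_prod, MeasureTheory.setIntegral_prod _
      (by rw [← MeasureTheory.Measure.volume_eq_prod]; exact hint.mono_set hIoc)]
    rw [intervalIntegral.integral_of_le (by linarith)] at hmain
    simp only [intervalIntegral.integral_of_le (zero_le_one (α := ℝ))] at hmain
    exact hmain
  have hU : IsOpen (Ioo (-R) R ×ˢ Ioo (0 : ℝ) 1) := isOpen_Ioo.prod isOpen_Ioo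
  have hUsub : Ioo (-R) R ×ˢ Ioo (0 : ℝ) 1 ⊆ Ioc (-R) R ×ˢ Ioc (0 : ℝ) 1 :=
    prod_mono Ioo_subset_Ioc_self Ioo_subset_Ioc_self
  -- the divergence is nonnegative on the closed strip as well, by continuity
  have hnn : ∀ z ∈ strip, 0 ≤ G z := by
    intro z hz
    have hcl : z ∈ closure (univ ×ˢ Ioo (0 : ℝ) 1 : Set (ℝ × ℝ)) := by
      rw [closure_prod_eq, closure_Ioo zero_ne_one, closure_univ]; exact hz
    have hsub : (univ ×ˢ Ioo (0 : ℝ) 1 : Set (ℝ × ℝ)) ⊆ strip :=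
      prod_mono subset_rfl Ioo_subset_Icc_self
    have hne : (𝓝[univ ×ˢ Ioo (0 : ℝ) 1] z).NeBot := mem_closure_iff_nhdsWithin_neBot.mp hcl
    refine ge_of_tendsto ((hGc z hz).mono hsub) ?_
    filter_upwards [self_mem_nhdsWithin] with y hy
    rw [hGeq y hy.2]
    exact hdiv y hy.2
  have hae := (MeasureTheory.setIntegral_eq_zero_iff_of_nonneg_ae
    (MeasureTheory.ae_restrict_of_forall_mem (measurableSet_Ioc.prod measurableSet_Ioc)
      fun z hz => hnn z (hrect (hIoc hz))) (hint.mono_set hIoc)).mp hset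
  have heq := MeasureTheory.Measure.eqOn_open_of_ae_eq
    (MeasureTheory.ae_restrict_of_ae_restrict_of_subset hUsub hae) hU
    (hGc.mono (hUsub.trans (hIoc.trans hrect))) continuousOn_const
  have hpU : p ∈ Ioo (-R) R ×ˢ Ioo (0 : ℝ) 1 := by
    have h1 : |p.1| < R := lt_of_lt_of_le (lt_add_one _) (le_max_right _ _)
    exact ⟨abs_lt.mp h1, hp⟩
  rw [← hGeq p hp]
  exact heq hpU

/-! ### The Floer equation on the strip -/

section
variable {m : ℕ} {W : Type*} [TopologicalSpace W] [ChartedSpace (EuclideanSpace ℝ (Fin m)) W]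
  {u : ℝ × ℝ → W}

theorem hasMFDerivAt_of_strip (hu : ContMDiffOn 𝓘(ℝ, ℝ × ℝ) (𝓡 m) ∞ u strip) {p : ℝ × ℝ}
    (hp : strip ∈ 𝓝 p) : HasMFDerivAt 𝓘(ℝ, ℝ × ℝ) (𝓡 m) u p
      (mfderivWithin 𝓘(ℝ, ℝ × ℝ) (𝓡 m) u strip p) := by
  rw [mfderivWithin_of_mem_nhds hp]
  exact ((hu.contMDiffAt hp).mdifferentiableAt (by simp)).hasMFDerivAt

theorem fderiv_comp_of_strip (hu : ContMDiffOn 𝓘(ℝ, ℝ × ℝ) (𝓡 m) ∞ u strip) {p : ℝ × ℝ}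
    (hp : strip ∈ 𝓝 p) {G : W → ℝ} (hG : MDifferentiableAt (𝓡 m) 𝓘(ℝ, ℝ) G (u p)) (e : ℝ × ℝ) :
    fderiv ℝ (fun z => G (u z)) p e =
      differential m G (u p) (mfderivWithin 𝓘(ℝ, ℝ × ℝ) (𝓡 m) u strip p e) := by
  have h1 := (hG.hasMFDerivAt.comp p (hasMFDerivAt_of_strip hu hp)).mfderiv
  rw [mfderiv_eq_fderiv] at h1
  exact DFunLike.congr_fun h1 e

/-- The chain rule for a function of the form `H (s, u (s, t))`. -/
theorem fderiv_family_of_strip (hu : ContMDiffOn 𝓘(ℝ, ℝ × ℝ) (𝓡 m) ∞ u strip) {p : ℝ × ℝ}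
    (hp : strip ∈ 𝓝 p) {H : ℝ → W → ℝ}
    (hH : ContMDiff (𝓘(ℝ, ℝ).prod (𝓡 m)) 𝓘(ℝ, ℝ) ∞ fun y : ℝ × W => H y.1 y.2) (e : ℝ × ℝ) :
    fderiv ℝ (fun z => H z.1 (u z)) p e = e.1 * deriv (fun r => H r (u p)) p.1 +
      differential m (H p.1) (u p) (mfderivWithin 𝓘(ℝ, ℝ × ℝ) (𝓡 m) u strip p e) := by
  have hHd : MDifferentiableAt (𝓘(ℝ, ℝ).prod (𝓡 m)) 𝓘(ℝ, ℝ) (fun y : ℝ × W => H y.1 y.2)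
      (p.1, u p) := (hH _).mdifferentiableAt (by simp)
  have h1 : HasMFDerivAt 𝓘(ℝ, ℝ × ℝ) 𝓘(ℝ, ℝ) (fun z : ℝ × ℝ => z.1) p
      (ContinuousLinearMap.fst ℝ ℝ ℝ) := hasFDerivAt_fst.hasMFDerivAt
  have h2 := (hHd.hasMFDerivAt.comp p (h1.prodMk (hasMFDerivAt_of_strip hu hp))).mfderiv
  rw [mfderiv_eq_fderiv] at h2
  refine (DFunLike.congr_fun h2 e).trans ?_
  let v : ℝ × EuclideanSpace ℝ (Fin m) := (e.1, mfderivWithin 𝓘(ℝ, ℝ × ℝ) (𝓡 m) u strip p e)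
  refine (mfderiv_prod_eq_add_apply (v := v) hHd).trans ?_
  refine congrArg₂ (fun x y : ℝ => x + y) ?_ rfl
  rw [mfderiv_eq_fderiv]
  refine Eq.trans ?_ (mul_comm _ _)
  have h3 : ∀ (f : ℝ → ℝ) (x d : ℝ), fderiv ℝ f x d = deriv f x * d := fun f x d => by
    rw [fderiv_eq_smul_deriv, smul_eq_mul, mul_comm]
  exact h3 (fun r => H r (u p)) p.1 e.1

end

section
variable {n : ℕ} {W : Type*} [TopologicalSpace W]
  [ChartedSpace (EuclideanSpace ℝ (Fin (2 * n))) W]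
  {Ω : DForm (2 * n) 2 W} {X : VField (2 * n) W}

/-- The energy density `Ω(∂_s u, J ∂_s u)` of a solution of Floer's equation. -/
theorem energy_density (hnd : ∀ x v, (∀ w, Ω x ![v, w] = 0) → v = 0)
    {J : (x : W) → TangentSpace (𝓡 (2 * n)) x →L[ℝ] TangentSpace (𝓡 (2 * n)) x}
    [IsManifold (𝓡 (2 * n)) ∞ W] (hJ : IsCompatible Ω J) {K : W → ℝ} {q : W}
    {us ut Y : EuclideanSpace ℝ (Fin (2 * n))} (hY : hamField Ω K q = Y)
    {A : EuclideanSpace ℝ (Fin (2 * n)) →L[ℝ] EuclideanSpace ℝ (Fin (2 * n))} (hA : J q = A)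
    (h : us - A (ut - Y) = 0) :
    A us = Y - ut ∧ Ω q ![us, A us] = differential (2 * n) K q us - Ω q ![us, ut] := by
  have hsq : ∀ v, A (A v) = -v := fun v => by
    subst hA; exact hJ.sq q v
  have h1 : A us = Y - ut := by
    rw [sub_eq_zero.mp h, hsq, neg_sub]
  refine ⟨h1, ?_⟩
  let B := altBilin (E := EuclideanSpace ℝ (Fin (2 * n))) (Ω q)
  have h2 : differential (2 * n) K q us = -B Y us := by
    subst hY; exact mfderiv_eq_hamField hnd K q us
  have h3 : B us Y = -B Y us := altBilin_swap _ _ _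
  have h4 : B us (A us) = B us Y - B us ut := by rw [h1, map_sub]
  rw [h3, ← h2] at h4
  exact h4

/-- Where `λ ∘ J = dr`, `dr(X) = r` and `dK = c dr`, Floer's equation says that
`λ(∂_s u) = ∂_t r(u)` and `λ(∂_t u) = c r(u) - ∂_s r(u)`. -/
theorem floer_collar (hnd : ∀ x v, (∀ w, Ω x ![v, w] = 0) → v = 0)
    {J : (x : W) → TangentSpace (𝓡 (2 * n)) x →L[ℝ] TangentSpace (𝓡 (2 * n)) x}
    [IsManifold (𝓡 (2 * n)) ∞ W] (hJ : IsCompatible Ω J) {K r : W → ℝ} {q : W} {c : ℝ}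
    {us ut Y : EuclideanSpace ℝ (Fin (2 * n))} (hY : hamField Ω K q = Y)
    {A : EuclideanSpace ℝ (Fin (2 * n)) →L[ℝ] EuclideanSpace ℝ (Fin (2 * n))} (hA : J q = A)
    (h : us - A (ut - Y) = 0)
    (hlam : ∀ v, DForm.interior X Ω q ![A v] = differential (2 * n) r q v)
    (hX : differential (2 * n) r q (X q) = r q)
    (hK : differential (2 * n) K q = c • differential (2 * n) r q) :
    DForm.interior X Ω q ![us] = differential (2 * n) r q ut ∧
      DForm.interior X Ω q ![ut] = c * r q - differential (2 * n) r q us := by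
  let l := altBilin (E := EuclideanSpace ℝ (Fin (2 * n))) (Ω q) (X q)
  have hl : ∀ v, l (A v) = differential (2 * n) r q v := hlam
  have hrY : differential (2 * n) r q Y = 0 := by
    subst hY; exact differential_hamField_eq_zero hnd hK
  have hlY : l Y = c * r q := by
    have h1 : l Y = differential (2 * n) K q (X q) := by
      subst hY; exact DForm.interior_hamField hnd K q
    rw [h1, hK, ← hX]; rfl
  have h1 : l us = differential (2 * n) r q ut := by
    rw [sub_eq_zero.mp h, hl, map_sub, hrY, sub_zero]
  have h2 := hl us
  rw [(energy_density hnd hJ hY hA h).1, map_sub, hlY] at h2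
  have h3 : l ut = c * r q - differential (2 * n) r q us := by linarith
  exact ⟨h1, h3⟩

end

/-! ### The energy estimate -/

section
variable {n : ℕ} {W : Type*} [TopologicalSpace W]
  [ChartedSpace (EuclideanSpace ℝ (Fin (2 * n))) W] [IsManifold (𝓡 (2 * n)) ∞ W]
  {Ω : DForm (2 * n) 2 W} {X : VField (2 * n) W}

/-- The energy estimate. Let `F = 1` where `u` could leave the domain, with `dF` a nonnegative
multiple of `dr` supported in a region `G` of the collar. Writing `λ = i_X Ω`, the field
`P = F (H^s(u) - λ(∂_t u) + a ν)`, `Q = F λ(∂_s u)` has divergence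
`F (E + ∂_s H^s) + a' ν F + k ((∂_s r)² + (∂_t r)²)`, where `E = Ω(∂_s u, J ∂_s u)` and
`dF = k dr`. All summands are nonnegative, and the boundary terms vanish; hence `F E = 0`. -/
theorem cutoff_comp_eq_zero (hL : IsLiouvilleField Ω X) {Hs : ℝ → W → ℝ}
    (hHs : ContMDiff (𝓘(ℝ, ℝ).prod (𝓡 (2 * n))) 𝓘(ℝ, ℝ) ∞ (fun y : ℝ × W => Hs y.1 y.2))
    (hHmono : ∀ s x, 0 ≤ deriv (fun r => Hs r x) s)
    {J : ℝ → ℝ → (x : W) → TangentSpace (𝓡 (2 * n)) x →L[ℝ] TangentSpace (𝓡 (2 * n)) x}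
    (hJ : ∀ s : ℝ, ∀ t ∈ Icc (0 : ℝ) 1, IsCompatible Ω (J s t))
    {a : ℝ → ℝ} (ha : ContDiff ℝ ∞ a) (hamono : ∀ s, 0 ≤ deriv a s) {ν : ℝ} (hν : 0 ≤ ν)
    {r F : W → ℝ}
    (hF : ContMDiff (𝓡 (2 * n)) 𝓘(ℝ, ℝ) ∞ F) (hF0 : ∀ q, 0 ≤ F q) {G : Set W}
    (hFd : ∀ q, ∃ k : ℝ, 0 ≤ k ∧ differential (2 * n) F q = k • differential (2 * n) r q ∧
      (k ≠ 0 → q ∈ G))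
    (hGH : ∀ s, ∀ q ∈ G, Hs s q = a s * (r q - ν) ∧
      differential (2 * n) (Hs s) q = a s • differential (2 * n) r q)
    (hGX : ∀ q ∈ G, differential (2 * n) r q (X q) = r q)
    (hGJ : ∀ s, ∀ t ∈ Icc (0 : ℝ) 1, ∀ q ∈ G, ∀ v : EuclideanSpace ℝ (Fin (2 * n)),
      DForm.interior X Ω q ![J s t q v] = differential (2 * n) r q v)
    {u : ℝ × ℝ → W} (hu : ContMDiffOn 𝓘(ℝ, ℝ × ℝ) (𝓡 (2 * n)) ∞ u strip)
    (hfloer : ∀ y ∈ strip,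
      mfderivWithin 𝓘(ℝ, ℝ × ℝ) (𝓡 (2 * n)) u strip y ((1, 0) : ℝ × ℝ) -
        J y.1 y.2 (u y) (mfderivWithin 𝓘(ℝ, ℝ × ℝ) (𝓡 (2 * n)) u strip y ((0, 1) : ℝ × ℝ) -
          hamField Ω (Hs y.1) (u y)) = 0)
    (hbd : ∀ s : ℝ, (DForm.interior X Ω).pullCoeff u strip ![(1, 0)] (s, 0) = 0 ∧
      (DForm.interior X Ω).pullCoeff u strip ![(1, 0)] (s, 1) = 0)
    {S : ℝ} (hS : ∀ s t, S ≤ |s| → t ∈ Icc (0 : ℝ) 1 → F (u (s, t)) = 0) :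
    ∀ y ∈ strip, F (u y) = 0 := by
  have hlam := hL.smooth_form.interior hL.smooth_field
  set lam := DForm.interior X Ω with hlamdef
  let A : ℝ × ℝ → ℝ := lam.pullCoeff u strip ![(0, 1)]
  let B : ℝ × ℝ → ℝ := lam.pullCoeff u strip ![(1, 0)]
  let h : ℝ × ℝ → ℝ := fun z => Hs z.1 (u z)
  let f : ℝ × ℝ → ℝ := fun z => F (u z)
  have hAs : ContDiffOn ℝ ∞ A strip := hlam.contDiffOn_pullCoeff uniqueDiffOn_strip hu _
  have hBs : ContDiffOn ℝ ∞ B strip := hlam.contDiffOn_pullCoeff uniqueDiffOn_strip hu _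
  have hhs : ContDiffOn ℝ ∞ h strip := by
    have h1 : ContMDiffOn 𝓘(ℝ, ℝ × ℝ) (𝓘(ℝ, ℝ).prod (𝓡 (2 * n))) ∞
        (fun z : ℝ × ℝ => ((z.1, u z) : ℝ × W)) strip :=
      (contDiff_fst.contMDiff.contMDiffOn).prodMk hu
    exact (hHs.comp_contMDiffOn h1).contDiffOn
  have hfs : ContDiffOn ℝ ∞ f strip := (hF.comp_contMDiffOn hu).contDiffOn
  have has : ContDiffOn ℝ ∞ (fun z : ℝ × ℝ => a z.1) strip :=
    (ha.comp contDiff_fst).contDiffOn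
  let P : ℝ × ℝ → ℝ := fun z => f z * (h z - A z + a z.1 * ν)
  let Q : ℝ × ℝ → ℝ := fun z => f z * B z
  have hPs : ContDiffOn ℝ ∞ P strip := hfs.mul ((hhs.sub hAs).add (has.mul contDiffOn_const))
  have hQs : ContDiffOn ℝ ∞ Q strip := hfs.mul hBs
  have hFdiff : ∀ q, MDifferentiableAt (𝓡 (2 * n)) 𝓘(ℝ, ℝ) F q := fun q =>
    (hF q).mdifferentiableAt (by simp)
  -- the divergence at an interior point
  have key : ∀ p : ℝ × ℝ, p.2 ∈ Ioo (0 : ℝ) 1 → ∃ (us : EuclideanSpace ℝ (Fin (2 * n))) (c : ℝ),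
      us = mfderivWithin 𝓘(ℝ, ℝ × ℝ) (𝓡 (2 * n)) u strip p ((1, 0) : ℝ × ℝ) ∧ 0 ≤ c ∧
      fderiv ℝ P p (1, 0) + fderiv ℝ Q p (0, 1) =
        f p * Ω (u p) ![us, J p.1 p.2 (u p) us] + c := by
    intro p hp
    have hpI : p.2 ∈ Icc (0 : ℝ) 1 := Ioo_subset_Icc_self hp
    have hps : p ∈ strip := ⟨mem_univ _, hpI⟩
    have hnh := strip_mem_nhds hp
    let us : EuclideanSpace ℝ (Fin (2 * n)) :=
      mfderivWithin 𝓘(ℝ, ℝ × ℝ) (𝓡 (2 * n)) u strip p ((1, 0) : ℝ × ℝ)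
    let ut : EuclideanSpace ℝ (Fin (2 * n)) :=
      mfderivWithin 𝓘(ℝ, ℝ × ℝ) (𝓡 (2 * n)) u strip p ((0, 1) : ℝ × ℝ)
    let j : EuclideanSpace ℝ (Fin (2 * n)) →L[ℝ] EuclideanSpace ℝ (Fin (2 * n)) := J p.1 p.2 (u p)
    let Y : EuclideanSpace ℝ (Fin (2 * n)) := hamField Ω (Hs p.1) (u p)
    have hfl : us - j (ut - Y) = 0 := hfloer p hps
    have hE : Ω (u p) ![us, j us] = differential (2 * n) (Hs p.1) (u p) us - Ω (u p) ![us, ut] :=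
      (energy_density hL.nondegenerate (hJ p.1 p.2 hpI) rfl rfl hfl).2
    have hA : A p = lam (u p) ![ut] := lam.pullCoeff_one _ _ _ _
    have hB : B p = lam (u p) ![us] := lam.pullCoeff_one _ _ _ _
    have hcurl : fderiv ℝ A p (1, 0) - fderiv ℝ B p (0, 1) = Ω (u p) ![us, ut] := by
      refine (hlam.fderiv_pullCoeff_sub hu hnh (1, 0) (0, 1)).trans ?_
      refine (lam.d.pullCoeff_two _ _ _ _ _).trans ?_
      rw [hlamdef, hL.exact]
    have hfe : ∀ e, fderiv ℝ f p e = differential (2 * n) F (u p)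
        (mfderivWithin 𝓘(ℝ, ℝ × ℝ) (𝓡 (2 * n)) u strip p e) :=
      fderiv_comp_of_strip hu hnh (hFdiff _)
    have hh1 : fderiv ℝ h p (1, 0) = deriv (fun r => Hs r (u p)) p.1 +
        differential (2 * n) (Hs p.1) (u p) us := by
      refine (fderiv_family_of_strip hu hnh hHs (1, 0)).trans ?_
      rw [one_mul]
    have hfd := (hfs.contDiffAt hnh).differentiableAt (by simp)
    have hhd := (hhs.contDiffAt hnh).differentiableAt (by simp)
    have hAd := (hAs.contDiffAt hnh).differentiableAt (by simp)
    have hBd := (hBs.contDiffAt hnh).differentiableAt (by simp)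
    have had : HasFDerivAt (fun z : ℝ × ℝ => a z.1 * ν)
        (ν • (deriv a p.1 • ContinuousLinearMap.fst ℝ ℝ ℝ)) p := by
      have h1 := ((ha.differentiable (by simp)) p.1).hasDerivAt.comp_hasFDerivAt p
        (hasFDerivAt_fst (𝕜 := ℝ) (E := ℝ) (F := ℝ) (p := p))
      exact h1.mul_const ν
    have hPd : fderiv ℝ P p (1, 0) = f p * (fderiv ℝ h p (1, 0) - fderiv ℝ A p (1, 0) +
        ν * deriv a p.1) + (h p - A p + a p.1 * ν) * fderiv ℝ f p (1, 0) := by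
      have h1 := hfd.hasFDerivAt.mul ((hhd.hasFDerivAt.sub hAd.hasFDerivAt).add had)
      have h2 : fderiv ℝ P p = _ := h1.fderiv
      rw [h2]
      simp
      ring
    have hQd : fderiv ℝ Q p (0, 1) = f p * fderiv ℝ B p (0, 1) + B p * fderiv ℝ f p (0, 1) := by
      have h2 : fderiv ℝ Q p = _ := (hfd.hasFDerivAt.mul hBd.hasFDerivAt).fderiv
      rw [h2]
      simp
    obtain ⟨k, hk0, hkd, hkG⟩ := hFd (u p)
    have hfs' : fderiv ℝ f p (1, 0) = k * differential (2 * n) r (u p) us := by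
      rw [hfe, hkd]; rfl
    have hft' : fderiv ℝ f p (0, 1) = k * differential (2 * n) r (u p) ut := by
      rw [hfe, hkd]; rfl
    -- the terms that contain the derivative of the cutoff function
    have hcut : (h p - A p + a p.1 * ν) * fderiv ℝ f p (1, 0) + B p * fderiv ℝ f p (0, 1) =
        k * (differential (2 * n) r (u p) us ^ 2 + differential (2 * n) r (u p) ut ^ 2) := by
      rw [hfs', hft']
      by_cases hk : k = 0
      · rw [hk]; ring
      · have hG := hkG hk
        obtain ⟨h1, h2⟩ := floer_collar hL.nondegenerate (hJ p.1 p.2 hpI) (r := r) (X := X)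
          rfl rfl hfl (hGJ p.1 p.2 hpI (u p) hG) (hGX _ hG) (hGH p.1 (u p) hG).2
        have h3 : A p = a p.1 * r (u p) - differential (2 * n) r (u p) us := hA.trans h2
        have h4 : B p = differential (2 * n) r (u p) ut := hB.trans h1
        have h5 : h p = a p.1 * (r (u p) - ν) := (hGH p.1 (u p) hG).1
        rw [h3, h4, h5]
        ring
    refine ⟨us, f p * deriv (fun r => Hs r (u p)) p.1 + f p * (ν * deriv a p.1) +
      k * (differential (2 * n) r (u p) us ^ 2 + differential (2 * n) r (u p) ut ^ 2), rfl, ?_, ?_⟩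
    · have h1 := mul_nonneg (hF0 (u p)) (hHmono p.1 (u p))
      have h2 := mul_nonneg (hF0 (u p)) (mul_nonneg hν (hamono p.1))
      have h3 := mul_nonneg hk0 (add_nonneg (sq_nonneg (differential (2 * n) r (u p) us))
        (sq_nonneg (differential (2 * n) r (u p) ut)))
      exact add_nonneg (add_nonneg h1 h2) h3
    · have hE' : Ω (u p) ![us, J p.1 p.2 (u p) us] =
          differential (2 * n) (Hs p.1) (u p) us - Ω (u p) ![us, ut] := hE
      rw [hE', hPd, hQd, hh1, ← hcut, ← hcurl]
      ring
  have hnn : ∀ p : ℝ × ℝ, p.2 ∈ Icc (0 : ℝ) 1 → ∀ v : EuclideanSpace ℝ (Fin (2 * n)),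
      0 ≤ Ω (u p) ![v, J p.1 p.2 (u p) v] := by
    intro p hp v
    by_cases hv : v = 0
    · subst hv
      let Bp := altBilin (E := EuclideanSpace ℝ (Fin (2 * n))) (Ω (u p))
      have h1 : ∀ w, Bp 0 w = 0 := fun w => by rw [map_zero]; rfl
      exact (h1 _).ge
    · exact ((hJ p.1 p.2 hp).pos (u p) v hv).le
  have hdiv := fun (p : ℝ × ℝ) (hp : p.2 ∈ Ioo (0 : ℝ) 1) =>
    divergence_eq_zero hPs hQs (S := S)
      (fun s t hs ht => by simp only [P, f, hS s t hs ht, zero_mul])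
      (fun s => by simp only [Q, B, (hbd s).1, mul_zero])
      (fun s => by simp only [Q, B, (hbd s).2, mul_zero])
      (fun p hp => by
        obtain ⟨us, c, -, hc, h1⟩ := key p hp
        rw [h1]
        exact add_nonneg (mul_nonneg (hF0 _) (hnn p (Ioo_subset_Icc_self hp) us)) hc) hp
  -- hence `F(u)` does not depend on `s`
  have hds : ∀ p : ℝ × ℝ, p.2 ∈ Ioo (0 : ℝ) 1 → fderiv ℝ f p (1, 0) = 0 := by
    intro p hp
    rcases (hF0 (u p)).eq_or_lt with h0 | h0
    -- where `F(u) = 0`, this is a minimum; where `F(u) > 0`, the energy density vanishes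
    · have hmin : IsLocalMin f p := Eventually.of_forall fun z => by
        change F (u p) ≤ F (u z)
        rw [← h0]; exact hF0 _
      rw [hmin.fderiv_eq_zero]; rfl
    · obtain ⟨us, c, hus, hc, h1⟩ := key p hp
      rw [hdiv p hp] at h1
      have h2 := mul_nonneg (hF0 (u p)) (hnn p (Ioo_subset_Icc_self hp) us)
      have h3 : F (u p) * Ω (u p) ![us, J p.1 p.2 (u p) us] = 0 :=
        le_antisymm (by have h4 := h1; simp only [f] at h4; linarith) h2
      have h4 := (mul_eq_zero.mp h3).resolve_left h0.ne'
      have h5 : us = 0 := by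
        by_contra hne
        exact absurd h4 ((hJ p.1 p.2 (Ioo_subset_Icc_self hp)).pos (u p) us hne).ne'
      rw [fderiv_comp_of_strip hu (strip_mem_nhds hp) (hFdiff _)]
      refine (congrArg (differential (2 * n) F (u p)) (hus.symm.trans h5)).trans ?_
      exact map_zero _
  have hint : ∀ p : ℝ × ℝ, p.2 ∈ Ioo (0 : ℝ) 1 → f p = 0 := by
    rintro ⟨s, t⟩ ht
    have hd : ∀ x, HasDerivAt (fun s => f (s, t)) 0 x := by
      intro x
      have h1 := ((hfs.contDiffAt (strip_mem_nhds (p := (x, t)) ht)).differentiableAt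
        (by simp)).hasFDerivAt
      have h2 : HasDerivAt (fun s : ℝ => (s, t)) ((1 : ℝ), (0 : ℝ)) x :=
        (hasDerivAt_id x).prodMk (hasDerivAt_const x t)
      have h3 := h1.comp_hasDerivAt x h2
      rwa [hds (x, t) ht] at h3
    have h1 := is_const_of_deriv_eq_zero (fun x => (hd x).differentiableAt)
      (fun x => (hd x).deriv) s (max S 0)
    refine h1.trans (hS _ t ?_ (Ioo_subset_Icc_self ht))
    exact (le_max_left _ _).trans (le_abs_self _)
  intro y hy
  have hcl : y ∈ closure (univ ×ˢ Ioo (0 : ℝ) 1 : Set (ℝ × ℝ)) := by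
    rw [closure_prod_eq, closure_Ioo zero_ne_one, closure_univ]; exact hy
  have hne : (𝓝[univ ×ˢ Ioo (0 : ℝ) 1] y).NeBot := mem_closure_iff_nhdsWithin_neBot.mp hcl
  refine tendsto_nhds_unique ((hfs.continuousOn y hy).mono
    (prod_mono subset_rfl Ioo_subset_Icc_self)) ?_
  refine tendsto_const_nhds.congr' ?_
  filter_upwards [self_mem_nhdsWithin] with z hz using (hint z hz.2).symm

end

/-! ### Confinement of Floer strips -/

/-- By compactness of `[0, 1]`, convergence that is locally uniform in `t` is uniform in `t`. -/
theorem eventually_forall_of_prod {l : Filter ℝ} {p : ℝ × ℝ → Prop}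
    (h : ∀ t ∈ Icc (0 : ℝ) 1, ∀ᶠ y in l ×ˢ 𝓝[Icc 0 1] t, p y) :
    ∀ᶠ s in l, ∀ t ∈ Icc (0 : ℝ) 1, p (s, t) := by
  refine isCompact_Icc.induction_on (p := fun T => ∀ᶠ s in l, ∀ t ∈ T, p (s, t)) (by simp)
    (fun T T' hT h' => h'.mono fun s hs t ht => hs t (hT ht))
    (fun T T' h1 h2 => (h1.and h2).mono fun s hs t ht => ht.elim (hs.1 t) (hs.2 t))
    fun t ht => ?_
  obtain ⟨pa, ha, pb, hb, hab⟩ := eventually_prod_iff.mp (h t ht)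
  exact ⟨{t | pb t}, hb, ha.mono fun s hs t ht => hab hs ht⟩

section
variable {n : ℕ} {W : Type*} [TopologicalSpace W] [T2Space W]
  [ChartedSpace (EuclideanSpace ℝ (Fin (2 * n))) W] [IsManifold (𝓡 (2 * n)) ∞ W]
  {Ω : DForm (2 * n) 2 W} {X : VField (2 * n) W} {M L : Set W}

/-- The Liouville form vanishes on the boundary derivative of a map with Lagrangian boundary
conditions. -/
theorem pullCoeff_boundary_eq_zero (hM : IsLiouvilleQuadruple n M Ω X L)
    (hW : IsCompletion n M Ω X) {u : ℝ × ℝ → W}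
    (hu : ContMDiffOn 𝓘(ℝ, ℝ × ℝ) (𝓡 (2 * n)) ∞ u strip) {τ : ℝ} (hτ : τ ∈ Icc (0 : ℝ) 1)
    (hL : ∀ s, u (s, τ) ∈ completedLagrangian X L) (s : ℝ) :
    (DForm.interior X Ω).pullCoeff u strip ![(1, 0)] (s, τ) = 0 := by
  have hmem : ∀ s, (s, τ) ∈ strip := fun s => ⟨mem_univ _, hτ⟩
  have hlam := hM.smooth_form.interior hM.smooth_field
  let w : ℝ → EuclideanSpace ℝ (Fin (2 * n)) := fun s =>
    mfderivWithin 𝓘(ℝ, ℝ × ℝ) (𝓡 (2 * n)) u strip (s, τ) ((1, 0) : ℝ × ℝ)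
  have heq : ∀ s, (DForm.interior X Ω).pullCoeff u strip ![(1, 0)] (s, τ) =
      DForm.interior X Ω (u (s, τ)) ![w s] := fun s => DForm.pullCoeff_one _ _ _ _ _
  rw [heq]
  refine interior_velocity_eq_zero hM hW (c := fun s => u (s, τ)) (w := w) (fun s => ?_) ?_ hL s
  · have h1 := ((hu (s, τ) (hmem s)).mdifferentiableWithinAt (by simp)).hasMFDerivWithinAt
    have h2 : HasMFDerivWithinAt 𝓘(ℝ, ℝ) 𝓘(ℝ, ℝ × ℝ) (fun r : ℝ => (r, τ)) univ s
        (ContinuousLinearMap.inl ℝ ℝ ℝ) :=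
      (hasFDerivAt_prodMk_left s τ).hasFDerivWithinAt.hasMFDerivWithinAt
    have h3 := (h1.comp s h2 fun r _ => hmem r).hasMFDerivAt univ_mem
    refine h3.congr_mfderiv (ContinuousLinearMap.ext fun (b : ℝ) => ?_)
    let A : ℝ × ℝ →L[ℝ] EuclideanSpace ℝ (Fin (2 * n)) :=
      mfderivWithin 𝓘(ℝ, ℝ × ℝ) (𝓡 (2 * n)) u strip (s, τ)
    have h4 : A (b, 0) = b • A (1, 0) := by
      rw [← map_smul]; simp
    exact h4
  · have h1 := (hlam.contDiffOn_pullCoeff uniqueDiffOn_strip hu ![(1, 0)]).continuousOn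
    have h2 : Continuous fun s : ℝ => (s, τ) := by fun_prop
    have h3 := h1.comp_continuous h2 hmem
    exact h3.congr heq

end

end LiouvilleFloer

end

theorem lemma5p1 (n : ℕ) {W : Type*} [TopologicalSpace W] [T2Space W] [SecondCountableTopology W]
    [ChartedSpace (EuclideanSpace ℝ (Fin (2 * n))) W] [IsManifold (𝓡 (2 * n)) ∞ W]
    (Ω : LiouvilleFloer.DForm (2 * n) 2 W) (X : LiouvilleFloer.VField (2 * n) W) (M L : Set W)
    (hM : LiouvilleFloer.IsLiouvilleQuadruple n M Ω X L)
    (hW : LiouvilleFloer.IsCompletion n M Ω X)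
    (Min : Set W) (hsub : Min ⊆ M)
    (hMin : LiouvilleFloer.IsLiouvilleQuadruple n Min Ω X (L ∩ Min))
    (H H' : W → ℝ)
    (hH : LiouvilleFloer.IsAdmissible M Ω X L H) (hH' : LiouvilleFloer.IsAdmissible M Ω X L H')
    (Hs : ℝ → W → ℝ) (hHs : LiouvilleFloer.IsMonotoneHomotopy M X H H' Hs)
    (J : ℝ → ℝ → (x : W) → TangentSpace (𝓡 (2 * n)) x →L[ℝ] TangentSpace (𝓡 (2 * n)) x)
    (hJ : ∀ s : ℝ, ∀ t ∈ Icc (0 : ℝ) 1, LiouvilleFloer.IsCompatible Ω (J s t))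
    (a : ℝ → ℝ) (ha : ContDiff ℝ ∞ a) (ν : ℝ) (hν0 : 0 < ν) (hν1 : ν < 1)
    (h1 : ∃ s₀ : ℝ, 0 < s₀ ∧ (∀ s ≤ -s₀, a s = a (-s₀)) ∧ (∀ s ≥ s₀, a s = a s₀) ∧
      a (-s₀) ∉ LiouvilleFloer.actionSpectrum (LiouvilleFloer.DForm.interior X Ω)
        (LiouvilleFloer.bdry (2 * n) 0 Min) (LiouvilleFloer.bdry (2 * n) n (L ∩ Min)) ∧
      a s₀ ∉ LiouvilleFloer.actionSpectrum (LiouvilleFloer.DForm.interior X Ω)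
        (LiouvilleFloer.bdry (2 * n) 0 Min) (LiouvilleFloer.bdry (2 * n) n (L ∩ Min)))
    (h2 : ∀ s : ℝ, ∀ z ∈ LiouvilleFloer.bdry (2 * n) 0 Min, ∀ ρ : ℝ, √ν < ρ → ρ ≤ 1 →
      ∀ q, LiouvilleFloer.CylCoord X z ρ q → Hs s q = a s * (ρ - ν))
    (h3 : ∀ s : ℝ, ∀ t ∈ Icc (0 : ℝ) 1,
      LiouvilleFloer.IsContactTypeOnCollar Min Ω X (√ν) (J s t))
    (xm xp : ℝ → W)
    (hxm : LiouvilleFloer.IsChord Ω (LiouvilleFloer.completedLagrangian X L) H xm)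
    (hxp : LiouvilleFloer.IsChord Ω (LiouvilleFloer.completedLagrangian X L) H' xp)
    (hxm_in : ∀ t ∈ Icc (0 : ℝ) 1, xm t ∈ Min) (hxp_in : ∀ t ∈ Icc (0 : ℝ) 1, xp t ∈ Min)
    (u : ℝ × ℝ → W)
    (hu : LiouvilleFloer.IsFloerTrajectory Ω (LiouvilleFloer.completedLagrangian X L)
      Hs J xm xp u) :
    ∀ y ∈ LiouvilleFloer.strip, u y ∈ Min := by
  open LiouvilleFloer in
  have hLF := hM.isLiouvilleField hW
  have hρ0 : 0 < √ν := Real.sqrt_pos.mpr hν0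
  have hρ1 : √ν < 1 := by rwa [Real.sqrt_lt' one_pos, one_pow]
  have h0I : (0 : ℝ) ∈ Icc (0 : ℝ) 1 := ⟨le_rfl, zero_le_one⟩
  have h1I : (1 : ℝ) ∈ Icc (0 : ℝ) 1 := ⟨zero_le_one, le_rfl⟩
  obtain ⟨r, b, hr, hb, hbmono, hHcol⟩ := hHs.exists_radial ha hν1 hρ1 h2
  have hcol : ∀ z ∈ bdry (2 * n) 0 Min, ∀ᶠ q in 𝓝 z, q ∈ Min → q ∈ collar (2 * n) X Min (√ν) := by
    intro z hz
    obtain ⟨g, f, hf, hpos⟩ := hMin.outward z hz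
    obtain ⟨D, R, ⟨φ, hφ, -, -⟩, -⟩ := h3 0 0 h0I z hz 1 hρ1 le_rfl z (cylCoord_one X z)
    rw [Real.log_one] at hφ
    exact eventually_mem_collar hM.smooth_field hf hpos hφ hρ1
  have hcollar : ∀ s, ∀ t ∈ Icc (0 : ℝ) 1, ∀ q ∈ collar (2 * n) X Min (√ν),
      differential (2 * n) r q (X q) = r q ∧ ∀ v : EuclideanSpace ℝ (Fin (2 * n)),
        DForm.interior X Ω q ![J s t q v] = differential (2 * n) r q v :=
    fun s t ht q hq => hr.liouville_comp_J hLF hMin.outward hρ0 (hJ s t ht) (h3 s t ht) hq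
  have hdr := fun q hq => (hcollar 0 0 h0I q hq).1
  -- the chords stay away from the boundary
  obtain ⟨s₀, hHm, hHp⟩ : ∃ s₀, Hs (-s₀) = H ∧ Hs s₀ = H' := by
    obtain ⟨-, _, _, _, -, s₀, -, hA, hB, -⟩ := hHs
    exact ⟨s₀, hA _ le_rfl, hB _ le_rfl⟩
  have hchord : ∀ (s : ℝ) (x : ℝ → W), IsChord Ω (completedLagrangian X L) (Hs s) x →
      IsNondegenerateChord Ω (completedLagrangian X L) (Hs s) x →
      (∀ t ∈ Icc (0 : ℝ) 1, x t ∈ Min) → ∀ t ∈ Icc (0 : ℝ) 1, x t ∈ interior Min := by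
    intro s x hx hnd hxN t ht
    have h4 := chord_notMem_bdry hr hρ1 hLF hMin.domain hMin.outward hcol hdr (hHs.smooth s)
      (hHcol s) (fun q hq => hM.field_tangent_completed hq) hx hnd hxN t ht
    rw [bdry_eq_diff_interior hMin.domain] at h4
    by_contra hi
    exact h4 ⟨hxN t ht, hi⟩
  have hxm_int : ∀ t ∈ Icc (0 : ℝ) 1, xm t ∈ interior Min := by
    subst hHm
    exact hchord _ xm hxm (hH.2 xm hxm) hxm_in
  have hxp_int : ∀ t ∈ Icc (0 : ℝ) 1, xp t ∈ interior Min := by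
    subst hHp
    exact hchord _ xp hxp (hH'.2 xp hxp) hxp_in
  -- a neighbourhood of the boundary that avoids the chords
  set C : Set W := interior {q | q ∈ Min → q ∈ collar (2 * n) X Min (√ν)} with hC
  set O : Set W := C ∩ ((xm '' Icc 0 1)ᶜ ∩ (xp '' Icc 0 1)ᶜ) with hO
  have hOopen : IsOpen O := isOpen_interior.inter
    ((isCompact_Icc.image_of_continuousOn hxm.1.continuousOn).isClosed.isOpen_compl.inter
      (isCompact_Icc.image_of_continuousOn hxp.1.continuousOn).isClosed.isOpen_compl)
  have hCcol : ∀ q ∈ C, q ∈ Min → q ∈ collar (2 * n) X Min (√ν) := fun q hq => interior_subset hq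
  have hbO : bdry (2 * n) 0 Min ⊆ O := by
    intro z hz
    have hzi : z ∉ interior Min := by
      rw [bdry_eq_diff_interior hMin.domain] at hz
      exact hz.2
    refine ⟨mem_interior_iff_mem_nhds.mpr (hcol z hz), ?_, ?_⟩
    · rintro ⟨t, ht, rfl⟩
      exact hzi (hxm_int t ht)
    · rintro ⟨t, ht, rfl⟩
      exact hzi (hxp_int t ht)
  obtain ⟨F, hFs, hF0, hF1, hFO, hFd⟩ := hr.exists_cutoff hρ1 hMin.domain hMin.compact hOopen hbO
    fun q hq => hCcol q hq.1
  have hzero_m : ∀ᶠ s in atBot, ∀ t ∈ Icc (0 : ℝ) 1, F (u (s, t)) = 0 :=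
    eventually_forall_of_prod (p := fun y => F (u y) = 0) fun t ht =>
      (hu.tendsto_atBot t ht).eventually
        (hFO _ (hxm_int t ht) fun h => h.2.1 ⟨t, ht, rfl⟩)
  have hzero_p : ∀ᶠ s in atTop, ∀ t ∈ Icc (0 : ℝ) 1, F (u (s, t)) = 0 :=
    eventually_forall_of_prod (p := fun y => F (u y) = 0) fun t ht =>
      (hu.tendsto_atTop t ht).eventually
        (hFO _ (hxp_int t ht) fun h => h.2.2 ⟨t, ht, rfl⟩)
  obtain ⟨Sm, hSm⟩ := eventually_atBot.mp hzero_m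
  obtain ⟨Sp, hSp⟩ := eventually_atTop.mp hzero_p
  have hzero := cutoff_comp_eq_zero hLF hHs.1 hHs.deriv_nonneg hJ hb hbmono hν0.le hFs hF0
    (G := Min ∩ O) hFd
    (fun s q hq => ⟨hHcol s q (hCcol q hq.2.1 hq.1),
      differential_eq_smul hMin.domain hq.1 ((hHs.smooth s q).mdifferentiableAt (by simp))
        (hr.mdifferentiableAt q) (ν := ν)
        (Filter.eventually_of_mem (isOpen_interior.mem_nhds hq.2.1)
          fun q' hq' hN => hHcol s q' (hCcol q' hq' hN))⟩)
    (fun q hq => hdr q (hCcol q hq.2.1 hq.1))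
    (fun s t ht q hq => (hcollar s t ht q (hCcol q hq.2.1 hq.1)).2)
    hu.smooth hu.floer
    (fun s => ⟨pullCoeff_boundary_eq_zero hM hW hu.smooth h0I (fun s => (hu.boundary s).1) s,
      pullCoeff_boundary_eq_zero hM hW hu.smooth h1I (fun s => (hu.boundary s).2) s⟩)
    (S := max (-Sm) Sp) (fun s t hs ht => by
      rcases le_total 0 s with h | h
      · rw [abs_of_nonneg h] at hs
        exact hSp s ((le_max_right _ _).trans hs) t ht
      · rw [abs_of_nonpos h] at hs
        exact hSm s (by linarith [(le_max_left (-Sm) Sp).trans hs]) t ht)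
  intro y hy
  by_contra hn
  have h4 := hzero y hy
  rw [hF1 _ hn] at h4
  exact one_ne_zero h4
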